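/- Let $\mathfrak H_0$ be a complex Hilbert space with inner product $(\cdot,\cdot)$ linear in the first argument, and let $B$ be a densely defined, closed, symmetric operator in $\mathfrak H_0$ that is simple (it induces a self-adjoint operator in no nonzero closed subspace) and has zero defect number in $\mathbb C_+$, i.e. $\ker(B^*-iI)=\{0\}$ (so $B$ is maximal symmetric). A spectral function of a symmetric operator $S$ in a Hilbert space is an increasing, strongly right-continuous family of bounded operators $(E_t)_{t\in\mathbb R}$ with $E_t\to0$ strongly as $t\to-\infty$ and $E_t\to I$ strongly as $t\to+\infty$, such that for all $f\in\mathcal D(S)$ one has $(Sf,f)=\int t\,d(E_tf,f)$ and $\|Sf\|^2=\int t^2\,d(E_tf,f)$, the integrals converging. For $\psi\in H^\infty(\mathbb C_+)$, extended to almost every $\delta\in\mathbb R$ by $\psi(\delta)=\lim_{y\downarrow0}\psi(\delta+iy)$, the bounded operator $\psi(S)$ is defined by $(\psi(S)f,g)=\int\psi(\delta)\,d(E_\delta f,g)$ for all $f,g$. For a Hilbert space $N$ write $W_2^1(I,N)$ for the Sobolev space of absolutely continuous $u\in L_2(I,N)$ with $u'\in L_2(I,N)$. Then: (0) $B$ has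 exactly one spectral function, and $\psi(B)$ is a well-defined bounded operator for every $\psi\in H^\infty(\mathbb C_+)$. There are a Hilbert space $N$ and a unitary $\Xi_+:\mathfrak H_0\to L_2(\mathbb R_+,N)$ with $B=\Xi_+^{-1}\,i\frac{d}{dx}\,\Xi_+$, $\mathcal D(B)=\Xi_+^{-1}\{u\in W_2^1(\mathbb R_+,N):u(0)=0\}$. (1) Let $N$ and $\Xi_+$ be any such space and unitary, let $\mathfrak H_0'$ be a Hilbert space, $\Xi_-:\mathfrak H_0'\to L_2(\mathbb R_-,N)$ a unitary, and $B'=\Xi_-^{-1}\,i\frac{d}{dx}\,\Xi_-$ with $\mathcal D(B')=\Xi_-^{-1}\{u\in W_2^1(\mathbb R_-,N):u(0)=0\}$. Put $\mathfrak H=\mathfrak H_0'\oplus\mathfrak H_0$, $\Xi=\Xi_-\oplus\Xi_+:\mathfrak H\to L_2(\mathbb R,N)$, and $A=\Xi^{-1}\,i\frac{d}{dx}\,\Xi$ with $\mathcal D(A)=\Xi^{-1}W_2^1(\mathbb R,N)$. Then $A$ is a self-adjoint extension of $B'\oplus B$, it has exactly one spectral function, which consists of orthogonal projections, $\psi(A)$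 is a well-defined bounded operator for every $\psi\in H^\infty(\mathbb C_+)$, and $$\psi(A)f=\psi(B)f\qquad\text{for all }\psi\in H^\infty(\mathbb C_+),\ f\in\mathfrak H_0.$$ (2) The following hold: (a) $\psi_1(B)\psi_2(B)=\psi_2(B)\psi_1(B)$ for all $\psi_1,\psi_2\in H^\infty(\mathbb C_+)$; (b) if $\psi\in H^\infty(\mathbb C_+)$ is inner ($|\psi(\delta)|=1$ for almost every $\delta\in\mathbb R$), then $\psi(B)$ is isometric; (c) if $\psi(\delta)=\frac1{\delta+i}$, then $\psi(B)=(B+iI)^{-1}$, an operator defined on all of $\mathfrak H_0$; (d) for every $\psi\in H^\infty(\mathbb C_+)$, $\psi(B)$ commutes with $B$: if $f\in\mathcal D(B)$, then $\psi(B)f\in\mathcal D(B)$ and $B\psi(B)f=\psi(B)Bf$. -/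

import Mathlib

open MeasureTheory Filter Topology

universe u v w

noncomputable section

namespace Plesner

/-! ### Spectral functions and integration against them -/

section Spectral

variable {H : Type*} [NormedAddCommGroup H] [InnerProductSpace ℂ H]

/-- A generalized resolution of the identity `(E_t)`, `t ∈ ℝ`, on `H`: an increasing, strongly
right-continuous family of bounded operators running strongly from `0` to the identity.
The `E_t` are positive but not required to be projections. -/
structure SpectralFamily (H : Type*) [NormedAddCommGroup H] [InnerProductSpace ℂ H] where
  toFun : ℝ → H →L[ℂ] H
  mono : ∀ s t : ℝ, s ≤ t → (toFun t - toFun s).IsPositive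
  right_cont : ∀ (f : H) (s : ℝ), ContinuousWithinAt (fun t => toFun t f) (Set.Ici s) s
  bot : ∀ f : H, Tendsto (fun t => toFun t f) atBot (𝓝 0)
  top : ∀ f : H, Tendsto (fun t => toFun t f) atTop (𝓝 f)

/-- The increasing right-continuous function `t ↦ (E_t f, f)`. -/
def SpectralFamily.stieltjes (E : SpectralFamily H) (f : H) : StieltjesFunction ℝ where
  toFun t := (inner ℂ f (E.toFun t f)).re
  mono' := by
    intro s t hst
    have h := (E.mono s t hst).re_inner_nonneg_right f
    simp only [sub_apply, inner_sub_right, map_sub,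
      RCLike.re_eq_complex_re] at h
    linarith
  right_continuous' := by
    intro s
    exact (Complex.continuous_re.comp
      (continuous_const.inner continuous_id)).continuousAt.comp_continuousWithinAt
        (E.right_cont f s)

/-- The finite positive Borel measure `d(E_t f, f)`. -/
def SpectralFamily.measure (E : SpectralFamily H) (f : H) : Measure ℝ :=
  (E.stieltjes f).measure

/-- The integral `∫ φ(t) d(E_t f, g)`. The complex measure `d(E_t f, g)` is, by polarization,
`(μ_{f+g} - μ_{f-g} + i μ_{f+ig} - i μ_{f-ig}) / 4`, where `μ_h = d(E_t h, h)`; the form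
`(E_t f, g)` is linear in `f` and is written `inner ℂ g (E_t f)` in Mathlib. -/
def SpectralFamily.integral (E : SpectralFamily H) (φ : ℝ → ℂ) (f g : H) : ℂ :=
  (1 / 4 : ℂ) *
    ((∫ t, φ t ∂E.measure (f + g)) - (∫ t, φ t ∂E.measure (f - g))
      + Complex.I * (∫ t, φ t ∂E.measure (f + Complex.I • g))
      - Complex.I * (∫ t, φ t ∂E.measure (f - Complex.I • g)))

/-- `T` is the bounded operator `∫ φ(t) dE_t`, understood weakly:
`(T f, g) = ∫ φ(t) d(E_t f, g)` for all `f, g`, all integrals being convergent. -/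
def SpectralFamily.IsIntegral (E : SpectralFamily H) (φ : ℝ → ℂ) (T : H →L[ℂ] H) : Prop :=
  (∀ f : H, Integrable φ (E.measure f)) ∧ ∀ f g : H, inner ℂ g (T f) = E.integral φ f g

/-- The spectral family is orthogonal: every `E_t` is an orthogonal projection (a positive
idempotent). -/
def SpectralFamily.IsOrthogonal (E : SpectralFamily H) : Prop :=
  ∀ t : ℝ, E.toFun t ∘L E.toFun t = E.toFun t

/-- `E` is a spectral function of the symmetric operator `B`: for `f` in the domain of `B`,
`(B f, f) = ∫ t d(E_t f, f)` and `‖B f‖² = ∫ t² d(E_t f, f)`, both integrals converging.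
(By polarization and density of the domain, the first identity amounts to
`(B f, g) = ∫ t d(E_t f, g)` for all `g`. By Naimark's dilation theorem these are exactly
the compressions to `H` of the orthogonal spectral functions of the self-adjoint extensions of `B`,
possibly acting in a larger Hilbert space.) -/
def IsSpectralFunction (B : H →ₗ.[ℂ] H) (E : SpectralFamily H) : Prop :=
  ∀ f : B.domain,
    Integrable (fun t : ℝ => t ^ 2) (E.measure (f : H)) ∧
    (((∫ t, t ∂E.measure (f : H)) : ℝ) : ℂ) = inner ℂ (f : H) (B f) ∧
    (∫ t, t ^ 2 ∂E.measure (f : H)) = ‖B f‖ ^ 2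

/-! ### Bounded analytic functions in the upper half-plane -/

/-- `ψ ∈ H^∞(ℂ₊)`. Values of `ψ` off the open upper half-plane are irrelevant. -/
def IsHInfty (ψ : ℂ → ℂ) : Prop :=
  DifferentiableOn ℂ ψ {z : ℂ | 0 < z.im} ∧ ∃ C : ℝ, ∀ z : ℂ, 0 < z.im → ‖ψ z‖ ≤ C

/-- The boundary function `ψ(x) = lim_{y ↓ 0} ψ(x + iy)` on the real line (which exists for almost
every `x` if `ψ ∈ H^∞(ℂ₊)`). -/
def boundary (ψ : ℂ → ℂ) (x : ℝ) : ℂ :=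
  limUnder (𝓝[>] (0 : ℝ)) (fun y : ℝ => ψ (x + y * Complex.I))

/-- `ψ` is an inner function of `H^∞(ℂ₊)`. -/
def IsInner (ψ : ℂ → ℂ) : Prop :=
  IsHInfty ψ ∧ ∀ᵐ x : ℝ, ‖boundary ψ x‖ = 1

open scoped Classical in
/-- The operator `ψ(B) = ∫ ψ(t) dE_t`, where `E` is the spectral function of `B` and `ψ` is taken
on the real line through its boundary values. (The value `0` is a placeholder for operators
without a spectral function against which `ψ` can be integrated.) -/
def funCalc (B : H →ₗ.[ℂ] H) (ψ : ℂ → ℂ) : H →L[ℂ] H :=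
  if h : ∃ T : H →L[ℂ] H, ∃ E : SpectralFamily H,
      IsSpectralFunction B E ∧ E.IsIntegral (boundary ψ) T
  then h.choose else 0

/-! ### Simple maximal symmetric operators -/

/-- The part of `B` in the subspace `K`: its domain is `{x ∈ K ∩ D(B) : B x ∈ K}`, on which it acts
as `B`. -/
def partIn (B : H →ₗ.[ℂ] H) (K : Submodule ℂ H) : K →ₗ.[ℂ] K :=
  (B.graph.comap (K.subtype.prodMap K.subtype)).toLinearPMap

theorem mem_graph_partIn (B : H →ₗ.[ℂ] H) (K : Submodule ℂ H) (p : K × K) :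
    p ∈ (partIn B K).graph ↔ ((p.1 : H), (p.2 : H)) ∈ B.graph := by
  rw [partIn, Submodule.toLinearPMap_graph_eq]
  · rfl
  · rintro ⟨x, y⟩ h hx
    have h' : ((x : H), (y : H)) ∈ B.graph := h
    have hx' : (x : H) = 0 := by simpa using hx
    have := B.graph_fst_eq_zero_snd h' hx'
    exact Subtype.ext this

/-- `B` is a densely defined closed symmetric operator, simple (it induces a self-adjoint operator
in no nonzero closed subspace), and it has zero defect number in `ℂ₊` (`ker (B* - i) = 0`), so that
it is maximal symmetric. -/
structure IsSimpleMaximalSymmetric [CompleteSpace H] (B : H →ₗ.[ℂ] H) : Prop where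
  dense : Dense (B.domain : Set H)
  closed : B.IsClosed
  symm : B.IsFormalAdjoint B
  simple : ∀ (K : Submodule ℂ H) [CompleteSpace K], K ≠ ⊥ → ¬ IsSelfAdjoint (partIn B K)
  defect_upper : ∀ x : B.adjoint.domain, B.adjoint x = Complex.I • (x : H) → (x : H) = 0

/-- The operator `Ξ⁻¹ T Ξ` with domain `Ξ⁻¹ D(T)`. -/
def conj {K : Type*} [NormedAddCommGroup K] [InnerProductSpace ℂ K]
    (Ξ : H ≃ₗᵢ[ℂ] K) (T : K →ₗ.[ℂ] K) : H →ₗ.[ℂ] H where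
  domain := T.domain.comap (Ξ.toLinearEquiv : H →ₗ[ℂ] K)
  toFun := (Ξ.symm.toLinearEquiv : K →ₗ[ℂ] H) ∘ₗ T.toFun ∘ₗ
    ((Ξ.toLinearEquiv : H →ₗ[ℂ] K).restrict (fun _ hx => hx))

end Spectral

/-! ### The operators `i d/dx` in `L₂(ℝ, N)` and `L₂(ℝ_±, N)` -/

section Momentum

variable {N : Type*} [NormedAddCommGroup N] [InnerProductSpace ℂ N]

/-- `L₂(S, N)`, as the subspace of `L₂(ℝ, N)` of the functions that vanish almost everywhere
off `S`. -/
def L2On (N : Type*) [NormedAddCommGroup N] [InnerProductSpace ℂ N] (S : Set ℝ) :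
    Submodule ℂ (Lp N 2 (volume : Measure ℝ)) where
  carrier := {u | ∀ᵐ x : ℝ, x ∉ S → u x = 0}
  zero_mem' := by
    filter_upwards [Lp.coeFn_zero N 2 (volume : Measure ℝ)] with x hx _
    rw [hx, Pi.zero_apply]
  add_mem' := by
    intro u v hu hv
    filter_upwards [hu, hv, Lp.coeFn_add u v] with x h1 h2 h3 hx
    rw [h3, Pi.add_apply, h1 hx, h2 hx, add_zero]
  smul_mem' := by
    intro c u hu
    filter_upwards [hu, Lp.coeFn_smul c u] with x h1 h3 hx
    rw [h3, Pi.smul_apply, h1 hx, smul_zero]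

/-- `u` is absolutely continuous with derivative `v` and value `c` at `0`:
`u(x) = c + ∫₀ˣ v(t) dt`. For `u, v ∈ L₂(ℝ, N)`, existence of such `c` and `v` means
`u ∈ W₂¹(ℝ, N)`, and then `v = du/dx`. For `u` and `v` in `L₂(ℝ_±, N)` the case `c = 0` says that
`u ∈ W₂¹(ℝ_±, N)`, `u(0) = 0` and `v = du/dx` (the other half-line contributes only `0 = 0`). -/
def IsPrimitive (c : N) (u v : Lp N 2 (volume : Measure ℝ)) : Prop :=
  ∀ᵐ x : ℝ, u x = c + ∫ t in (0 : ℝ)..x, v t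

theorem locallyIntegrable_lp (v : Lp N 2 (volume : Measure ℝ)) :
    LocallyIntegrable v volume :=
  (Lp.memLp v).locallyIntegrable (by norm_num)

theorem intervalIntegrable_lp (v : Lp N 2 (volume : Measure ℝ)) (a b : ℝ) :
    IntervalIntegrable v volume a b :=
  ((locallyIntegrable_lp v).integrableOn_isCompact isCompact_uIcc).intervalIntegrable

theorem IsPrimitive.zero : IsPrimitive (0 : N) 0 0 := by
  have h0 := Lp.coeFn_zero N 2 (volume : Measure ℝ)
  filter_upwards [h0] with x hx
  rw [hx, intervalIntegral.integral_congr_ae (g := fun _ => (0 : N))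
    (h0.mono fun y hy _ => by rw [hy]; rfl)]
  simp

theorem IsPrimitive.add {c c' : N} {u v u' v' : Lp N 2 (volume : Measure ℝ)}
    (h : IsPrimitive c u v) (h' : IsPrimitive c' u' v') :
    IsPrimitive (c + c') (u + u') (v + v') := by
  filter_upwards [h, h', Lp.coeFn_add u u'] with x h1 h2 h3
  rw [h3, Pi.add_apply, h1, h2, intervalIntegral.integral_congr_ae (f := fun t => (v + v') t)
    (g := fun t => v t + v' t)
    ((Lp.coeFn_add v v').mono fun y hy _ => by rw [hy]; rfl),
    intervalIntegral.integral_add (intervalIntegrable_lp v _ _) (intervalIntegrable_lp v' _ _)]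
  abel

theorem IsPrimitive.smul {c : N} {u v : Lp N 2 (volume : Measure ℝ)} (a : ℂ)
    (h : IsPrimitive c u v) : IsPrimitive (a • c) (a • u) (a • v) := by
  filter_upwards [h, Lp.coeFn_smul a u] with x h1 h3
  rw [h3, Pi.smul_apply, h1, intervalIntegral.integral_congr_ae (f := fun t => (a • v) t)
    (g := fun t => a • v t)
    ((Lp.coeFn_smul a v).mono fun y hy _ => by rw [hy]; rfl),
    intervalIntegral.integral_smul, smul_add]

/-- The derivative is determined by the function. -/
theorem IsPrimitive.eq_zero [CompleteSpace N] {c : N} {v : Lp N 2 (volume : Measure ℝ)}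
    (h : IsPrimitive c 0 v) : v = 0 := by
  have hc : Continuous (fun x : ℝ => c + ∫ t in (0 : ℝ)..x, v t) :=
    continuous_const.add (intervalIntegral.continuous_primitive (intervalIntegrable_lp v) 0)
  have h0 : (fun x : ℝ => c + ∫ t in (0 : ℝ)..x, v t) =ᵐ[volume] fun _ => (0 : N) := by
    filter_upwards [h, Lp.coeFn_zero N 2 (volume : Measure ℝ)] with x h1 h2
    rw [← h1, h2]; rfl
  have h1 := (hc.ae_eq_iff_eq volume continuous_const).1 h0
  have h2 : (fun x : ℝ => ∫ t in (0 : ℝ)..x, v t) = fun _ => -c := by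
    funext x
    have := congrFun h1 x
    exact eq_neg_of_add_eq_zero_right this
  rw [Lp.eq_zero_iff_ae_eq_zero]
  filter_upwards [LocallyIntegrable.ae_hasDerivAt_integral (locallyIntegrable_lp v)] with x hx
  have hx0 := hx 0
  rw [h2] at hx0
  exact hx0.unique (hasDerivAt_const x (-c))

/-- The graph of `i d/dx` on `W₂¹(ℝ, N)`. -/
def lineGraph (N : Type*) [NormedAddCommGroup N] [InnerProductSpace ℂ N] :
    Submodule ℂ (Lp N 2 (volume : Measure ℝ) × Lp N 2 (volume : Measure ℝ)) where
  carrier := {p | ∃ (c : N) (v : Lp N 2 (volume : Measure ℝ)),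
    IsPrimitive c p.1 v ∧ p.2 = Complex.I • v}
  zero_mem' := ⟨0, 0, IsPrimitive.zero, by simp⟩
  add_mem' := by
    rintro p q ⟨c, v, h, hv⟩ ⟨c', v', h', hv'⟩
    exact ⟨c + c', v + v', h.add h', by rw [Prod.snd_add, hv, hv', smul_add]⟩
  smul_mem' := by
    rintro a p ⟨c, v, h, hv⟩
    exact ⟨a • c, a • v, h.smul a, by rw [Prod.smul_snd, hv, smul_comm]⟩

/-- The operator `i d/dx` in `L₂(ℝ, N)` with domain `W₂¹(ℝ, N)`. -/
def lineMomentum (N : Type*) [NormedAddCommGroup N] [InnerProductSpace ℂ N] :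
    Lp N 2 (volume : Measure ℝ) →ₗ.[ℂ] Lp N 2 (volume : Measure ℝ) :=
  (lineGraph N).toLinearPMap

theorem graph_lineMomentum [CompleteSpace N] : (lineMomentum N).graph = lineGraph N := by
  refine Submodule.toLinearPMap_graph_eq _ ?_
  rintro ⟨u, w⟩ ⟨c, v, h, hv⟩ hu
  simp only at hu hv h
  subst hu
  rw [hv, h.eq_zero, smul_zero]

/-- The graph of `i d/dx` on `{u ∈ W₂¹(S, N) : u(0) = 0}`, for `S = ℝ₊` or `S = ℝ₋`. -/
def halfLineGraph (N : Type*) [NormedAddCommGroup N] [InnerProductSpace ℂ N] (S : Set ℝ) :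
    Submodule ℂ (L2On N S × L2On N S) where
  carrier := {p | ∃ v : L2On N S,
    IsPrimitive 0 (p.1 : Lp N 2 (volume : Measure ℝ)) v ∧ p.2 = Complex.I • v}
  zero_mem' := ⟨0, IsPrimitive.zero, by simp⟩
  add_mem' := by
    rintro p q ⟨v, h, hv⟩ ⟨v', h', hv'⟩
    exact ⟨v + v', by simpa using h.add h', by rw [Prod.snd_add, hv, hv', smul_add]⟩
  smul_mem' := by
    rintro a p ⟨v, h, hv⟩
    exact ⟨a • v, by simpa using h.smul a, by rw [Prod.smul_snd, hv, smul_comm]⟩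

/-- The operator `i d/dx` in `L₂(S, N)` with domain `{u ∈ W₂¹(S, N) : u(0) = 0}`, for `S = ℝ₊` or
`S = ℝ₋`. -/
def halfLineMomentum (N : Type*) [NormedAddCommGroup N] [InnerProductSpace ℂ N] (S : Set ℝ) :
    L2On N S →ₗ.[ℂ] L2On N S :=
  (halfLineGraph N S).toLinearPMap

theorem graph_halfLineMomentum [CompleteSpace N] (S : Set ℝ) :
    (halfLineMomentum N S).graph = halfLineGraph N S := by
  refine Submodule.toLinearPMap_graph_eq _ ?_
  rintro ⟨u, w⟩ ⟨v, h, hv⟩ hu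
  simp only at hu hv h
  subst hu
  have : v = 0 := Subtype.ext (IsPrimitive.eq_zero h)
  rw [hv, this, smul_zero]

/-! ### The unitary `Ξ = Ξ₋ ⊕ Ξ₊` -/

theorem inner_halfLines (a : L2On N (Set.Iio 0)) (b : L2On N (Set.Ioi 0)) :
    inner ℂ (a : Lp N 2 (volume : Measure ℝ)) (b : Lp N 2 (volume : Measure ℝ)) = 0 := by
  rw [L2.inner_def]
  refine integral_eq_zero_of_ae ?_
  filter_upwards [a.2, b.2] with x h1 h2
  rcases lt_or_ge x 0 with hx | hx
  · rw [h2 (by simp [hx.le])]; simp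
  · rw [h1 (by simpa using hx)]; simp

variable {H' H : Type*} [NormedAddCommGroup H'] [InnerProductSpace ℂ H']
  [NormedAddCommGroup H] [InnerProductSpace ℂ H]

/-- `(f', f) ↦ Ξ₋ f' + Ξ₊ f`, as an isometry into `L₂(ℝ, N)`. -/
def glueIsometry (Ξm : H' ≃ₗᵢ[ℂ] L2On N (Set.Iio 0)) (Ξp : H ≃ₗᵢ[ℂ] L2On N (Set.Ioi 0)) :
    WithLp 2 (H' × H) →ₗᵢ[ℂ] Lp N 2 (volume : Measure ℝ) where
  toFun p := (Ξm p.fst : Lp N 2 (volume : Measure ℝ)) + (Ξp p.snd : Lp N 2 (volume : Measure ℝ))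
  map_add' p q := by
    simp only [WithLp.add_fst, WithLp.add_snd, map_add, Submodule.coe_add]
    abel
  map_smul' c p := by
    simp only [WithLp.smul_fst, WithLp.smul_snd, map_smul, Submodule.coe_smul, smul_add,
      RingHom.id_apply]
  norm_map' p := by
    have h := norm_add_sq_eq_norm_sq_add_norm_sq_of_inner_eq_zero
      (Ξm p.fst : Lp N 2 (volume : Measure ℝ)) (Ξp p.snd : Lp N 2 (volume : Measure ℝ))
      (inner_halfLines _ _)
    have h1 : ‖(Ξm p.fst : Lp N 2 (volume : Measure ℝ))‖ = ‖p.fst‖ := Ξm.norm_map _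
    have h2 : ‖(Ξp p.snd : Lp N 2 (volume : Measure ℝ))‖ = ‖p.snd‖ := Ξp.norm_map _
    have h3 := WithLp.prod_norm_sq_eq_of_L2 p
    rw [h1, h2] at h
    refine (sq_eq_sq₀ (norm_nonneg _) (norm_nonneg _)).1 ?_
    simp only [LinearMap.coe_mk, AddHom.coe_mk]
    rw [h3, sq, h, sq, sq]

theorem glueIsometry_surjective (Ξm : H' ≃ₗᵢ[ℂ] L2On N (Set.Iio 0))
    (Ξp : H ≃ₗᵢ[ℂ] L2On N (Set.Ioi 0)) : Function.Surjective (glueIsometry Ξm Ξp) := by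
  intro u
  have hm := (Lp.memLp u).indicator (s := Set.Iio (0 : ℝ)) measurableSet_Iio
  have hp := (Lp.memLp u).indicator (s := Set.Ioi (0 : ℝ)) measurableSet_Ioi
  have mm : hm.toLp _ ∈ L2On N (Set.Iio 0) := by
    change ∀ᵐ x : ℝ, x ∉ Set.Iio (0 : ℝ) → hm.toLp _ x = 0
    filter_upwards [hm.coeFn_toLp] with x hx hxS
    rw [hx, Set.indicator_of_notMem hxS]
  have mp : hp.toLp _ ∈ L2On N (Set.Ioi 0) := by
    change ∀ᵐ x : ℝ, x ∉ Set.Ioi (0 : ℝ) → hp.toLp _ x = 0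
    filter_upwards [hp.coeFn_toLp] with x hx hxS
    rw [hx, Set.indicator_of_notMem hxS]
  refine ⟨WithLp.toLp 2 (Ξm.symm ⟨_, mm⟩, Ξp.symm ⟨_, mp⟩), ?_⟩
  change (Ξm (Ξm.symm ⟨_, mm⟩) : Lp N 2 (volume : Measure ℝ))
    + (Ξp (Ξp.symm ⟨_, mp⟩) : Lp N 2 (volume : Measure ℝ)) = u
  rw [Ξm.apply_symm_apply, Ξp.apply_symm_apply]
  refine Lp.ext ?_
  have hne : ∀ᵐ x : ℝ, x ≠ 0 := by simp [ae_iff]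
  filter_upwards [Lp.coeFn_add (hm.toLp _) (hp.toLp _), hm.coeFn_toLp, hp.coeFn_toLp, hne]
    with x h1 h2 h3 h4
  rw [h1, Pi.add_apply, h2, h3]
  rcases lt_or_gt_of_ne h4 with hx | hx
  · rw [Set.indicator_of_mem (show x ∈ Set.Iio (0 : ℝ) from hx),
      Set.indicator_of_notMem (by simp [hx.le]), add_zero]
  · rw [Set.indicator_of_notMem (by simp [hx.le]),
      Set.indicator_of_mem (show x ∈ Set.Ioi (0 : ℝ) from hx), zero_add]

/-- The unitary `Ξ = Ξ₋ ⊕ Ξ₊` from the orthogonal sum `H' ⊕ H` onto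
`L₂(ℝ, N) = L₂(ℝ₋, N) ⊕ L₂(ℝ₊, N)`. -/
def glue (Ξm : H' ≃ₗᵢ[ℂ] L2On N (Set.Iio 0)) (Ξp : H ≃ₗᵢ[ℂ] L2On N (Set.Ioi 0)) :
    WithLp 2 (H' × H) ≃ₗᵢ[ℂ] Lp N 2 (volume : Measure ℝ) :=
  LinearIsometryEquiv.ofSurjective (glueIsometry Ξm Ξp) (glueIsometry_surjective Ξm Ξp)

/-- The operator `A = Ξ⁻¹ (i d/dx) Ξ` in `H' ⊕ H`, with domain `Ξ⁻¹ W₂¹(ℝ, N)`. -/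
def extensionA (Ξm : H' ≃ₗᵢ[ℂ] L2On N (Set.Iio 0)) (Ξp : H ≃ₗᵢ[ℂ] L2On N (Set.Ioi 0)) :
    WithLp 2 (H' × H) →ₗ.[ℂ] WithLp 2 (H' × H) :=
  conj (glue Ξm Ξp) (lineMomentum N)

end Momentum

end Plesner

end

set_option linter.unusedSectionVars false

noncomputable section

namespace Plesner

/-! ### Riemann sums of a spectral family -/

section Riemann

variable {H : Type*} [NormedAddCommGroup H] [InnerProductSpace ℂ H]

namespace SpectralFamily

/-! The Cayley transform `V = 1 - 2iR`, with `R = (B + i)⁻¹`, carries the argument. Vanishing of the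
defect number in the upper half-plane says that `B + i` is onto (`exists_resolvent`), so `V` is an
everywhere defined isometry. The vectors orthogonal to all `Vⁿ (ran V)ᗮ` form a closed subspace that
`V` maps onto itself. The part of `B` there is self-adjoint, so simplicity makes this subspace zero
and `V` is a unilateral shift (`IsSimpleMaximalSymmetric.isShift`). The Cayley transform of `i d/dx`
on the right half-line is a shift too, its wandering subspace being the functions `e^{-x} c`
(`isShift_halfLine`). Shifts of equal multiplicity are unitarily equivalent, and an operator is
recovered from its Cayley transform; this gives the half-line realization.

After the Fourier transform, `i d/dx` on the line is multiplication by `symbol ξ = -2πξ`. On the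
half-line the resolvent at `-i` is the restriction of the resolvent on the line, because the latter
is causal. Both operators therefore fit the pattern `IsModel`: an isometry `ι` into `L₂(ℝ, N)`
carries `R` to multiplication by `1 / (symbol + i)`. Compressing the spectral projections of the
multiplication along `ι` gives a spectral function (`IsModel.isSpectralFunction`).

For uniqueness, Cauchy–Schwarz and the identity for `‖B f‖²` give `∫ φ d(E B f, h) = ∫ t φ d(E f,
h)` for any spectral function `E` (`integral_apply`). Hence `∫ cayleyⁿ d(E f, g) = (Vⁿ f, g)`, and
these moments determine a finite measure (`measure_ext_of_cayley`).

Finally, Fatou's theorem and Taylor expansion in the disc exhibit the boundary function of `ψ ∈ H^∞`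
as an iterated bounded almost everywhere limit of polynomials in the Cayley function
(`boundary_induction`). The range of `ι` is closed and invariant under multiplication by the Cayley
function, hence under multiplication by the boundary values of `ψ`. So `ψ(B)` is a restriction of a
multiplication operator, not merely a compression (`map_funCalc`). Commutation, isometry and
agreement with `ψ(A)` then become pointwise statements about multipliers. -/

theorem re_inner_tendsto_bot (E : SpectralFamily H) (f : H) :
    Tendsto (E.stieltjes f) atBot (𝓝 0) := by
  have h := (Complex.continuous_re.tendsto _).comp
    ((tendsto_const_nhds (x := f)).inner (𝕜 := ℂ) (E.bot f))
  rw [inner_zero_right] at h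
  exact h

theorem re_inner_tendsto_top (E : SpectralFamily H) (f : H) :
    Tendsto (E.stieltjes f) atTop (𝓝 (‖f‖ ^ 2)) := by
  have h := (Complex.continuous_re.tendsto _).comp
    ((tendsto_const_nhds (x := f)).inner (𝕜 := ℂ) (E.top f))
  rw [inner_self_eq_norm_sq_to_K] at h
  norm_cast at h

theorem measure_univ (E : SpectralFamily H) (f : H) :
    E.measure f Set.univ = ENNReal.ofReal (‖f‖ ^ 2) := by
  rw [SpectralFamily.measure, StieltjesFunction.measure_univ _ (E.re_inner_tendsto_bot f)
    (E.re_inner_tendsto_top f), sub_zero]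

instance (E : SpectralFamily H) (f : H) : IsFiniteMeasure (E.measure f) :=
  ⟨by rw [E.measure_univ f]; exact ENNReal.ofReal_lt_top⟩

theorem measure_Ioc (E : SpectralFamily H) (f : H) (a b : ℝ) (hab : a ≤ b) :
    ((E.measure f).real (Set.Ioc a b) : ℂ) = inner ℂ f ((E.toFun b - E.toFun a) f) := by
  have hp := (E.mono a b hab).inner_nonneg_right f
  have h0 := (E.stieltjes f).mono hab
  rw [Measure.real, SpectralFamily.measure, StieltjesFunction.measure_Ioc,
    ENNReal.toReal_ofReal (by linarith)]
  -- Positivity of the increment makes this inner product real, so taking real parts loses nothing.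
  have hre : ((inner ℂ f ((E.toFun b - E.toFun a) f)).re : ℂ)
      = inner ℂ f ((E.toFun b - E.toFun a) f) :=
    (Complex.eq_re_of_ofReal_le (r := 0) (by rw [Complex.ofReal_zero]; exact hp)).symm
  rw [← hre]
  congr 1
  simp only [sub_apply, inner_sub_right, Complex.sub_re]
  rfl

/-- The increment of `E` over the `k`-th interval of length `1 / n`. -/
def increment (E : SpectralFamily H) (n : ℕ) (k : ℤ) : H →L[ℂ] H :=
  E.toFun (((k : ℝ) + 1) / n) - E.toFun ((k : ℝ) / n)

theorem increment_isPositive (E : SpectralFamily H) (n : ℕ) (k : ℤ) :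
    (E.increment n k).IsPositive :=
  E.mono _ _ (by gcongr; linarith)

/-- The indices of the intervals of length `1 / n` in `(-n, n]`. -/
def indices (n : ℕ) : Finset ℤ := Finset.Ico (-(n : ℤ) ^ 2) ((n : ℤ) ^ 2)

/-- The Riemann sum for `∫ φ(t) dE_t` with mesh `1 / n` on `(-n, n]`. -/
def riemannSum (E : SpectralFamily H) (n : ℕ) (φ : ℝ → ℂ) : H →L[ℂ] H :=
  ∑ k ∈ indices n, φ ((k : ℝ) / n) • E.increment n k

theorem inner_riemannSum (E : SpectralFamily H) (n : ℕ) (φ : ℝ → ℂ) (f g : H) :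
    inner ℂ g (E.riemannSum n φ f)
      = ∑ k ∈ indices n, φ ((k : ℝ) / n) * inner ℂ g (E.increment n k f) := by
  simp [riemannSum]

end SpectralFamily

open SpectralFamily in
/-- The step function that approximates `φ` on `(-n, n]` with mesh `1 / n`. -/
def stepFun (n : ℕ) (φ : ℝ → ℂ) (t : ℝ) : ℂ :=
  ∑ k ∈ indices n, (Set.Ioc ((k : ℝ) / n) (((k : ℝ) + 1) / n)).indicator
    (fun _ => φ ((k : ℝ) / n)) t

open SpectralFamily in
-- The intervals are open on the left and closed on the right, so the one that contains `t` has
-- index `⌈n t⌉ - 1`, and the sum collapses to at most one term.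
theorem stepFun_eq {n : ℕ} (hn : 0 < n) (φ : ℝ → ℂ) (t : ℝ) :
    stepFun n φ t = if ⌈n * t⌉ - 1 ∈ indices n then φ (((⌈n * t⌉ - 1 : ℤ) : ℝ) / n) else 0 := by
  have hn' : (0 : ℝ) < n := by exact_mod_cast hn
  have h : ∀ k ∈ indices n, (Set.Ioc ((k : ℝ) / n) (((k : ℝ) + 1) / n)).indicator
      (fun _ => φ ((k : ℝ) / n)) t = if ⌈n * t⌉ - 1 = k then φ ((k : ℝ) / n) else 0 := by
    intro k _
    rw [Set.indicator_apply]
    refine if_congr ?_ rfl rfl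
    rw [Set.mem_Ioc, div_lt_iff₀ hn', le_div_iff₀ hn', sub_eq_iff_eq_add, Int.ceil_eq_iff]
    push_cast
    rw [mul_comm t, add_sub_cancel_right]
  rw [stepFun, Finset.sum_congr rfl h, Finset.sum_ite_eq]

open SpectralFamily in
theorem mem_indices_of_abs_lt {n : ℕ} {t : ℝ} (h : |t| < n) : ⌈n * t⌉ - 1 ∈ indices n := by
  have hn' : (0 : ℝ) < n := (abs_nonneg t).trans_lt h
  obtain ⟨h1, h2⟩ := abs_lt.1 h
  rw [indices, Finset.mem_Ico]
  have e1 : -(n : ℤ) ^ 2 < ⌈n * t⌉ := by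
    rw [Int.lt_ceil]; push_cast; nlinarith
  have e2 : ⌈n * t⌉ ≤ (n : ℤ) ^ 2 := by
    rw [Int.ceil_le]; push_cast; nlinarith
  omega

theorem abs_ceil_sub_one_div_sub_le {n : ℕ} (hn : 0 < n) (t : ℝ) :
    |((⌈n * t⌉ - 1 : ℤ) : ℝ) / n - t| ≤ 1 / n := by
  have hn' : (0 : ℝ) < n := by exact_mod_cast hn
  have h1 := Int.le_ceil (n * t)
  have h2 := Int.ceil_lt_add_one (n * t)
  have : ((⌈n * t⌉ - 1 : ℤ) : ℝ) / n - t = (⌈n * t⌉ - 1 - n * t) / n := by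
    push_cast; field_simp
  rw [this, abs_div, abs_of_pos hn']
  gcongr
  rw [abs_le]
  constructor <;> linarith

theorem tendsto_stepFun {φ : ℝ → ℂ} (hφ : Continuous φ) (t : ℝ) :
    Tendsto (fun n => stepFun n φ t) atTop (𝓝 (φ t)) := by
  have h1 : Tendsto (fun n : ℕ => ((⌈n * t⌉ - 1 : ℤ) : ℝ) / n) atTop (𝓝 t) := by
    rw [tendsto_iff_dist_tendsto_zero]
    refine squeeze_zero' (Eventually.of_forall fun _ => dist_nonneg) ?_
      tendsto_one_div_atTop_nhds_zero_nat
    filter_upwards [eventually_gt_atTop 0] with n hn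
    exact abs_ceil_sub_one_div_sub_le hn t
  refine ((hφ.tendsto t).comp h1).congr' ?_
  obtain ⟨m, hm⟩ := exists_nat_gt |t|
  filter_upwards [eventually_ge_atTop (m + 1)] with n hn
  have hmn : |t| < n := hm.trans (by exact_mod_cast hn)
  rw [stepFun_eq (by omega), if_pos (mem_indices_of_abs_lt hmn)]
  rfl

/-- The sample point lies within `1 / n ≤ 1` of `t`, so bounds of `φ` on unit neighbourhoods
dominate all step functions at once. This form is needed for the unbounded integrands `t` and `t²`.
-/
theorem norm_stepFun_le {n : ℕ} (hn : 0 < n) {φ : ℝ → ℂ} {t C : ℝ} (hC : 0 ≤ C)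
    (h : ∀ s, |s - t| ≤ 1 → ‖φ s‖ ≤ C) : ‖stepFun n φ t‖ ≤ C := by
  rw [stepFun_eq hn]
  split_ifs
  · refine h _ ((abs_ceil_sub_one_div_sub_le hn t).trans ?_)
    rw [div_le_one (by exact_mod_cast hn)]
    exact_mod_cast hn
  · simpa using hC

theorem measurable_stepFun (n : ℕ) (φ : ℝ → ℂ) : Measurable (stepFun n φ) := by
  unfold stepFun
  exact Finset.measurable_fun_sum _ fun k _ => measurable_const.indicator measurableSet_Ioc

theorem integral_stepFun (μ : Measure ℝ) [IsFiniteMeasure μ] (n : ℕ) (φ : ℝ → ℂ) :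
    ∫ t, stepFun n φ t ∂μ = ∑ k ∈ SpectralFamily.indices n,
      μ.real (Set.Ioc ((k : ℝ) / n) (((k : ℝ) + 1) / n)) * φ ((k : ℝ) / n) := by
  unfold stepFun
  rw [integral_finsetSum _ fun k _ => (integrable_const _).indicator measurableSet_Ioc]
  refine Finset.sum_congr rfl fun k _ => ?_
  rw [integral_indicator_const _ measurableSet_Ioc, Complex.real_smul]

namespace SpectralFamily

theorem inner_self_riemannSum (E : SpectralFamily H) (n : ℕ) (φ : ℝ → ℂ) (f : H) :
    inner ℂ f (E.riemannSum n φ f) = ∫ t, stepFun n φ t ∂E.measure f := by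
  rw [inner_riemannSum, integral_stepFun]
  refine Finset.sum_congr rfl fun k _ => ?_
  rw [E.measure_Ioc f _ _ (by gcongr; linarith), mul_comm]
  rfl

theorem tendsto_inner_self_riemannSum (E : SpectralFamily H) {φ : ℝ → ℂ} (hφ : Continuous φ)
    {f : H} {b : ℝ → ℝ} (hb : Integrable b (E.measure f))
    (hφb : ∀ t s, |s - t| ≤ 1 → ‖φ s‖ ≤ b t) :
    Tendsto (fun n => inner ℂ f (E.riemannSum n φ f)) atTop (𝓝 (∫ t, φ t ∂E.measure f)) := by
  simp only [inner_self_riemannSum]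
  refine tendsto_integral_filter_of_dominated_convergence b
    (Eventually.of_forall fun n => (measurable_stepFun n φ).aestronglyMeasurable) ?_ hb
    (Eventually.of_forall fun t => tendsto_stepFun hφ t)
  filter_upwards [eventually_gt_atTop 0] with n hn
  exact Eventually.of_forall fun t => norm_stepFun_le hn
    ((norm_nonneg _).trans (hφb t t (by simp))) (hφb t)

end SpectralFamily

theorem inner_polarization (T : H →L[ℂ] H) (f g : H) :
    inner ℂ g (T f) = (1 / 4 : ℂ) * (inner ℂ (f + g) (T (f + g)) - inner ℂ (f - g) (T (f - g))
      + Complex.I * inner ℂ (f + Complex.I • g) (T (f + Complex.I • g))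
      - Complex.I * inner ℂ (f - Complex.I • g) (T (f - Complex.I • g))) := by
  have hI := Complex.I_sq
  simp only [map_add, map_sub, map_smul, inner_add_left, inner_add_right, inner_sub_left,
    inner_sub_right, inner_smul_left, inner_smul_right, Complex.conj_I]
  linear_combination (1/2 * inner ℂ g (T f) - 1/2 * inner ℂ f (T g)) * hI

namespace SpectralFamily

theorem tendsto_inner_riemannSum (E : SpectralFamily H) {φ : ℝ → ℂ} (hφ : Continuous φ) {C : ℝ}
    (hC : ∀ t, ‖φ t‖ ≤ C) (f g : H) :
    Tendsto (fun n => inner ℂ g (E.riemannSum n φ f)) atTop (𝓝 (E.integral φ f g)) := by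
  have h (x : H) := E.tendsto_inner_self_riemannSum hφ (f := x) (integrable_const C)
    fun _ s _ => hC s
  unfold SpectralFamily.integral
  simp only [inner_polarization _ f g]
  exact ((((h _).sub (h _)).add ((h _).const_mul _)).sub ((h _).const_mul _)).const_mul _

theorem integral_self (E : SpectralFamily H) {φ : ℝ → ℂ} (hφ : Continuous φ) {C : ℝ}
    (hC : ∀ t, ‖φ t‖ ≤ C) (f : H) : E.integral φ f f = ∫ t, φ t ∂E.measure f :=
  tendsto_nhds_unique (E.tendsto_inner_riemannSum hφ hC f f)
    (E.tendsto_inner_self_riemannSum hφ (integrable_const C) fun _ s _ => hC s)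

/-- Linearity is not visible in the polarized definition of the integral; it is inherited from the
Riemann sums, which are operators. -/
theorem integral_sub_smul (E : SpectralFamily H) {φ : ℝ → ℂ} (hφ : Continuous φ) {C : ℝ}
    (hC : ∀ t, ‖φ t‖ ≤ C) (f₁ f₂ g : H) (c : ℂ) :
    E.integral φ (f₁ - c • f₂) g = E.integral φ f₁ g - c * E.integral φ f₂ g := by
  refine tendsto_nhds_unique (E.tendsto_inner_riemannSum hφ hC _ g) ?_
  refine ((E.tendsto_inner_riemannSum hφ hC f₁ g).sub
    ((E.tendsto_inner_riemannSum hφ hC f₂ g).const_mul c)).congr fun n => ?_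
  rw [map_sub, map_smul, inner_sub_right, inner_smul_right]

theorem integral_fun_sub_smul (E : SpectralFamily H) {φ χ : ℝ → ℂ} (hφ : Continuous φ) {C : ℝ}
    (hC : ∀ t, ‖φ t‖ ≤ C) (hχ : Continuous χ) {D : ℝ} (hD : ∀ t, ‖χ t‖ ≤ D) (f g : H) (c : ℂ) :
    E.integral (fun t => φ t - c * χ t) f g = E.integral φ f g - c * E.integral χ f g := by
  have hb : ∀ t, ‖φ t - c * χ t‖ ≤ C + ‖c‖ * D := fun t =>
    (norm_sub_le _ _).trans (add_le_add (hC t) (by rw [norm_mul]; gcongr; exact hD t))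
  refine tendsto_nhds_unique (E.tendsto_inner_riemannSum (by fun_prop) hb f g) ?_
  refine ((E.tendsto_inner_riemannSum hφ hC f g).sub
    ((E.tendsto_inner_riemannSum hχ hD f g).const_mul c)).congr fun n => ?_
  simp only [inner_riemannSum, Finset.mul_sum, ← Finset.sum_sub_distrib]
  exact Finset.sum_congr rfl fun k _ => by ring

theorem integral_one (E : SpectralFamily H) (f g : H) :
    E.integral (fun _ => 1) f g = inner ℂ g f := by
  have h (x : H) : ∫ _, (1 : ℂ) ∂E.measure x = inner ℂ x x := by
    rw [integral_const, Measure.real, E.measure_univ, ENNReal.toReal_ofReal (by positivity),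
      inner_self_eq_norm_sq_to_K]
    simp
  have := inner_polarization (ContinuousLinearMap.id ℂ H) f g
  simp only [ContinuousLinearMap.id_apply] at this
  rw [this, SpectralFamily.integral, h, h, h, h]

end SpectralFamily

/-- Cauchy–Schwarz for the semi-inner product `∑ₖ ⟨aₖ, Tₖ bₖ⟩` on families of vectors. Letting the
vectors vary with `k` allows a factor depending on the sample point, as in `B f - tₖ f`. -/
theorem norm_sum_inner_le {ι : Type*} (s : Finset ι) (T : ι → H →L[ℂ] H)
    (hT : ∀ k, (T k).IsPositive) (x y : ι → H) :
    ‖∑ k ∈ s, inner ℂ (y k) (T k (x k))‖ ^ 2 ≤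
      (∑ k ∈ s, inner ℂ (y k) (T k (y k))).re * (∑ k ∈ s, inner ℂ (x k) (T k (x k))).re := by
  let core : PreInnerProductSpace.Core ℂ (ι → H) :=
    { inner := fun a b => ∑ k ∈ s, inner ℂ (a k) (T k (b k))
      conj_inner_symm := fun a b => by
        simp only [map_sum, inner_conj_symm]
        exact Finset.sum_congr rfl fun k _ => (hT k).inner_left_eq_inner_right _ _
      re_inner_nonneg := fun a => by
        simp only [map_sum]
        exact Finset.sum_nonneg fun k _ => (hT k).re_inner_nonneg_right _
      add_left := fun a b c => by
        simp [Finset.sum_add_distrib]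
      smul_left := fun a b r => by
        simp only [Pi.smul_apply, inner_smul_left, Finset.mul_sum] }
  have h := @InnerProductSpace.Core.inner_mul_inner_self_le ℂ (ι → H) _ _ _ core y x
  have e : ‖core.inner x y‖ = ‖core.inner y x‖ := by
    rw [← core.conj_inner_symm x y, RCLike.norm_conj]
  have h' : ‖core.inner y x‖ * ‖core.inner x y‖ ≤ (core.inner y y).re * (core.inner x x).re := h
  rw [e, ← sq] at h'
  exact h'

end Riemann

/-! ### The Cayley function -/

/-- The Cayley function `(t - i) / (t + i)`. -/
def cayley (t : ℝ) : ℂ := (t - Complex.I) / (t + Complex.I)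

theorem ofReal_add_I_ne_zero (t : ℝ) : (t : ℂ) + Complex.I ≠ 0 := fun h => by
  simpa using congrArg Complex.im h

theorem ofReal_sub_I_ne_zero (t : ℝ) : (t : ℂ) - Complex.I ≠ 0 := fun h => by
  simpa using congrArg Complex.im h

theorem norm_ofReal_sub_I (t : ℝ) : ‖(t : ℂ) - Complex.I‖ = ‖(t : ℂ) + Complex.I‖ := by
  rw [← RCLike.norm_conj ((t : ℂ) - Complex.I)]
  simp [Complex.conj_ofReal, Complex.conj_I]

theorem norm_cayley (t : ℝ) : ‖cayley t‖ = 1 := by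
  rw [cayley, norm_div, norm_ofReal_sub_I, div_self]
  simpa using ofReal_add_I_ne_zero t

theorem continuous_cayley : Continuous cayley := by
  unfold cayley
  exact Continuous.div (by fun_prop) (by fun_prop) ofReal_add_I_ne_zero

/-- The scalar counterpart of `V = 1 - 2iR`. -/
theorem cayley_eq (t : ℝ) : cayley t = 1 - 2 * Complex.I * (1 / (t + Complex.I)) := by
  rw [cayley]
  field_simp [ofReal_add_I_ne_zero t]
  ring

theorem cayley_injective : Function.Injective cayley := by
  intro s t h
  rw [cayley_eq, cayley_eq] at h
  have h1 : (1 : ℂ) / (s + Complex.I) = 1 / (t + Complex.I) := by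
    have h2 : 2 * Complex.I * (1 / ((s : ℂ) + Complex.I)) =
      2 * Complex.I * (1 / ((t : ℂ) + Complex.I)) := by linear_combination -h
    exact mul_left_cancel₀ (by simp) h2
  rw [one_div, one_div, inv_inj] at h1
  exact_mod_cast add_right_cancel h1

theorem norm_one_div_add_I_le (t : ℝ) : ‖1 / ((t : ℂ) + Complex.I)‖ ≤ 1 := by
  rw [norm_div, norm_one, div_le_one (by simpa using ofReal_add_I_ne_zero t)]
  have := Complex.abs_im_le_norm ((t : ℂ) + Complex.I)
  simpa using this

/-- The Cayley function as a bounded continuous function. -/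
def cayleyBCF : BoundedContinuousFunction ℝ ℂ :=
  BoundedContinuousFunction.ofNormedAddCommGroup cayley continuous_cayley 1
    fun t => (norm_cayley t).le

theorem star_cayley_mul (t : ℝ) : star (cayley t) * cayley t = 1 := by
  have := RCLike.conj_mul (cayley t)
  rw [norm_cayley] at this
  simpa using this

/-- On the unit circle conjugation is inversion, so a mixed monomial is a power of the Cayley
function or the conjugate of one. -/
theorem integral_cayley_star_pow_mul_pow {μ ν : Measure ℝ}
    (h : ∀ n : ℕ, ∫ t, cayley t ^ n ∂μ = ∫ t, cayley t ^ n ∂ν) (a b : ℕ) :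
    ∫ t, star (cayley t) ^ a * cayley t ^ b ∂μ = ∫ t, star (cayley t) ^ a * cayley t ^ b ∂ν := by
  rcases le_total a b with hab | hab
  · obtain ⟨c, rfl⟩ := Nat.exists_eq_add_of_le hab
    have e : ∀ t, star (cayley t) ^ a * cayley t ^ (a + c) = cayley t ^ c := fun t => by
      rw [pow_add, ← mul_assoc, ← mul_pow, star_cayley_mul, one_pow, one_mul]
    simp only [e, h]
  · obtain ⟨c, rfl⟩ := Nat.exists_eq_add_of_le hab
    have e : ∀ t, star (cayley t) ^ (b + c) * cayley t ^ b = star (cayley t ^ c) := fun t => by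
      rw [pow_add, mul_right_comm, ← mul_pow, star_cayley_mul, one_pow, one_mul, star_pow]
    simp only [e]
    have e2 (ρ : Measure ℝ) : ∫ t, star (cayley t ^ c) ∂ρ = star (∫ t, cayley t ^ c ∂ρ) :=
      integral_conj
    rw [e2, e2, h]

/-- A finite measure on the line is determined by the integrals of the powers of the Cayley
function. -/
theorem measure_ext_of_cayley {μ ν : Measure ℝ} [IsFiniteMeasure μ] [IsFiniteMeasure ν]
    (h : ∀ n : ℕ, ∫ t, cayley t ^ n ∂μ = ∫ t, cayley t ^ n ∂ν) : μ = ν := by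
  -- Injectivity of the Cayley function makes the star algebra generated by it separate points. Its
  -- elements are linear combinations of mixed monomials in the function and its conjugate.
  refine ext_of_forall_mem_subalgebra_integral_eq_of_polish (𝕜 := ℂ)
    (A := StarAlgebra.adjoin ℂ {cayleyBCF}) ?_ ?_
  · intro s t hst
    refine ⟨cayley, ⟨⟨cayley, continuous_cayley⟩, ?_, rfl⟩, fun e => hst (cayley_injective e)⟩
    exact ⟨cayleyBCF, StarAlgebra.subset_adjoin ℂ _ rfl, rfl⟩
  · intro g hg
    have hg' : g ∈ Submodule.span ℂ
        ((Submonoid.closure ({cayleyBCF} ∪ star {cayleyBCF}) :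
          Submonoid (BoundedContinuousFunction ℝ ℂ)) : Set (BoundedContinuousFunction ℝ ℂ)) := by
      rw [← Algebra.adjoin_eq_span, ← StarAlgebra.adjoin_toSubalgebra]
      exact hg
    clear hg
    induction hg' using Submodule.span_induction with
    | mem x hx =>
      have : ∃ a b : ℕ, ∀ t, x t = star (cayley t) ^ a * cayley t ^ b := by
        induction hx using Submonoid.closure_induction with
        | mem x hx =>
          rcases hx with hx | hx
          · rw [Set.mem_singleton_iff] at hx
            exact ⟨0, 1, fun t => by rw [hx]; simp; rfl⟩
          · rw [Set.star_singleton, Set.mem_singleton_iff] at hx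
            exact ⟨1, 0, fun t => by rw [hx]; simp; rfl⟩
        | one => exact ⟨0, 0, fun t => by simp⟩
        | mul x y _ _ h1 h2 =>
          obtain ⟨a, b, h1⟩ := h1
          obtain ⟨c, d, h2⟩ := h2
          exact ⟨a + c, b + d, fun t => by
            rw [BoundedContinuousFunction.mul_apply, h1, h2]; ring⟩
      obtain ⟨a, b, e⟩ := this
      simp only [e]
      exact integral_cayley_star_pow_mul_pow h a b
    | zero => simp
    | add x y _ _ h1 h2 =>
      simp only [BoundedContinuousFunction.add_apply]
      rw [integral_add (x.integrable _) (y.integrable _),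
        integral_add (x.integrable _) (y.integrable _), h1, h2]
    | smul c x _ h1 =>
      simp only [BoundedContinuousFunction.smul_apply]
      rw [integral_smul, integral_smul, h1]

/-! ### Uniqueness of the spectral function -/

section Uniqueness

variable {H : Type*} [NormedAddCommGroup H] [InnerProductSpace ℂ H]

/-- `R` is the inverse of `B + i`, defined on the whole space. -/
def IsResolvent (B : H →ₗ.[ℂ] H) (R : H →L[ℂ] H) : Prop :=
  ∀ p : H × H, p ∈ B.graph ↔ ∃ h : H, p = (R h, h - Complex.I • R h)

namespace IsSpectralFunction

variable {B : H →ₗ.[ℂ] H} {E : SpectralFamily H}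

/-- With `c = 3` this dominates the Riemann sums of both `t` and `t²`: if `|s - t| ≤ 1`, then `|s|`
and `s²` are at most `3 + 4 t²`. -/
theorem integrable_sq (hE : IsSpectralFunction B E) (f : B.domain) (c : ℝ) :
    Integrable (fun t : ℝ => c + 4 * t ^ 2) (E.measure (f : H)) :=
  (integrable_const c).add ((hE f).1.const_mul 4)

theorem tendsto_inner_self_riemannSum_id (hE : IsSpectralFunction B E) (f : B.domain) :
    Tendsto (fun n => inner ℂ (f : H) (E.riemannSum n (fun t => (t : ℂ)) (f : H))) atTop
      (𝓝 (inner ℂ (f : H) (B f))) := by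
  have h := E.tendsto_inner_self_riemannSum (φ := fun t => (t : ℂ)) (by fun_prop)
    (hE.integrable_sq f 3) (fun t s hts => by
      rw [Complex.norm_real, Real.norm_eq_abs]
      have := abs_sub_abs_le_abs_sub s t
      nlinarith [sq_nonneg (|t| - 1), sq_abs t, abs_nonneg t])
  rwa [integral_complex_ofReal, (hE f).2.1] at h

theorem tendsto_inner_self_riemannSum_sq (hE : IsSpectralFunction B E) (f : B.domain) :
    Tendsto (fun n => inner ℂ (f : H) (E.riemannSum n (fun t => ((t ^ 2 : ℝ) : ℂ)) (f : H))) atTop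
      (𝓝 (((‖B f‖ ^ 2 : ℝ) : ℂ))) := by
  have h := E.tendsto_inner_self_riemannSum (φ := fun t => ((t ^ 2 : ℝ) : ℂ)) (by fun_prop)
    (hE.integrable_sq f 3) (fun t s hts => by
      rw [Complex.norm_real, Real.norm_eq_abs, abs_of_nonneg (sq_nonneg s)]
      have h1 := abs_le.1 hts
      nlinarith [sq_nonneg (s - 2 * t)])
  rwa [integral_complex_ofReal, (hE f).2.2] at h

theorem inner_polarization_pmap (B : H →ₗ.[ℂ] H) (f g : B.domain) :
    inner ℂ (g : H) (B f) = (1 / 4 : ℂ) * (inner ℂ ((f + g : B.domain) : H) (B (f + g))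
      - inner ℂ ((f - g : B.domain) : H) (B (f - g))
      + Complex.I * inner ℂ ((f + Complex.I • g : B.domain) : H) (B (f + Complex.I • g))
      - Complex.I * inner ℂ ((f - Complex.I • g : B.domain) : H) (B (f - Complex.I • g))) := by
  have hI := Complex.I_sq
  simp only [LinearPMap.map_add, LinearPMap.map_sub, LinearPMap.map_smul, inner_add_left,
    inner_add_right, inner_sub_left, Submodule.coe_add, Submodule.coe_sub, Submodule.coe_smul,
    inner_sub_right, inner_smul_left, inner_smul_right, Complex.conj_I]
  linear_combination (1/2 * inner ℂ (g : H) (B f) - 1/2 * inner ℂ (f : H) (B g)) * hI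

theorem tendsto_inner_riemannSum_id_of_mem (hE : IsSpectralFunction B E) (f g : B.domain) :
    Tendsto (fun n => inner ℂ (g : H) (E.riemannSum n (fun t => (t : ℂ)) (f : H))) atTop
      (𝓝 (inner ℂ (g : H) (B f))) := by
  have h (x : B.domain) := hE.tendsto_inner_self_riemannSum_id x
  rw [inner_polarization_pmap B f g]
  have key := ((((h (f + g)).sub (h (f - g))).add ((h (f + Complex.I • g)).const_mul
    Complex.I)).sub ((h (f - Complex.I • g)).const_mul Complex.I)).const_mul (1 / 4 : ℂ)
  refine key.congr fun n => ?_
  rw [inner_polarization _ (f : H) (g : H)]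
  simp only [Submodule.coe_add, Submodule.coe_sub, Submodule.coe_smul]

theorem norm_inner_riemannSum_one_le (E : SpectralFamily H) {n : ℕ} (hn : 0 < n) (g : H) :
    ‖inner ℂ g (E.riemannSum n (fun _ => 1) g)‖ ≤ ‖g‖ ^ 2 := by
  rw [E.inner_self_riemannSum]
  refine (norm_integral_le_of_norm_le_const (C := 1) (Eventually.of_forall fun t =>
    norm_stepFun_le hn zero_le_one (by simp))).trans ?_
  rw [one_mul, Measure.real, E.measure_univ, ENNReal.toReal_ofReal (by positivity)]

/-- Cauchy–Schwarz with the whole weight `φ` placed on `f`, so that the factor of `g` is the bounded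
sum for the constant `1`. -/
theorem norm_inner_riemannSum_sq_le (E : SpectralFamily H) (n : ℕ) (φ : ℝ → ℂ) (f g : H) :
    ‖inner ℂ g (E.riemannSum n φ f)‖ ^ 2 ≤ (inner ℂ g (E.riemannSum n (fun _ => 1) g)).re *
      (inner ℂ f (E.riemannSum n (fun t => ((‖φ t‖ ^ 2 : ℝ) : ℂ)) f)).re := by
  have h := norm_sum_inner_le (H := H) (SpectralFamily.indices n) (E.increment n)
    (E.increment_isPositive n) (fun k => φ ((k : ℝ) / n) • f) (fun _ => g)
  simp only [SpectralFamily.inner_riemannSum]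
  simp only [map_smul, inner_smul_right, inner_smul_left, one_mul, ← mul_assoc] at h ⊢
  refine h.trans (le_of_eq ?_)
  congr 2
  refine Finset.sum_congr rfl fun k _ => ?_
  rw [RCLike.mul_conj]
  norm_cast

/-- The functionals `g ↦ ⟨g, Sₙ f⟩` are uniformly bounded, since the Riemann sums of `t²` at `f`
converge; hence convergence for `g` in the dense domain extends to all `g`. The extension is needed
for `g = B f`, which need not lie in the domain. -/
theorem tendsto_inner_riemannSum_id (hE : IsSpectralFunction B E)
    (hB : Dense (B.domain : Set H)) (f : B.domain) (g : H) :
    Tendsto (fun n => inner ℂ g (E.riemannSum n (fun t => (t : ℂ)) (f : H))) atTop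
      (𝓝 (inner ℂ g (B f))) := by
  obtain ⟨M, hM⟩ := ((Complex.continuous_re.tendsto _).comp
    (hE.tendsto_inner_self_riemannSum_sq f)).bddAbove_range
  have hM' : ∀ n, (inner ℂ (f : H)
      (E.riemannSum n (fun t => ((t ^ 2 : ℝ) : ℂ)) (f : H))).re ≤ M := fun n => hM ⟨n, rfl⟩
  have hbound : ∀ n : ℕ, 0 < n → ∀ x : H,
      ‖inner ℂ x (E.riemannSum n (fun t => (t : ℂ)) (f : H))‖ ≤ √(max M 0) * ‖x‖ := by
    intro n hn x
    refine (pow_le_pow_iff_left₀ (norm_nonneg _) (by positivity) two_ne_zero).1 ?_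
    rw [mul_pow, Real.sq_sqrt (le_max_right _ _)]
    refine (norm_inner_riemannSum_sq_le E n _ (f : H) x).trans ?_
    have h1 := (Complex.re_le_norm _).trans (norm_inner_riemannSum_one_le E hn x)
    have h2 := (hM' n).trans (le_max_left M 0)
    simp only [Complex.norm_real, Real.norm_eq_abs, sq_abs]
    have h3 : 0 ≤ (inner ℂ x (E.riemannSum n (fun _ => 1) x)).re := by
      rw [SpectralFamily.inner_riemannSum, Complex.re_sum]
      refine Finset.sum_nonneg fun k _ => ?_
      rw [one_mul]
      exact (E.increment_isPositive n k).re_inner_nonneg_right x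
    calc _ ≤ (inner ℂ x (E.riemannSum n (fun _ => 1) x)).re * max M 0 := by gcongr
      _ ≤ ‖x‖ ^ 2 * max M 0 := by gcongr
      _ = _ := mul_comm _ _
  rw [Metric.tendsto_atTop]
  intro ε hε
  -- `K` covers the error of replacing `g` by `g'` both in the Riemann sum and in the limit; the
  -- summand `1` keeps it positive.
  set K := √(max M 0) + ‖B f‖ + 1 with hK
  have hKpos : 0 < K := by positivity
  obtain ⟨g', hg', hgg'⟩ := Metric.dense_iff.1 hB g (ε / (2 * K)) (by positivity)
  obtain ⟨m, hm⟩ := Metric.tendsto_atTop.1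
    (hE.tendsto_inner_riemannSum_id_of_mem f ⟨g', hgg'⟩) (ε / 2) (by positivity)
  refine ⟨m + 1, fun n hn => ?_⟩
  have h1 := hm n (by omega)
  have h2 := hbound n (by omega) (g - g')
  rw [Metric.mem_ball, dist_comm, dist_eq_norm] at hg'
  rw [dist_eq_norm] at h1 ⊢
  have h3 : ‖(inner ℂ (g - g') (B f) : ℂ)‖ ≤ ‖B f‖ * ‖g - g'‖ := by
    rw [mul_comm]; exact norm_inner_le_norm _ _
  have h4 : K * ‖g - g'‖ < ε / 2 := by
    rw [lt_div_iff₀ (by positivity)] at hg'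
    linarith
  have h5 : inner ℂ g (E.riemannSum n (fun t => (t : ℂ)) (f : H)) - inner ℂ g (B f)
      = inner ℂ (g - g') (E.riemannSum n (fun t => (t : ℂ)) (f : H))
        - inner ℂ (g - g') (B f)
        + (inner ℂ g' (E.riemannSum n (fun t => (t : ℂ)) (f : H)) - inner ℂ g' (B f)) := by
    simp only [inner_sub_left]; ring
  rw [h5]
  refine (norm_add_le _ _).trans_lt ?_
  have h6 := norm_sub_le (inner ℂ (g - g') (E.riemannSum n (fun t => (t : ℂ)) (f : H)))
    (inner ℂ (g - g') (B f))
  have h7 := norm_nonneg (g - g')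
  simp only at h1
  nlinarith

/-- `∫ φ d(E_t B f, h) = ∫ t φ d(E_t f, h)`. -/
theorem integral_apply (hE : IsSpectralFunction B E) (hB : Dense (B.domain : Set H))
    {φ : ℝ → ℂ} (hφ : Continuous φ) {C D : ℝ} (hC : ∀ t, ‖φ t‖ ≤ C)
    (hD : ∀ t : ℝ, ‖t * φ t‖ ≤ D) (f : B.domain) (h : H) :
    E.integral φ (B f) h = E.integral (fun t => t * φ t) f h := by
  have e1 := E.tendsto_inner_riemannSum hφ hC (B f) h
  have e2 := E.tendsto_inner_riemannSum (φ := fun t => t * φ t) (by fun_prop) hD (f : H) h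
  have e3 := (continuous_norm.tendsto _).comp (e1.sub e2)
  have e4 := e3.pow 2
  have hc0 : 0 ≤ C := (norm_nonneg _).trans (hC 0)
  -- These limits control the two Cauchy–Schwarz factors: `∑ |φ|² ⟨h, Eₖ h⟩` stays bounded, while `∑
  -- ⟨B f - tₖ f, Eₖ (B f - tₖ f)⟩` tends to `‖B f‖² - 2 ‖B f‖² + ‖B f‖² = 0`.
  have t1 := (Complex.continuous_re.tendsto _).comp (E.tendsto_inner_self_riemannSum
    (φ := fun t => ((‖φ t‖ ^ 2 : ℝ) : ℂ)) (by fun_prop) (f := h) (integrable_const (C ^ 2))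
    fun _ s _ => by
      rw [Complex.norm_real, Real.norm_eq_abs, abs_of_nonneg (sq_nonneg _)]
      gcongr; exact hC s)
  have t2 := (Complex.continuous_re.tendsto _).comp (E.tendsto_inner_riemannSum
    (φ := fun _ => (1 : ℂ)) (by fun_prop) (C := 1) (by simp) (B f) (B f))
  have t3 := (Complex.continuous_re.tendsto _).comp
    (hE.tendsto_inner_riemannSum_id hB f (B f))
  have t4 := (Complex.continuous_re.tendsto _).comp (hE.tendsto_inner_self_riemannSum_sq f)
  have t5 := t1.mul ((t2.sub (t3.const_mul 2)).add t4)
  rw [E.integral_one] at t5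
  have hz : (inner ℂ (B f) (B f)).re - 2 * (inner ℂ (B f) (B f)).re
      + (((‖B f‖ ^ 2 : ℝ)) : ℂ).re = 0 := by
    rw [Complex.ofReal_re, inner_self_eq_norm_sq_to_K]
    simp only [← Complex.ofReal_pow, Complex.coe_algebraMap, Complex.ofReal_re]
    ring
  rw [hz, mul_zero] at t5
  -- The difference of the Riemann sums is `∑ φ(tₖ) ⟨h, Eₖ (B f - tₖ f)⟩`. Putting `φ` on the side
  -- of `h`, conjugated, leaves the vanishing factor free of `φ`.
  have hle : ‖E.integral φ (B f) h - E.integral (fun t => t * φ t) f h‖ ^ 2 ≤ 0 := by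
    refine le_of_tendsto_of_tendsto e4 t5 (Eventually.of_forall fun n => ?_)
    have key := norm_sum_inner_le (SpectralFamily.indices n) (E.increment n)
      (E.increment_isPositive n) (fun k => B f - (((k : ℝ) / n : ℝ) : ℂ) • (f : H))
      (fun k => starRingEnd ℂ (φ ((k : ℝ) / n)) • h)
    simp only [Function.comp_apply, SpectralFamily.inner_riemannSum]
    refine (le_of_eq ?_).trans (key.trans (le_of_eq ?_))
    · congr 2
      rw [← Finset.sum_sub_distrib]
      refine Finset.sum_congr rfl fun k _ => ?_
      simp only [map_sub, map_smul, inner_sub_right, inner_smul_left, inner_smul_right,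
        Complex.conj_conj]
      ring
    · congr 1
      · congr 1
        refine Finset.sum_congr rfl fun k _ => ?_
        simp only [map_smul, inner_smul_left, inner_smul_right, Complex.conj_conj]
        rw [← mul_assoc, RCLike.conj_mul]
        norm_cast
      · simp only [Complex.re_sum, Finset.mul_sum, ← Finset.sum_sub_distrib,
          ← Finset.sum_add_distrib]
        refine Finset.sum_congr rfl fun k _ => ?_
        have hs : (inner ℂ (f : H) (E.increment n k (B f))).re
            = (inner ℂ (B f) (E.increment n k (f : H))).re := by
          rw [← (E.increment_isPositive n k).inner_left_eq_inner_right, ← inner_conj_symm,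
            Complex.conj_re]
        simp only [map_sub, map_smul, inner_sub_left, inner_sub_right, inner_smul_left,
          inner_smul_right, Complex.conj_ofReal, Complex.sub_re, Complex.re_ofReal_mul, one_mul,
          hs]
        ring
  have := pow_eq_zero_iff (two_ne_zero) |>.1 (le_antisymm hle (sq_nonneg _))
  exact sub_eq_zero.1 (norm_eq_zero.1 this)

/-- Induction through `cayley = 1 - 2i / (t + i)`: dividing by `t + i` under the integral must
amount to applying `R` to `g`. This is the multiplication rule `integral_apply` for `φ = cayleyⁿ /
(t + i)` and the vector `R g`, whose image under `B` is `g - i R g`. -/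
theorem integral_cayley_pow (hE : IsSpectralFunction B E) (hB : Dense (B.domain : Set H))
    {R : H →L[ℂ] H} (hR : IsResolvent B R) (n : ℕ) (g h : H) :
    E.integral (fun t => cayley t ^ n) g h
      = inner ℂ h (((ContinuousLinearMap.id ℂ H - (2 * Complex.I) • R) ^ n) g) := by
  induction n generalizing g with
  | zero => simpa using E.integral_one g h
  | succ n ih =>
    set φ : ℝ → ℂ := fun t => cayley t ^ n * (1 / (t + Complex.I)) with hφdef
    have hcp : Continuous fun t => cayley t ^ n := continuous_cayley.pow n
    have hcb : ∀ t, ‖cayley t ^ n‖ ≤ 1 := fun t => by rw [norm_pow, norm_cayley, one_pow]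
    have hφ : Continuous φ := hcp.mul
      (continuous_const.div (by fun_prop) ofReal_add_I_ne_zero)
    have hC : ∀ t, ‖φ t‖ ≤ 1 := fun t => by
      rw [norm_mul]; exact mul_le_one₀ (hcb t) (norm_nonneg _) (norm_one_div_add_I_le t)
    have htφ : ∀ t : ℝ, t * φ t = cayley t ^ n - Complex.I * φ t := fun t => by
      have := ofReal_add_I_ne_zero t
      simp only [hφdef]
      field_simp
      ring
    have hD : ∀ t : ℝ, ‖t * φ t‖ ≤ 2 := fun t => by
      rw [htφ]
      refine (norm_sub_le _ _).trans ?_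
      rw [norm_mul, Complex.norm_I, one_mul]
      linarith [hcb t, hC t]
    obtain ⟨hmem, happ⟩ : ∃ hm : R g ∈ B.domain, B ⟨R g, hm⟩ = g - Complex.I • R g := by
      have := (hR (R g, g - Complex.I • R g)).2 ⟨g, rfl⟩
      rw [LinearPMap.mem_graph_iff] at this
      obtain ⟨y, hy1, hy2⟩ := this
      have hm : R g ∈ B.domain := by
        have := y.2
        rwa [hy1] at this
      have hy : y = ⟨R g, hm⟩ := Subtype.ext hy1
      exact ⟨hm, by rw [← hy, hy2]⟩
    -- Both sides contain the same term `i ∫ φ d(E R g, h)`. Cancelling it leaves `∫ φ d(E g, h) = ∫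
    -- cayleyⁿ d(E R g, h)`.
    have key := hE.integral_apply hB hφ hC hD ⟨R g, hmem⟩ h
    simp only [happ, htφ] at key
    rw [E.integral_sub_smul hφ hC, E.integral_fun_sub_smul hcp hcb hφ hC, sub_left_inj] at key
    have e : (fun t => cayley t ^ (n + 1)) = fun t => cayley t ^ n - (2 * Complex.I) * φ t := by
      funext t
      rw [pow_succ, cayley_eq t, ← cayley_eq t]
      simp only [hφdef]
      rw [cayley_eq t]
      ring
    rw [e, E.integral_fun_sub_smul hcp hcb hφ hC, key, ← E.integral_sub_smul hcp hcb, ih,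
      pow_succ]
    rfl

end IsSpectralFunction

/-- If `x` is orthogonal to the domain and `y = R x`, then `0 = ⟨y, x⟩ = ⟨y, B y⟩ + i ‖y‖²`. The
first term is real because the spectral function writes it as a real integral, so `y = 0` and `x =
0`. -/
theorem IsResolvent.dense_of_isSpectralFunction [CompleteSpace H] {B : H →ₗ.[ℂ] H}
    {R : H →L[ℂ] H} (hR : IsResolvent B R) {E : SpectralFamily H}
    (hE : IsSpectralFunction B E) : Dense (B.domain : Set H) := by
  rw [Submodule.dense_iff_topologicalClosure_eq_top,
    Submodule.topologicalClosure_eq_top_iff, Submodule.eq_bot_iff]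
  intro x hx
  have hg := (hR (R x, x - Complex.I • R x)).2 ⟨x, rfl⟩
  rw [LinearPMap.mem_graph_iff] at hg
  obtain ⟨y, hy1, hy2⟩ := hg
  simp only at hy1 hy2
  have h1 : inner ℂ (y : H) x = 0 := (Submodule.mem_orthogonal _ _).1 hx _ y.2
  have h2 : x = B y + Complex.I • (y : H) := by rw [hy2, hy1]; abel
  rw [h2, inner_add_right, inner_smul_right, ← (hE y).2.1, inner_self_eq_norm_sq_to_K] at h1
  have h3 := congrArg Complex.im h1
  have h4 : ‖(y : H)‖ ^ 2 = 0 := by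
    simpa [← Complex.ofReal_pow] using h3
  have h5 : (y : H) = 0 := by simpa using h4
  rw [h2, h5, show y = 0 from Subtype.ext h5, LinearPMap.map_zero, smul_zero, add_zero]

/-- The measure of `(-∞, t]` is the quadratic form of `E_t`, and on a complex space the quadratic
form determines the operator. -/
theorem SpectralFamily.ext_of_measure [CompleteSpace H] {E E' : SpectralFamily H}
    (h : ∀ f, E.measure f = E'.measure f) : E = E' := by
  have hfun : E.toFun = E'.toFun := by
    funext t
    have hpos (F : SpectralFamily H) (f : H) :
        inner ℂ f (F.toFun t f) = (((F.measure f).real (Set.Iic t) : ℝ) : ℂ) := by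
      have h1 : ∀ s ≤ t, (((F.toFun t - F.toFun s).reApplyInnerSelf f : ℝ) : ℂ)
          = inner ℂ f ((F.toFun t - F.toFun s) f) := fun s hs => by
        have hp := F.mono s t hs
        have := Complex.eq_re_of_ofReal_le (r := 0) (z := inner ℂ f ((F.toFun t - F.toFun s) f))
          (by rw [Complex.ofReal_zero]; exact hp.inner_nonneg_right f)
        rw [this, ContinuousLinearMap.reApplyInnerSelf_apply, hp.inner_left_eq_inner_right]
        rfl
      -- Only increments are assumed positive, so the form of `F_t` is shown to be real by letting
      -- `s → -∞` in the increments `F_t - F_s`.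
      have h2 : Tendsto (fun s => (inner ℂ f ((F.toFun t - F.toFun s) f)).im) atBot
          (𝓝 (inner ℂ f (F.toFun t f)).im) := by
        have := (Complex.continuous_im.tendsto _).comp ((tendsto_const_nhds (x := f)).inner
          (𝕜 := ℂ) ((tendsto_const_nhds (x := F.toFun t f)).sub (F.bot f)))
        rw [sub_zero] at this
        exact this
      have h3 : (inner ℂ f (F.toFun t f)).im = 0 := by
        refine tendsto_nhds_unique (h2.congr' ?_) tendsto_const_nhds
        filter_upwards [eventually_le_atBot t] with s hs
        rw [← h1 s hs, Complex.ofReal_im]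
      have h4 : 0 ≤ F.stieltjes f t := by
        refine ge_of_tendsto (x := atBot) (f := fun s => F.stieltjes f t - F.stieltjes f s) ?_ ?_
        · simpa using (tendsto_const_nhds (x := F.stieltjes f t)).sub (F.re_inner_tendsto_bot f)
        · filter_upwards [eventually_le_atBot t] with s hs
          exact sub_nonneg.2 ((F.stieltjes f).mono hs)
      rw [Measure.real, SpectralFamily.measure,
        StieltjesFunction.measure_Iic _ (F.re_inner_tendsto_bot f), sub_zero,
        ENNReal.toReal_ofReal h4]
      exact Complex.ext rfl (by simpa using h3)
    refine ContinuousLinearMap.ext fun f => ?_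
    have := (ext_inner_map (V := H) (E.toFun t : H →ₗ[ℂ] H) (E'.toFun t : H →ₗ[ℂ] H)).1 fun f => by
      rw [← inner_conj_symm, ← inner_conj_symm ((E'.toFun t : H →ₗ[ℂ] H) f)]
      exact congrArg _ (by rw [ContinuousLinearMap.coe_coe, ContinuousLinearMap.coe_coe,
        hpos, hpos, h])
    exact LinearMap.congr_fun this f
  cases E; cases E'; congr

/-- An operator `B` for which `B + i` has an everywhere defined inverse has at most one spectral
function. -/
theorem IsSpectralFunction.unique [CompleteSpace H] {B : H →ₗ.[ℂ] H} {R : H →L[ℂ] H}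
    (hR : IsResolvent B R) {E E' : SpectralFamily H} (hE : IsSpectralFunction B E)
    (hE' : IsSpectralFunction B E') : E = E' := by
  have hB := hR.dense_of_isSpectralFunction hE
  refine SpectralFamily.ext_of_measure fun f => measure_ext_of_cayley fun n => ?_
  have hcp : Continuous fun t => cayley t ^ n := continuous_cayley.pow n
  have hcb : ∀ t, ‖cayley t ^ n‖ ≤ 1 := fun t => by rw [norm_pow, norm_cayley, one_pow]
  rw [← E.integral_self hcp hcb, ← E'.integral_self hcp hcb, hE.integral_cayley_pow hB hR,
    hE'.integral_cayley_pow hB hR]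

end Uniqueness

/-! ### Fatou's theorem in the upper half-plane -/

/-- The Stolz angle at `x ∈ ℝ` in the upper half-plane. -/
def stolz (x : ℝ) : Set ℂ := {z | 0 < z.im ∧ ‖z - x‖ ≤ 2 * z.im}

theorem isOpen_upper : IsOpen {z : ℂ | 0 < z.im} :=
  isOpen_lt continuous_const Complex.continuous_im

theorem norm_one_sub_I_mul_sq (K : ℝ) (z : ℂ) :
    ‖1 - Complex.I * K * z‖ ^ 2 = (1 + K * z.im) ^ 2 + (K * z.re) ^ 2 := by
  rw [← Complex.normSq_eq_norm_sq, Complex.normSq_apply]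
  simp
  ring

theorem norm_sq_eq_re_im (z : ℂ) : ‖z‖ ^ 2 = z.re ^ 2 + z.im ^ 2 := by
  rw [← Complex.normSq_eq_norm_sq, Complex.normSq_apply]
  ring

/-- A Lipschitz holomorphic function in the upper half-plane that is `o(|t|)` at `0` along the
real line is `o(|z|)` at `0`. -/
theorem norm_le_of_isLittleO_real {G : ℂ → ℂ} (hGc : Continuous G)
    (hGd : DifferentiableOn ℂ G {z : ℂ | 0 < z.im}) {L : ℝ} (hL : ∀ z, ‖G z‖ ≤ L * ‖z‖)
    (hG : ∀ ε > 0, ∃ δ > 0, ∀ t : ℝ, |t| ≤ δ → ‖G t‖ ≤ ε * |t|) {ε : ℝ} (hε : 0 < ε) :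
    ∃ δ > 0, ∀ z : ℂ, 0 < z.im → ‖z‖ < δ → ‖G z‖ ≤ ε * ‖z‖ := by
  have hL0 : 0 ≤ L := by
    have := (norm_nonneg _).trans (hL 1)
    simpa using this
  obtain ⟨d, hd, hGd0⟩ := hG (ε / 2) (by positivity)
  -- `M` makes `L ≤ (ε / 2) M`, and `K = M / d` gives `|1 - iKw| ≥ M` on the arc `|w| = d`. There
  -- the crude Lipschitz bound then suffices.
  set M := 2 * L / ε + 1 with hM
  have hM0 : 0 < M := by positivity
  have hLM : L ≤ ε / 2 * M := by
    rw [hM]; field_simp; linarith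
  set K := M / d with hK
  have hK0 : 0 < K := by positivity
  refine ⟨min d (1 / K), by positivity, fun z hz hzd => ?_⟩
  set Ω : Set ℂ := {z | 0 < z.im ∧ ‖z‖ < d} with hΩ
  have hΩo : IsOpen Ω := isOpen_upper.inter (isOpen_lt continuous_norm continuous_const)
  have hΩc : closure Ω ⊆ {z | 0 ≤ z.im ∧ ‖z‖ ≤ d} :=
    closure_minimal (fun z hz => ⟨hz.1.le, hz.2.le⟩)
      ((isClosed_le continuous_const Complex.continuous_im).inter
        (isClosed_le continuous_norm continuous_const))
  have hΩb : Bornology.IsBounded Ω :=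
    Metric.isBounded_ball.subset (fun z hz => by simpa using hz.2 : Ω ⊆ Metric.ball 0 d)
  have hge : ∀ w : ℂ, 0 ≤ w.im → 1 ≤ ‖1 - Complex.I * K * w‖ := fun w hw => by
    refine (pow_le_pow_iff_left₀ zero_le_one (norm_nonneg _) two_ne_zero).1 ?_
    rw [norm_one_sub_I_mul_sq]
    nlinarith [sq_nonneg (K * w.re), mul_nonneg hK0.le hw]
  have hge2 : ∀ w : ℂ, 0 ≤ w.im → K * ‖w‖ ≤ ‖1 - Complex.I * K * w‖ := fun w hw => by
    refine (pow_le_pow_iff_left₀ (by positivity) (norm_nonneg _) two_ne_zero).1 ?_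
    rw [norm_one_sub_I_mul_sq, mul_pow, norm_sq_eq_re_im]
    nlinarith [mul_nonneg hK0.le hw]
  have hge3 : ∀ η : ℝ, 0 < η → ∀ w : ℂ, 0 ≤ w.im → ‖w‖ ≤ ‖w + Complex.I * η‖ := by
    intro η hη w hw
    refine (pow_le_pow_iff_left₀ (norm_nonneg _) (norm_nonneg _) two_ne_zero).1 ?_
    rw [norm_sq_eq_re_im, norm_sq_eq_re_im]
    simp
    nlinarith
  have hne : ∀ η : ℝ, 0 < η → ∀ w : ℂ, 0 ≤ w.im →
      (w + Complex.I * η) * (1 - Complex.I * K * w) ≠ 0 := by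
    intro η hη w hw
    refine mul_ne_zero (fun h => ?_) (fun h => ?_)
    · have := congrArg Complex.im h
      simp at this
      linarith
    · have := hge w hw
      rw [h, norm_zero] at this
      linarith
  -- Maximum principle on the half-disc for `G(w) / ((w + iη)(1 - iKw))`. The denominator has no
  -- zeros in the closed half-plane. On the real segment the `o(|t|)` hypothesis bounds the quotient
  -- by `ε / 2`, on the arc the factor `1 - iKw` does.
  have key : ∀ η : ℝ, 0 < η →
      ‖G z‖ ≤ ε / 2 * (‖z + Complex.I * η‖ * ‖1 - Complex.I * K * z‖) := by
    intro η hη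
    have hDC : DiffContOnCl ℂ (fun w => G w / ((w + Complex.I * η) * (1 - Complex.I * K * w)))
        Ω := by
      constructor
      · refine (hGd.mono fun w hw => hw.1).div (by fun_prop) fun w hw => hne η hη w hw.1.le
      · exact hGc.continuousOn.div (by fun_prop) fun w hw => hne η hη w (hΩc hw).1
    have hfr : ∀ w ∈ frontier Ω,
        ‖G w / ((w + Complex.I * η) * (1 - Complex.I * K * w))‖ ≤ ε / 2 := by
      intro w hw
      rw [hΩo.frontier_eq] at hw
      obtain ⟨hwc, hwn⟩ := hw
      obtain ⟨h1, h2⟩ := hΩc hwc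
      rw [norm_div, norm_mul]
      refine div_le_of_le_mul₀ (by positivity) (by positivity) ?_
      rcases h1.eq_or_lt with h0 | h0
      · have hwr : w = (w.re : ℂ) := Complex.ext rfl (by simpa using h0.symm)
        have hwn' : ‖w‖ = |w.re| := by rw [hwr, Complex.norm_real, Real.norm_eq_abs]; simp
        have := hGd0 w.re (hwn' ▸ h2)
        rw [← hwr, ← hwn'] at this
        refine this.trans ?_
        gcongr
        calc ‖w‖ ≤ ‖w + Complex.I * η‖ := hge3 η hη w h1
          _ ≤ _ := le_mul_of_one_le_right (norm_nonneg _) (hge w h1)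
      · have h3 : ‖w‖ = d := le_antisymm h2 (not_lt.1 fun h => hwn ⟨h0, h⟩)
        refine (hL w).trans ?_
        have h4 : M ≤ ‖1 - Complex.I * K * w‖ := by
          have := hge2 w h1
          rwa [h3, hK, div_mul_cancel₀ _ hd.ne'] at this
        calc L * ‖w‖ ≤ (ε / 2 * M) * ‖w‖ := by gcongr
          _ = ε / 2 * (‖w‖ * M) := by ring
          _ ≤ _ := by gcongr; exact hge3 η hη w h1
    have hzΩ : z ∈ Ω := ⟨hz, hzd.trans_le (min_le_left _ _)⟩
    have := Complex.norm_le_of_forall_mem_frontier_norm_le hΩb hDC hfr (subset_closure hzΩ)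
    rw [norm_div, norm_mul] at this
    rwa [div_le_iff₀] at this
    rw [← norm_mul]
    exact norm_pos_iff.2 (hne η hη z hz.le)
  have key2 : ‖G z‖ ≤ ε / 2 * (‖z‖ * ‖1 - Complex.I * K * z‖) := by
    have hc : Continuous fun η : ℝ =>
        ε / 2 * (‖z + Complex.I * η‖ * ‖1 - Complex.I * K * z‖) := by fun_prop
    have ht := (hc.tendsto 0).mono_left (nhdsWithin_le_nhds (s := Set.Ioi 0))
    simp only [Complex.ofReal_zero, mul_zero, add_zero] at ht
    exact ge_of_tendsto ht (by filter_upwards [self_mem_nhdsWithin] with η hη using key η hη)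
  -- This is where the radius `1 / K` enters: close to `0` the auxiliary factor costs only `2`.
  have h5 : ‖1 - Complex.I * K * z‖ ≤ 2 := by
    refine (norm_sub_le _ _).trans ?_
    have : K * ‖z‖ ≤ 1 := by
      have := hzd.le.trans (min_le_right _ _)
      rwa [le_div_iff₀ hK0, mul_comm] at this
    simp only [norm_one, norm_mul, Complex.norm_I, Complex.norm_real, Real.norm_eq_abs,
      abs_of_pos hK0, one_mul]
    linarith
  calc ‖G z‖ ≤ ε / 2 * (‖z‖ * ‖1 - Complex.I * K * z‖) := key2
    _ ≤ ε / 2 * (‖z‖ * 2) := by gcongr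
    _ = ε * ‖z‖ := by ring

/-- Cauchy's estimate on the circle of radius `Im z / 2` about `z`. In the Stolz angle its points
have modulus at most `4 Im z`, so the bound is `ε · 4 Im z / (Im z / 2)`. -/
theorem norm_deriv_le_of_stolz {G : ℂ → ℂ} (hGd : DifferentiableOn ℂ G {z : ℂ | 0 < z.im})
    {ε δ : ℝ} (hε : 0 ≤ ε) (h : ∀ z : ℂ, 0 < z.im → ‖z‖ < δ → ‖G z‖ ≤ ε * ‖z‖) {z : ℂ}
    (hz : 0 < z.im) (hz2 : ‖z‖ ≤ 2 * z.im) (hzδ : 2 * ‖z‖ < δ) :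
    ‖deriv G z‖ ≤ 8 * ε := by
  have hsub : Metric.closedBall z (z.im / 2) ⊆ {z : ℂ | 0 < z.im} := by
    intro w hw
    rw [Metric.mem_closedBall, dist_eq_norm] at hw
    have := (abs_le.1 ((Complex.abs_im_le_norm (w - z)).trans hw)).1
    simp only [Complex.sub_im] at this
    change 0 < w.im
    linarith
  have hdc : DiffContOnCl ℂ G (Metric.ball z (z.im / 2)) :=
    (hGd.mono (closure_minimal (Metric.ball_subset_closedBall)
      Metric.isClosed_closedBall |>.trans hsub)).diffContOnCl
  have := Complex.norm_deriv_le_of_forall_mem_sphere_norm_le (R := z.im / 2) (by positivity) hdc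
    (C := ε * (4 * z.im)) fun w hw => by
      have h1 := hsub (Metric.sphere_subset_closedBall hw)
      rw [mem_sphere_iff_norm] at hw
      have h2 : ‖w‖ ≤ ‖z‖ + z.im / 2 := by
        rw [← hw]; simpa using norm_add_le z (w - z)
      have h3 := (le_abs_self z.im).trans (Complex.abs_im_le_norm z)
      refine (h w h1 (by linarith)).trans ?_
      gcongr
      linarith
  refine this.trans (le_of_eq ?_)
  field_simp
  ring

/-- **Fatou's theorem**: a bounded analytic function in the upper half-plane has nontangential
limits at almost every point of the real line. -/
theorem IsHInfty.ae_exists_tendsto_stolz {ψ : ℂ → ℂ} (hψ : IsHInfty ψ) :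
    ∀ᵐ x : ℝ, ∃ c, Tendsto ψ (𝓝[stolz x] (x : ℂ)) (𝓝 c) := by
  obtain ⟨hd, C, hC⟩ := hψ
  -- A primitive of the bounded `ψ` is Lipschitz. Extended to the plane and restricted to the real
  -- line it is differentiable almost everywhere, and its derivative there is the candidate for the
  -- limit.
  obtain ⟨Ψ, hΨ⟩ := (convex_halfSpace_im_gt 0).exists_forall_hasDerivWithinAt hd
  have hC0 : 0 ≤ C := (norm_nonneg _).trans (hC Complex.I (by simp))
  have hLip : LipschitzOnWith C.toNNReal Ψ {z : ℂ | 0 < z.im} :=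
    (convex_halfSpace_im_gt 0).lipschitzOnWith_of_nnnorm_hasDerivWithin_le hΨ fun z hz => by
      rw [← NNReal.coe_le_coe, coe_nnnorm, Real.coe_toNNReal _ hC0]
      exact hC z hz
  obtain ⟨g, hg, hgΨ⟩ := hLip.extend_finite_dimension
  have hgd : ∀ z : ℂ, 0 < z.im → HasDerivAt g (ψ z) z := fun z hz => by
    have h1 := (hΨ z hz).hasDerivAt (isOpen_upper.mem_nhds hz)
    refine h1.congr_of_eventuallyEq ?_
    filter_upwards [isOpen_upper.mem_nhds hz] with w hw using (hgΨ hw).symm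
  have hreal : LipschitzWith _ (fun t : ℝ => g t) := hg.comp
    (LipschitzWith.of_dist_le_mul (K := 1) fun s t => by simp [Complex.dist_eq, ← Complex.ofReal_sub, Real.dist_eq])
  filter_upwards [hreal.ae_differentiableAt_real] with x hx
  set c := deriv (fun t : ℝ => g t) x with hc
  refine ⟨c, ?_⟩
  -- The remainder of the first-order expansion at `x`. It is `o(|t|)` on the line, hence `o(|z|)`
  -- in the half-plane, and its derivative at `z` is `ψ(x + z) - c`.
  set G : ℂ → ℂ := fun z => g (x + z) - g x - c * z with hG
  set L := lipschitzExtensionConstant ℂ * C.toNNReal with hLdef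
  have hGc : Continuous G := by
    have := hg.continuous
    fun_prop
  have hGder : ∀ z : ℂ, 0 < z.im → HasDerivAt G (ψ (x + z) - c) z := fun z hz => by
    have h1 := (hgd (x + z) (by simpa using hz)).comp_const_add (x : ℂ) z
    have h2 := (h1.sub_const (g x)).sub ((hasDerivAt_id z).const_mul c)
    rw [mul_one] at h2
    exact h2
  have hGd : DifferentiableOn ℂ G {z : ℂ | 0 < z.im} := fun z hz =>
    (hGder z hz).differentiableAt.differentiableWithinAt
  have hGL : ∀ z, ‖G z‖ ≤ (L + ‖c‖) * ‖z‖ := fun z => by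
    have h1 := hg.dist_le_mul (x + z) x
    rw [dist_eq_norm, dist_eq_norm, add_sub_cancel_left] at h1
    refine (norm_sub_le _ _).trans ?_
    rw [norm_mul, add_mul]
    gcongr
  have hGo : ∀ ε > 0, ∃ δ > 0, ∀ t : ℝ, |t| ≤ δ → ‖G t‖ ≤ ε * |t| := fun ε hε => by
    have h1 := hasDerivAt_iff_isLittleO_nhds_zero.1 hx.hasDerivAt
    have h2 := h1.def hε
    rw [Metric.eventually_nhds_iff] at h2
    obtain ⟨δ, hδ, h2⟩ := h2
    refine ⟨δ / 2, by positivity, fun t ht => ?_⟩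
    have h3 := h2 (y := t) (by rw [Real.dist_eq, sub_zero]; linarith)
    simp only [Complex.ofReal_add, Complex.real_smul, Real.norm_eq_abs] at h3
    rw [hG]
    simp only
    rwa [mul_comm c]
  rw [Metric.tendsto_nhdsWithin_nhds]
  intro ε hε
  -- The derivative estimate loses a factor `8`, so `ε / 16` leaves `ε / 2`. It also requires `2 ‖z‖
  -- < δ`, whence `δ / 2` below.
  obtain ⟨δ, hδ, hδG⟩ := norm_le_of_isLittleO_real hGc hGd hGL hGo (ε := ε / 16) (by positivity)
  refine ⟨δ / 2, by positivity, fun {z} hz hzd => ?_⟩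
  rw [dist_eq_norm] at hzd ⊢
  have him : (z - x).im = z.im := by simp
  have h1 := norm_deriv_le_of_stolz hGd (by positivity) hδG (z := z - x) (by rw [him]; exact hz.1)
    (by rw [him]; exact hz.2) (by linarith)
  rw [(hGder (z - x) (by rw [him]; exact hz.1)).deriv, add_sub_cancel] at h1
  linarith

theorem tendsto_vertical_stolz (x : ℝ) :
    Tendsto (fun y : ℝ => (x : ℂ) + y * Complex.I) (𝓝[>] 0) (𝓝[stolz x] (x : ℂ)) := by
  refine tendsto_nhdsWithin_iff.2 ⟨?_, ?_⟩
  · have : Continuous fun y : ℝ => (x : ℂ) + y * Complex.I := by fun_prop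
    have h := (this.tendsto 0).mono_left (nhdsWithin_le_nhds (s := Set.Ioi 0))
    simpa using h
  · filter_upwards [self_mem_nhdsWithin] with y hy
    have hy' : 0 < y := hy
    refine ⟨by simpa using hy', ?_⟩
    simp [abs_of_pos hy']
    linarith

theorem IsHInfty.ae_tendsto_boundary {ψ : ℂ → ℂ} (hψ : IsHInfty ψ) :
    ∀ᵐ x : ℝ, Tendsto ψ (𝓝[stolz x] (x : ℂ)) (𝓝 (boundary ψ x)) := by
  filter_upwards [hψ.ae_exists_tendsto_stolz] with x ⟨c, hc⟩
  have : boundary ψ x = c := (hc.comp (tendsto_vertical_stolz x)).limUnder_eq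
  rwa [this]

theorem boundary_eq_of_continuousAt {ψ : ℂ → ℂ} {x : ℝ} (h : ContinuousAt ψ x) :
    boundary ψ x = ψ x :=
  ((h.tendsto.mono_left nhdsWithin_le_nhds).comp (tendsto_vertical_stolz x)).limUnder_eq

theorem IsHInfty.ae_norm_boundary_le {ψ : ℂ → ℂ} (hψ : IsHInfty ψ) :
    ∃ C : ℝ, ∀ᵐ x : ℝ, ‖boundary ψ x‖ ≤ C := by
  obtain ⟨hd, C, hC⟩ := id hψ
  refine ⟨C, ?_⟩
  filter_upwards [hψ.ae_tendsto_boundary] with x hx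
  refine le_of_tendsto (hx.comp (tendsto_vertical_stolz x)).norm ?_
  filter_upwards [self_mem_nhdsWithin] with y hy
  exact hC _ (by simpa using hy)

/-! ### Approximation by polynomials in the Cayley function -/

/-- The point `i (1 + w) / (1 - w)` of the upper half-plane that corresponds to a point of the unit
disc. -/
def invCayley (w : ℂ) : ℂ := Complex.I * (1 + w) / (1 - w)

theorem one_sub_ne_zero_of_mem_ball {w : ℂ} (hw : w ∈ Metric.ball (0 : ℂ) 1) : 1 - w ≠ 0 := by
  intro h
  rw [mem_ball_zero_iff, ← sub_eq_zero.1 h, norm_one] at hw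
  exact lt_irrefl _ hw

theorem im_invCayley_pos {w : ℂ} (hw : w ∈ Metric.ball (0 : ℂ) 1) : 0 < (invCayley w).im := by
  have h0 := one_sub_ne_zero_of_mem_ball hw
  have h1 : invCayley w = ((Complex.I * (1 + w) * starRingEnd ℂ (1 - w))) /
      ((Complex.normSq (1 - w) : ℝ) : ℂ) := by
    have h2 : starRingEnd ℂ (1 - w) ≠ 0 := (map_ne_zero _).2 h0
    rw [invCayley, Complex.normSq_eq_conj_mul_self]
    field_simp
  rw [h1, Complex.div_ofReal_im]
  refine div_pos ?_ (Complex.normSq_pos.2 h0)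
  have h3 : ‖w‖ ^ 2 < 1 := by
    rw [mem_ball_zero_iff] at hw
    exact pow_lt_one₀ (norm_nonneg _) hw two_ne_zero
  rw [norm_sq_eq_re_im] at h3
  simp
  nlinarith

/-- Writing the radius as `(1 - s) / (1 + s)` makes the half-plane image of a radius of the disc an
explicit rational curve ending at `t` as `s ↓ 0`. -/
theorem invCayley_mul_cayley (s t : ℝ) (hs : 0 < s) :
    invCayley (((1 - s) / (1 + s) : ℝ) * cayley t)
      = t + Complex.I * (s * (1 + t ^ 2)) / (1 - Complex.I * s * t) := by
  have h1 := ofReal_add_I_ne_zero t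
  have h2 : (1 + s : ℂ) ≠ 0 := by exact_mod_cast (by positivity : (1 + s) ≠ 0)
  have h3 : (1 : ℂ) - Complex.I * s * t ≠ 0 := fun h => by
    simpa using congrArg Complex.re h
  have h4 : (1 : ℂ) - ((1 - s) / (1 + s) : ℝ) * cayley t
      = 2 * Complex.I * (1 - Complex.I * s * t) / ((1 + s) * (t + Complex.I)) := by
    rw [cayley]
    push_cast
    field_simp
    linear_combination (2 * (s : ℂ) * t) * Complex.I_sq
  have h5 : (1 : ℂ) + ((1 - s) / (1 + s) : ℝ) * cayley t
      = 2 * (t + Complex.I * s) / ((1 + s) * (t + Complex.I)) := by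
    rw [cayley]
    push_cast
    field_simp
    ring
  rw [invCayley, h4, h5]
  obtain ⟨d, hd⟩ : ∃ d : ℂ, d = 1 - Complex.I * s * t := ⟨_, rfl⟩
  rw [← hd] at h3 ⊢
  field_simp
  linear_combination (-(t : ℂ)) * hd

/-- The displacement from `t` is `q (i - s t)` with `q > 0`. Its height is `q` and its modulus at
most `q (1 + s |t|) ≤ 2q`. Radial approach in the disc is not vertical in the half-plane, which is
why nontangential limits are used. -/
theorem invCayley_mem_stolz {s t : ℝ} (hs : 0 < s) (hst : s * |t| ≤ 1) :
    invCayley (((1 - s) / (1 + s) : ℝ) * cayley t) ∈ stolz t := by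
  have hst2 : s ^ 2 * t ^ 2 ≤ 1 := by
    have := pow_le_one₀ (by positivity) hst (n := 2)
    rwa [mul_pow, sq_abs] at this
  have e : Complex.I * ((s : ℂ) * (1 + t ^ 2)) / (1 - Complex.I * s * t)
      = ((s * (1 + t ^ 2) / (1 + s ^ 2 * t ^ 2) : ℝ) : ℂ) * (Complex.I * (1 + Complex.I * s * t)) := by
    have h3 : (1 : ℂ) - Complex.I * s * t ≠ 0 := fun h => by
      simpa using congrArg Complex.re h
    have h4 : (1 : ℂ) + s ^ 2 * t ^ 2 ≠ 0 := by
      exact_mod_cast (by positivity : 1 + s ^ 2 * t ^ 2 ≠ 0)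
    push_cast
    field_simp
    linear_combination ((s : ℂ) ^ 3 * t ^ 2 * (1 + t ^ 2)) * Complex.I_sq
  rw [invCayley_mul_cayley s t hs, e]
  set q := s * (1 + t ^ 2) / (1 + s ^ 2 * t ^ 2) with hq
  have hq0 : 0 < q := by positivity
  refine ⟨by simpa using hq0, ?_⟩
  rw [add_sub_cancel_left]
  have him : ((t : ℂ) + q * (Complex.I * (1 + Complex.I * s * t))).im = q := by simp
  rw [him, norm_mul, norm_mul, Complex.norm_I, one_mul, Complex.norm_real, Real.norm_eq_abs,
    abs_of_pos hq0, mul_comm]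
  gcongr
  refine (norm_add_le _ _).trans ?_
  simp only [norm_one, norm_mul, Complex.norm_I, Complex.norm_real, Real.norm_eq_abs,
    abs_of_pos hs, one_mul]
  linarith

theorem tendsto_invCayley (t : ℝ) {s : ℕ → ℝ} (hs : ∀ n, 0 < s n)
    (hs0 : Tendsto s atTop (𝓝 0)) :
    Tendsto (fun n => invCayley (((1 - s n) / (1 + s n) : ℝ) * cayley t)) atTop
      (𝓝[stolz t] (t : ℂ)) := by
  refine tendsto_nhdsWithin_iff.2 ⟨?_, ?_⟩
  · have h1 : Continuous fun x : ℝ =>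
        (t : ℂ) + Complex.I * (x * (1 + t ^ 2)) / (1 - Complex.I * x * t) := by
      refine continuous_const.add (Continuous.div (by fun_prop) (by fun_prop) fun x h => ?_)
      simpa using congrArg Complex.re h
    have h2 := (h1.tendsto 0).comp hs0
    simp only [Complex.ofReal_zero, zero_mul, mul_zero, zero_div, add_zero] at h2
    refine h2.congr fun n => ?_
    rw [invCayley_mul_cayley _ _ (hs n)]
    rfl
  · have h := hs0.mul_const |t|
    rw [zero_mul] at h
    filter_upwards [h.eventually (ge_mem_nhds zero_lt_one)] with n hn
    exact invCayley_mem_stolz (hs n) hn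

/-- A property of functions on the line that holds for the polynomials in the Cayley function and
is stable under bounded almost everywhere limits holds for the boundary values of the functions of
`H^∞`. -/
theorem IsHInfty.boundary_induction {ψ : ℂ → ℂ} (hψ : IsHInfty ψ) {P : (ℝ → ℂ) → Prop}
    (hpoly : ∀ (n : ℕ) (c : ℕ → ℂ), P fun t => ∑ k ∈ Finset.range n, c k * cayley t ^ k)
    (hlim : ∀ (φ : ℕ → ℝ → ℂ) (χ : ℝ → ℂ) (C : ℝ), (∀ n, P (φ n)) → (∀ n t, ‖φ n t‖ ≤ C) →
      (∀ᵐ t, Tendsto (fun n => φ n t) atTop (𝓝 (χ t))) → P χ) : P (boundary ψ) := by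
  obtain ⟨hd, C, hC⟩ := id hψ
  have hΦ : DifferentiableOn ℂ (fun w => ψ (invCayley w)) (Metric.ball 0 1) := by
    refine hd.comp (DifferentiableOn.div (by fun_prop) (by fun_prop)
      fun w hw => one_sub_ne_zero_of_mem_ball hw) fun w hw => im_invCayley_pos hw
  -- `0 < s ≤ 1` puts the radius `(1 - s) / (1 + s)` in `[0, 1)`.
  set s : ℕ → ℝ := fun n => 1 / ((n : ℝ) + 1) with hs
  have hs0 : ∀ n, 0 < s n := fun n => by positivity
  have hs1 : ∀ n, s n ≤ 1 := fun n => by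
    rw [hs]; simp only; rw [div_le_one (by positivity)]; linarith [n.cast_nonneg (α := ℝ)]
  have hr : ∀ n, 0 ≤ (1 - s n) / (1 + s n) ∧ (1 - s n) / (1 + s n) < 1 := fun n => by
    have h0 := hs0 n
    have h1 := hs1 n
    refine ⟨div_nonneg (by linarith) (by linarith), ?_⟩
    rw [div_lt_one (by linarith)]
    linarith
  have hball : ∀ n t, (((1 - s n) / (1 + s n) : ℝ) : ℂ) * cayley t ∈ Metric.ball (0 : ℂ) 1 := by
    intro n t
    rw [mem_ball_zero_iff, norm_mul, norm_cayley, mul_one, Complex.norm_real, Real.norm_eq_abs,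
      abs_of_nonneg (hr n).1]
    exact (hr n).2
  -- Two limits: for a fixed radius below `1` the Taylor polynomials converge boundedly, and as the
  -- radius tends to `1` Fatou's theorem gives the boundary values.
  refine hlim (fun n t => ψ (invCayley (((1 - s n) / (1 + s n) : ℝ) * cayley t))) _ C
    (fun n => ?_) (fun n t => hC _ (im_invCayley_pos (hball n t))) ?_
  · set r := (1 - s n) / (1 + s n) with hrdef
    set a : ℕ → ℂ := fun k => (k.factorial : ℂ)⁻¹ *
      iteratedDeriv k (fun w => ψ (invCayley w)) 0 * (r : ℂ) ^ k with ha
    have hsum : ∀ t, HasSum (fun k => a k * cayley t ^ k) (ψ (invCayley (r * cayley t))) := by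
      intro t
      have h := Complex.hasSum_taylorSeries_on_ball hΦ (hball n t)
      refine h.congr_fun fun k => ?_
      simp only [ha, sub_zero, smul_eq_mul, mul_pow]
      ring
    -- The Cayley function is unimodular, so convergence at the single point `t = 0` already bounds
    -- the coefficients absolutely.
    have hsumm : Summable fun k => ‖a k‖ := by
      have := (hsum 0).summable.norm
      simpa [norm_mul, norm_pow, norm_cayley] using this
    refine hlim (fun m t => ∑ k ∈ Finset.range m, a k * cayley t ^ k) _ (∑' k, ‖a k‖)
      (fun m => hpoly m a) (fun m t => ?_) (Eventually.of_forall fun t => (hsum t).tendsto_sum_nat)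
    refine (norm_sum_le _ _).trans ?_
    simp only [norm_mul, norm_pow, norm_cayley, one_pow, mul_one]
    exact hsumm.sum_le_tsum _ fun k _ => norm_nonneg _
  · filter_upwards [hψ.ae_tendsto_boundary] with t ht
    exact ht.comp (tendsto_invCayley t hs0 tendsto_one_div_add_atTop_nhds_zero_nat)

theorem IsHInfty.aestronglyMeasurable_boundary {ψ : ℂ → ℂ} (hψ : IsHInfty ψ) :
    AEStronglyMeasurable (boundary ψ) volume := by
  refine hψ.boundary_induction (P := fun φ => AEStronglyMeasurable φ volume) (fun n c => ?_)
    fun φ χ _ h _ hlim => aestronglyMeasurable_of_tendsto_ae atTop h hlim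
  have := continuous_cayley
  exact Continuous.aestronglyMeasurable (by fun_prop)

/-! ### Multiplication operators -/

section MulOp

variable {N : Type*} [NormedAddCommGroup N] [InnerProductSpace ℂ N]

open scoped Classical in
/-- Multiplication by the essentially bounded function `φ` in `L₂(ℝ, N)` (and `0` if `φ` is not
essentially bounded). -/
def mulOp (N : Type*) [NormedAddCommGroup N] [InnerProductSpace ℂ N] (φ : ℝ → ℂ) :
    Lp N 2 (volume : Measure ℝ) →L[ℂ] Lp N 2 (volume : Measure ℝ) :=
  if h : MemLp φ ⊤ volume then
    (ContinuousLinearMap.lsmul ℂ ℂ : ℂ →L[ℂ] N →L[ℂ] N).holderL volume ⊤ 2 2 (h.toLp φ)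
  else 0

theorem coeFn_mulOp {φ : ℝ → ℂ} (h : MemLp φ ⊤ volume) (u : Lp N 2 (volume : Measure ℝ)) :
    mulOp N φ u =ᵐ[volume] fun x => φ x • u x := by
  rw [mulOp, dif_pos h]
  have := (ContinuousLinearMap.lsmul ℂ ℂ : ℂ →L[ℂ] N →L[ℂ] N).coeFn_holder (r := 2)
    (h.toLp φ) u
  filter_upwards [this, h.coeFn_toLp] with x h1 h2
  rw [← h2]
  exact h1

theorem mulOp_mulOp {φ χ : ℝ → ℂ} (hφ : MemLp φ ⊤ volume) (hχ : MemLp χ ⊤ volume)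
    (u : Lp N 2 (volume : Measure ℝ)) :
    mulOp N φ (mulOp N χ u) = mulOp N (fun x => φ x * χ x) u := by
  have h : MemLp (fun x => φ x * χ x) ⊤ volume := hχ.mul hφ
  refine Lp.ext ?_
  filter_upwards [coeFn_mulOp hφ (mulOp N χ u), coeFn_mulOp hχ u, coeFn_mulOp h u]
    with x h1 h2 h3
  rw [h1, h2, h3, mul_smul]

theorem mulOp_comm {φ χ : ℝ → ℂ} (hφ : MemLp φ ⊤ volume) (hχ : MemLp χ ⊤ volume)
    (u : Lp N 2 (volume : Measure ℝ)) :
    mulOp N φ (mulOp N χ u) = mulOp N χ (mulOp N φ u) := by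
  rw [mulOp_mulOp hφ hχ, mulOp_mulOp hχ hφ]
  simp only [mul_comm]

theorem mulOp_add {φ χ : ℝ → ℂ} (hφ : MemLp φ ⊤ volume) (hχ : MemLp χ ⊤ volume) :
    mulOp N (fun x => φ x + χ x) = mulOp N φ + mulOp N χ := by
  ext1 u
  refine Lp.ext ?_
  filter_upwards [coeFn_mulOp hφ u, coeFn_mulOp hχ u, coeFn_mulOp (hφ.add hχ) u,
    Lp.coeFn_add (mulOp N φ u) (mulOp N χ u)] with x h1 h2 h3 h4
  rw [add_apply, h4, Pi.add_apply, h1, h2, ← add_smul]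
  exact h3

theorem mulOp_const_mul {φ : ℝ → ℂ} (hφ : MemLp φ ⊤ volume) (c : ℂ) :
    mulOp N (fun x => c * φ x) = c • mulOp N φ := by
  ext1 u
  refine Lp.ext ?_
  filter_upwards [coeFn_mulOp hφ u, coeFn_mulOp (hφ.const_mul c) u,
    Lp.coeFn_smul c (mulOp N φ u)] with x h1 h2 h3
  rw [smul_apply, h3, Pi.smul_apply, h1, h2, mul_smul]

theorem mulOp_one : mulOp N (fun _ => 1) = ContinuousLinearMap.id ℂ _ := by
  ext1 u
  refine Lp.ext ?_
  filter_upwards [coeFn_mulOp (memLp_top_const (1 : ℂ)) u] with x h1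
  rw [h1, one_smul, ContinuousLinearMap.id_apply]

theorem norm_sq_lp (u : Lp N 2 (volume : Measure ℝ)) : ‖u‖ ^ 2 = ∫ x, ‖u x‖ ^ 2 := by
  have h := L2.inner_def (𝕜 := ℂ) u u
  simp only [inner_self_eq_norm_sq_to_K] at h
  rw [← Complex.ofReal_inj, ← integral_complex_ofReal]
  push_cast
  exact h

theorem integrable_norm_sq_lp (u : Lp N 2 (volume : Measure ℝ)) :
    Integrable (fun x => ‖u x‖ ^ 2) volume := by
  have := (Lp.memLp u).integrable_norm_rpow (by norm_num) (by norm_num)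
  simpa using this

theorem norm_mulOp_of_norm_eq_one {φ : ℝ → ℂ} (hφ : MemLp φ ⊤ volume) (h : ∀ᵐ x, ‖φ x‖ = 1)
    (u : Lp N 2 (volume : Measure ℝ)) : ‖mulOp N φ u‖ = ‖u‖ := by
  refine (pow_left_inj₀ (norm_nonneg _) (norm_nonneg _) two_ne_zero).1 ?_
  rw [norm_sq_lp, norm_sq_lp]
  refine integral_congr_ae ?_
  filter_upwards [coeFn_mulOp hφ u, h] with x h1 h2
  rw [h1, norm_smul, h2, one_mul]

theorem inner_mulOp {φ : ℝ → ℂ} (hφ : MemLp φ ⊤ volume) (u v : Lp N 2 (volume : Measure ℝ)) :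
    inner ℂ u (mulOp N φ v) = ∫ x, φ x * inner ℂ (u x) (v x) := by
  rw [L2.inner_def]
  refine integral_congr_ae ?_
  filter_upwards [coeFn_mulOp hφ v] with x h1
  rw [h1, inner_smul_right]

theorem inner_mulOp_left {φ : ℝ → ℂ} (hφ : MemLp φ ⊤ volume) (u v : Lp N 2 (volume : Measure ℝ)) :
    inner ℂ (mulOp N φ u) v = inner ℂ u (mulOp N (fun x => starRingEnd ℂ (φ x)) v) := by
  have h : MemLp (fun x => starRingEnd ℂ (φ x)) ⊤ volume := hφ.star
  rw [inner_mulOp h, L2.inner_def]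
  refine integral_congr_ae ?_
  filter_upwards [coeFn_mulOp hφ u] with x h1
  rw [h1, inner_smul_left]

theorem inner_self_mulOp {φ : ℝ → ℂ} (hφ : MemLp φ ⊤ volume) (u : Lp N 2 (volume : Measure ℝ)) :
    inner ℂ u (mulOp N φ u) = ∫ x, (‖u x‖ ^ 2 : ℝ) • φ x := by
  rw [inner_mulOp hφ]
  refine integral_congr_ae (Eventually.of_forall fun x => ?_)
  simp only [inner_self_eq_norm_sq_to_K, Complex.real_smul]
  push_cast
  exact mul_comm _ _

/-- Dominated convergence with majorant `(2C)² ‖u‖²`: bounded almost everywhere convergence of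
multipliers gives strong convergence. -/
theorem tendsto_mulOp {ι : Type*} {l : Filter ι} [l.IsCountablyGenerated] {φ : ι → ℝ → ℂ}
    {χ : ℝ → ℂ} {C : ℝ} (hφ : ∀ n, MemLp (φ n) ⊤ volume) (hχ : MemLp χ ⊤ volume)
    (hC : ∀ n, ∀ᵐ x, ‖φ n x‖ ≤ C) (hCχ : ∀ᵐ x, ‖χ x‖ ≤ C)
    (h : ∀ᵐ x, Tendsto (fun n => φ n x) l (𝓝 (χ x))) (u : Lp N 2 (volume : Measure ℝ)) :
    Tendsto (fun n => mulOp N (φ n) u) l (𝓝 (mulOp N χ u)) := by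
  rw [tendsto_iff_norm_sub_tendsto_zero]
  have key : Tendsto (fun n => ∫ x, ‖φ n x - χ x‖ ^ 2 * ‖u x‖ ^ 2) l (𝓝 (∫ _ : ℝ, (0 : ℝ))) := by
    refine tendsto_integral_filter_of_dominated_convergence (fun x => (2 * C) ^ 2 * ‖u x‖ ^ 2)
      (Eventually.of_forall fun n => ?_) (Eventually.of_forall fun n => ?_)
      ((integrable_norm_sq_lp u).const_mul _) ?_
    · exact (((hφ n).1.sub hχ.1).norm.pow 2).mul ((Lp.aestronglyMeasurable u).norm.pow 2)
    · filter_upwards [hC n, hCχ] with x h1 h2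
      rw [norm_mul, norm_pow, norm_pow, norm_norm, norm_norm]
      gcongr
      exact (norm_sub_le _ _).trans (by linarith)
    · filter_upwards [h] with x hx
      have := ((tendsto_iff_norm_sub_tendsto_zero.1 hx).pow 2).mul_const (‖u x‖ ^ 2)
      simpa using this
  rw [integral_zero] at key
  have h2 := (Real.continuous_sqrt.tendsto 0).comp key
  rw [Real.sqrt_zero] at h2
  refine h2.congr fun n => ?_
  rw [Function.comp_apply, Real.sqrt_eq_iff_mul_self_eq (by positivity) (norm_nonneg _), ← sq,
    norm_sq_lp]
  refine integral_congr_ae ?_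
  filter_upwards [Lp.coeFn_sub (mulOp N (φ n) u) (mulOp N χ u), coeFn_mulOp (hφ n) u,
    coeFn_mulOp hχ u] with x h1 h2 h3
  rw [h1, Pi.sub_apply, h2, h3, ← sub_smul, norm_smul, mul_pow]

/-! ### Functions of the frequency -/

/-- The symbol `-2 π ξ` of `i d/dx` with respect to the Fourier transform
`û(ξ) = ∫ e^{-2 π i x ξ} u(x) dx`. -/
def symbol (ξ : ℝ) : ℝ := -(2 * Real.pi) * ξ

theorem continuous_symbol : Continuous symbol := by unfold symbol; fun_prop

theorem neg_two_pi_ne_zero : -(2 * Real.pi) ≠ 0 := neg_ne_zero.2 Real.two_pi_pos.ne'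

theorem measurableEmbedding_symbol : MeasurableEmbedding symbol :=
  measurableEmbedding_mulLeft₀ neg_two_pi_ne_zero

/-- Boundary values exist only almost everywhere; this lets such statements be pulled back to the
frequency variable. -/
theorem quasiMeasurePreserving_symbol : Measure.QuasiMeasurePreserving symbol volume volume := by
  refine ⟨continuous_symbol.measurable, ?_⟩
  have : Measure.map symbol volume = ENNReal.ofReal |(-(2 * Real.pi))⁻¹| • volume :=
    Real.map_volume_mul_left neg_two_pi_ne_zero
  rw [this]
  exact Measure.smul_absolutelyContinuous

theorem memLp_top_comp_symbol {φ : ℝ → ℂ} (hφ : MemLp φ ⊤ volume) :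
    MemLp (fun x => φ (symbol x)) ⊤ volume := by
  obtain ⟨C, hC⟩ : ∃ C : ℝ, ∀ᵐ x, ‖φ x‖ ≤ C :=
    ⟨(eLpNormEssSup φ volume).toReal, by
      have h : eLpNormEssSup φ volume ≠ ⊤ := by simpa [eLpNorm_exponent_top] using hφ.2.ne
      filter_upwards [ae_le_eLpNormEssSup (f := φ) (μ := volume)] with x hx
      rw [← toReal_enorm]
      exact ENNReal.toReal_mono h hx⟩
  exact memLp_top_of_bound (hφ.1.comp_quasiMeasurePreserving quasiMeasurePreserving_symbol) C
    (quasiMeasurePreserving_symbol.ae hC)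

theorem memLp_top_of_continuous {φ : ℝ → ℂ} (hφ : Continuous φ) {C : ℝ} (hC : ∀ t, ‖φ t‖ ≤ C) :
    MemLp φ ⊤ volume :=
  memLp_top_of_bound hφ.aestronglyMeasurable C (Eventually.of_forall hC)

theorem memLp_top_indicator (S : Set ℝ) (hS : MeasurableSet S) :
    MemLp (S.indicator fun _ => (1 : ℂ)) ⊤ volume :=
  (memLp_top_const (1 : ℂ)).indicator hS

theorem memLp_top_resolvent : MemLp (fun t : ℝ => 1 / ((t : ℂ) + Complex.I)) ⊤ volume :=
  memLp_top_of_continuous (continuous_const.div (by fun_prop) ofReal_add_I_ne_zero)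
    norm_one_div_add_I_le

theorem memLp_top_cayley_pow (n : ℕ) : MemLp (fun t : ℝ => cayley t ^ n) ⊤ volume :=
  memLp_top_of_continuous (continuous_cayley.pow n) (C := 1)
    fun t => by rw [norm_pow, norm_cayley, one_pow]

theorem IsHInfty.memLp_boundary {ψ : ℂ → ℂ} (hψ : IsHInfty ψ) : MemLp (boundary ψ) ⊤ volume := by
  obtain ⟨C, hC⟩ := hψ.ae_norm_boundary_le
  exact memLp_top_of_bound hψ.aestronglyMeasurable_boundary C hC

/-- Multiplication by `φ(-2 π ξ)` in `L₂(ℝ, N)`. -/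
def freqMul (N : Type*) [NormedAddCommGroup N] [InnerProductSpace ℂ N] (φ : ℝ → ℂ) :
    Lp N 2 (volume : Measure ℝ) →L[ℂ] Lp N 2 (volume : Measure ℝ) :=
  mulOp N fun x => φ (symbol x)

theorem freqMul_mul {φ χ : ℝ → ℂ} (hφ : MemLp φ ⊤ volume) (hχ : MemLp χ ⊤ volume)
    (u : Lp N 2 (volume : Measure ℝ)) :
    freqMul N φ (freqMul N χ u) = freqMul N (fun x => φ x * χ x) u :=
  mulOp_mulOp (memLp_top_comp_symbol hφ) (memLp_top_comp_symbol hχ) u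

theorem freqMul_comm {φ χ : ℝ → ℂ} (hφ : MemLp φ ⊤ volume) (hχ : MemLp χ ⊤ volume)
    (u : Lp N 2 (volume : Measure ℝ)) :
    freqMul N φ (freqMul N χ u) = freqMul N χ (freqMul N φ u) :=
  mulOp_comm (memLp_top_comp_symbol hφ) (memLp_top_comp_symbol hχ) u

end MulOp

/-! ### The spectral family of a compression of a multiplication operator -/

section Compression

variable {N : Type*} [NormedAddCommGroup N] [InnerProductSpace ℂ N] [CompleteSpace N]
  {H : Type*} [NormedAddCommGroup H] [InnerProductSpace ℂ H] [CompleteSpace H]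

/-- The compression of the multiplication by `φ(-2 π ξ)` along an isometry into `L₂(ℝ, N)`. -/
def compress (ι : H →ₗᵢ[ℂ] Lp N 2 (volume : Measure ℝ)) (φ : ℝ → ℂ) : H →L[ℂ] H :=
  ContinuousLinearMap.adjoint ι.toContinuousLinearMap ∘L freqMul N φ ∘L ι.toContinuousLinearMap

variable (ι : H →ₗᵢ[ℂ] Lp N 2 (volume : Measure ℝ))

theorem inner_compress (φ : ℝ → ℂ) (f g : H) :
    inner ℂ g (compress ι φ f) = inner ℂ (ι g) (freqMul N φ (ι f)) := by
  rw [compress, ContinuousLinearMap.comp_apply, ContinuousLinearMap.adjoint_inner_right]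
  rfl

theorem adjoint_apply_self (f : H) :
    ContinuousLinearMap.adjoint ι.toContinuousLinearMap (ι f) = f := by
  refine ext_inner_left ℂ fun g => ?_
  rw [ContinuousLinearMap.adjoint_inner_right]
  exact ι.inner_map_map g f

/-- When the product stays in the range of `ι`, the final projection does nothing and the
compression is a restriction. -/
theorem compress_eq_of_mem {φ : ℝ → ℂ} {f g : H} (h : ι g = freqMul N φ (ι f)) :
    compress ι φ f = g := by
  rw [compress, ContinuousLinearMap.comp_apply, ContinuousLinearMap.comp_apply]
  change ContinuousLinearMap.adjoint ι.toContinuousLinearMap (freqMul N φ (ι f)) = g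
  rw [← h, adjoint_apply_self]

theorem inner_self_compress {φ : ℝ → ℂ} (hφ : MemLp φ ⊤ volume) (f : H) :
    inner ℂ f (compress ι φ f) = ∫ x, (‖ι f x‖ ^ 2 : ℝ) • φ (symbol x) := by
  rw [inner_compress, freqMul, inner_self_mulOp (memLp_top_comp_symbol hφ)]

theorem tendsto_compress {κ : Type*} {l : Filter κ} [l.IsCountablyGenerated] {φ : κ → ℝ → ℂ}
    {χ : ℝ → ℂ} {C : ℝ} (hφ : ∀ n, MemLp (φ n) ⊤ volume) (hχ : MemLp χ ⊤ volume)
    (hC : ∀ n, ∀ x, ‖φ n x‖ ≤ C) (hCχ : ∀ x, ‖χ x‖ ≤ C)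
    (h : ∀ x, Tendsto (fun n => φ n x) l (𝓝 (χ x))) (f : H) :
    Tendsto (fun n => compress ι (φ n) f) l (𝓝 (compress ι χ f)) :=
  ((ContinuousLinearMap.adjoint ι.toContinuousLinearMap).continuous.tendsto _).comp
    (tendsto_mulOp (fun n => memLp_top_comp_symbol (hφ n)) (memLp_top_comp_symbol hχ)
      (fun n => Eventually.of_forall fun _ => hC n _) (Eventually.of_forall fun _ => hCχ _)
      (Eventually.of_forall fun _ => h _) (ι f))

theorem norm_indicator_one_le (S : Set ℝ) (x : ℝ) : ‖S.indicator (fun _ => (1 : ℂ)) x‖ ≤ 1 :=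
  (norm_indicator_le_norm_self _ _).trans (by simp)

/-- The compression of the spectral family of the multiplication by `-2 π ξ`. -/
def compressFamily : SpectralFamily H where
  toFun t := compress ι ((Set.Iic t).indicator fun _ => 1)
  mono s t hst := by
    rw [ContinuousLinearMap.isPositive_iff_complex]
    intro f
    have hs := inner_self_compress ι (memLp_top_indicator (Set.Iic s) measurableSet_Iic) f
    have ht := inner_self_compress ι (memLp_top_indicator (Set.Iic t) measurableSet_Iic) f
    have hi (r : ℝ) : Integrable (fun x => (‖ι f x‖ ^ 2 : ℝ) •
        (Set.Iic r).indicator (fun _ => (1 : ℂ)) (symbol x)) volume := by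
      have h1 := (integrable_norm_sq_lp (ι f)).ofReal (𝕜 := ℂ)
      have h2 := h1.bdd_mul
        (memLp_top_comp_symbol (memLp_top_indicator (Set.Iic r) measurableSet_Iic)).1
        (Eventually.of_forall fun x => norm_indicator_one_le _ _)
      refine h2.congr (Eventually.of_forall fun x => ?_)
      simp only [Complex.real_smul, mul_comm]
      rfl
    -- The increment is the compression of multiplication by the indicator of `(s, t]`, so its form
    -- is the integral of a nonnegative function.
    have hd : inner ℂ f ((compress ι ((Set.Iic t).indicator fun _ => 1)
        - compress ι ((Set.Iic s).indicator fun _ => 1)) f)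
        = ((∫ x, ‖ι f x‖ ^ 2 * (Set.Ioc s t).indicator (fun _ => (1 : ℝ)) (symbol x) : ℝ) : ℂ) := by
      rw [sub_apply, inner_sub_right, hs, ht, ← integral_sub (hi t) (hi s),
        ← integral_complex_ofReal]
      refine integral_congr_ae (Eventually.of_forall fun x => ?_)
      simp only [Set.indicator_apply, Set.mem_Iic, Set.mem_Ioc]
      by_cases h1 : symbol x ≤ s
      · simp [h1, h1.trans hst, not_lt.2 h1]
      · by_cases h2 : symbol x ≤ t <;> simp [h1, h2, not_le.1 h1]
    rw [← inner_conj_symm, hd, Complex.conj_ofReal]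
    refine ⟨by simp, ?_⟩
    simp only [RCLike.re_eq_complex_re, Complex.ofReal_re]
    refine integral_nonneg fun x => mul_nonneg (by positivity) ?_
    exact Set.indicator_nonneg (fun _ _ => zero_le_one) _
  right_cont f s := by
    refine tendsto_compress ι (fun t => memLp_top_indicator (Set.Iic t) measurableSet_Iic)
      (memLp_top_indicator _ measurableSet_Iic) (fun t => norm_indicator_one_le _)
      (norm_indicator_one_le _) (fun x => ?_) f
    refine tendsto_const_nhds.congr' ?_
    rcases le_or_gt x s with hx | hx
    · filter_upwards [self_mem_nhdsWithin] with t ht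
      simp [hx, hx.trans ht]
    · filter_upwards [nhdsWithin_le_nhds (Iio_mem_nhds hx)] with t ht
      have ht' : t < x := ht
      simp [hx, ht']
  bot f := by
    have := tendsto_compress ι (χ := fun _ => 0) (l := atBot)
      (fun t => memLp_top_indicator (Set.Iic t) measurableSet_Iic)
      (memLp_top_const 0) (fun t => norm_indicator_one_le _) (by simp) (fun x => by
        refine tendsto_const_nhds.congr' ?_
        filter_upwards [eventually_lt_atBot x] with t ht
        simp [ht]) f
    have h0 : compress ι (fun _ => (0 : ℂ)) f = 0 := by
      refine compress_eq_of_mem ι ?_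
      rw [map_zero]
      symm
      rw [Lp.eq_zero_iff_ae_eq_zero]
      filter_upwards [coeFn_mulOp (N := N) (memLp_top_comp_symbol (memLp_top_const (0 : ℂ))) (ι f)]
        with x hx
      rw [freqMul, hx, zero_smul]
      rfl
    rwa [h0] at this
  top f := by
    have := tendsto_compress ι (χ := fun _ => 1) (l := atTop)
      (fun t => memLp_top_indicator (Set.Iic t) measurableSet_Iic)
      (memLp_top_const 1) (fun t => norm_indicator_one_le _) (by simp) (fun x => by
        refine tendsto_const_nhds.congr' ?_
        filter_upwards [eventually_ge_atTop x] with t ht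
        simp [ht]) f
    have h0 : compress ι (fun _ => (1 : ℂ)) f = f := by
      refine compress_eq_of_mem ι ?_
      rw [freqMul, mulOp_one]
      rfl
    rwa [h0] at this

/-- The two measures agree on the half-lines `(-∞, t]`. Integrals against the spectral function thus
become Lebesgue integrals with density `‖ι f‖²`. -/
theorem compressFamily_measure (f : H) : (compressFamily ι).measure f =
    Measure.map symbol (volume.withDensity fun x => ENNReal.ofReal (‖ι f x‖ ^ 2)) := by
  refine Measure.ext_of_Iic _ _ fun t => ?_
  have hpos : 0 ≤ ∫ x in symbol ⁻¹' Set.Iic t, ‖ι f x‖ ^ 2 :=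
    integral_nonneg fun x => by positivity
  have hm : MeasurableSet (symbol ⁻¹' Set.Iic t) := continuous_symbol.measurable measurableSet_Iic
  rw [SpectralFamily.measure, StieltjesFunction.measure_Iic _
    ((compressFamily ι).re_inner_tendsto_bot f), sub_zero,
    Measure.map_apply continuous_symbol.measurable measurableSet_Iic, withDensity_apply _ hm,
    ← ofReal_integral_eq_lintegral_ofReal (integrable_norm_sq_lp (ι f)).integrableOn
      (Eventually.of_forall fun x => by positivity)]
  congr 1
  have h := inner_self_compress ι (memLp_top_indicator (Set.Iic t) measurableSet_Iic) f
  change (inner ℂ f (compress ι ((Set.Iic t).indicator fun _ => 1) f)).re = _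
  rw [h, ← integral_indicator hm, ← Complex.ofReal_re (∫ x, _), ← integral_complex_ofReal]
  congr 1
  refine integral_congr_ae (Eventually.of_forall fun x => ?_)
  by_cases hx : symbol x ≤ t <;> simp [hx]

theorem measurable_density (f : H) : Measurable fun x => ENNReal.ofReal (‖ι f x‖ ^ 2) :=
  (((Lp.stronglyMeasurable (ι f)).norm.measurable).pow_const 2).ennreal_ofReal

theorem integral_compressFamily_measure {F : Type*} [NormedAddCommGroup F] [NormedSpace ℝ F]
    (φ : ℝ → F) (f : H) : ∫ t, φ t ∂(compressFamily ι).measure f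
      = ∫ x, (‖ι f x‖ ^ 2 : ℝ) • φ (symbol x) := by
  rw [compressFamily_measure, measurableEmbedding_symbol.integral_map,
    integral_withDensity_eq_integral_toReal_smul (measurable_density ι f)
      (Eventually.of_forall fun x => ENNReal.ofReal_lt_top)]
  refine integral_congr_ae (Eventually.of_forall fun x => ?_)
  simp only
  rw [ENNReal.toReal_ofReal (by positivity)]

theorem integrable_compressFamily_measure {F : Type*} [NormedAddCommGroup F] [NormedSpace ℝ F]
    (φ : ℝ → F) (f : H) : Integrable φ ((compressFamily ι).measure f)
      ↔ Integrable (fun x => (‖ι f x‖ ^ 2 : ℝ) • φ (symbol x)) volume := by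
  rw [compressFamily_measure, measurableEmbedding_symbol.integrable_map_iff,
    integrable_withDensity_iff_integrable_smul' (measurable_density ι f)
      (Eventually.of_forall fun x => ENNReal.ofReal_lt_top)]
  refine integrable_congr (Eventually.of_forall fun x => ?_)
  simp only [Function.comp_apply]
  rw [ENNReal.toReal_ofReal (by positivity)]

theorem compressFamily_isIntegral {φ : ℝ → ℂ} (hφ : MemLp φ ⊤ volume) :
    (compressFamily ι).IsIntegral φ (compress ι φ) := by
  constructor
  · intro f
    rw [integrable_compressFamily_measure]
    have h1 := (integrable_norm_sq_lp (ι f)).ofReal (𝕜 := ℂ)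
    have h2 := memLp_one_iff_integrable.1 ((memLp_one_iff_integrable.2 h1).mul (p := ⊤) (q := 1)
      (r := 1) (memLp_top_comp_symbol hφ))
    refine h2.congr (Eventually.of_forall fun x => ?_)
    simp only [Complex.real_smul, Pi.mul_apply]
    rw [mul_comm]
    rfl
  · intro f g
    rw [inner_polarization _ f g, SpectralFamily.integral]
    simp only [integral_compressFamily_measure, inner_self_compress ι hφ]

end Compression

/-! ### Operators that are restrictions of a multiplication operator -/

section Model

variable {N : Type*} [NormedAddCommGroup N] [InnerProductSpace ℂ N] [CompleteSpace N]
  {H : Type*} [NormedAddCommGroup H] [InnerProductSpace ℂ H]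

/-- `R` is the inverse of `B + i`, and the isometry `ι` carries `R` to the multiplication by
`1 / (-2 π ξ + i)`. -/
structure IsModel (B : H →ₗ.[ℂ] H) (R : H →L[ℂ] H)
    (ι : H →ₗᵢ[ℂ] Lp N 2 (volume : Measure ℝ)) : Prop where
  resolvent : IsResolvent B R
  map_resolvent : ∀ g : H, ι (R g) = freqMul N (fun t => 1 / ((t : ℂ) + Complex.I)) (ι g)

theorem IsResolvent.mem_domain {B : H →ₗ.[ℂ] H} {R : H →L[ℂ] H} (hR : IsResolvent B R) (g : H) :
    ∃ h : R g ∈ B.domain, B ⟨R g, h⟩ = g - Complex.I • R g := by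
  have := (hR (R g, g - Complex.I • R g)).2 ⟨g, rfl⟩
  rw [LinearPMap.mem_graph_iff] at this
  obtain ⟨y, hy1, hy2⟩ := this
  have hm : R g ∈ B.domain := by
    have := y.2
    rwa [hy1] at this
  have hy : y = ⟨R g, hm⟩ := Subtype.ext hy1
  exact ⟨hm, by rw [← hy, hy2]⟩

theorem IsResolvent.exists_eq {B : H →ₗ.[ℂ] H} {R : H →L[ℂ] H} (hR : IsResolvent B R)
    (f : B.domain) : ∃ g, (f : H) = R g ∧ B f = g - Complex.I • R g := by
  obtain ⟨g, hg⟩ := (hR (f, B f)).1 (B.mem_graph f)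
  exact ⟨g, congrArg Prod.fst hg, congrArg Prod.snd hg⟩

variable {B : H →ₗ.[ℂ] H} {R : H →L[ℂ] H} {ι : H →ₗᵢ[ℂ] Lp N 2 (volume : Measure ℝ)}

namespace IsModel

/-- With `f = R g` and `B f = g - i R g` this is the scalar identity `1 - i / (t + i) = t / (t +
i)`. -/
theorem map_apply (h : IsModel B R ι) (f : B.domain) :
    ι (B f) =ᵐ[volume] fun x => (symbol x : ℂ) • ι f x := by
  obtain ⟨g, hg1, hg2⟩ := h.resolvent.exists_eq f
  rw [hg1, hg2, map_sub, map_smul, h.map_resolvent]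
  filter_upwards [coeFn_mulOp (N := N) (memLp_top_comp_symbol memLp_top_resolvent) (ι g),
    Lp.coeFn_sub (ι g) (Complex.I • freqMul N (fun t => 1 / ((t : ℂ) + Complex.I)) (ι g)),
    Lp.coeFn_smul Complex.I (freqMul N (fun t => 1 / ((t : ℂ) + Complex.I)) (ι g))]
    with x h1 h2 h3
  rw [h2, Pi.sub_apply, h3, Pi.smul_apply, freqMul, h1, smul_smul, smul_smul]
  nth_rw 1 [← one_smul ℂ (ι g x)]
  rw [← sub_smul]
  congr 1
  have := ofReal_add_I_ne_zero (symbol x)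
  field_simp
  ring

variable [CompleteSpace H]

theorem isSpectralFunction (h : IsModel B R ι) : IsSpectralFunction B (compressFamily ι) := by
  intro f
  have hB := h.map_apply f
  have hsq : ∀ᵐ x, ‖ι (B f) x‖ ^ 2 = (‖ι (f : H) x‖ ^ 2 : ℝ) • (symbol x) ^ 2 := by
    filter_upwards [hB] with x hx
    rw [hx, norm_smul, mul_pow, Complex.norm_real, Real.norm_eq_abs, sq_abs, smul_eq_mul, mul_comm]
  refine ⟨?_, ?_, ?_⟩
  · rw [integrable_compressFamily_measure]
    exact (integrable_norm_sq_lp _).congr hsq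
  · rw [integral_compressFamily_measure, ← integral_complex_ofReal, ← ι.inner_map_map,
      L2.inner_def]
    refine integral_congr_ae ?_
    filter_upwards [hB] with x hx
    rw [hx, inner_smul_right, inner_self_eq_norm_sq_to_K]
    rw [smul_eq_mul]
    push_cast
    exact mul_comm _ _
  · rw [integral_compressFamily_measure, ← ι.norm_map (B f), norm_sq_lp]
    exact (integral_congr_ae hsq).symm

/-- The range of `ι` is invariant under multiplication by the Cayley function, which is the image of
`g ↦ g - 2i R g`, hence under its polynomials. Being closed, it absorbs strong limits, so
`boundary_induction` applies. Essential boundedness is carried through the induction so that each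
multiplier defines an operator. -/
theorem exists_map_eq_freqMul (h : IsModel B R ι) {ψ : ℂ → ℂ} (hψ : IsHInfty ψ) (g : H) :
    ∃ g', ι g' = freqMul N (boundary ψ) (ι g) := by
  have hclosed : IsClosed (Set.range ι) := ι.isometry.isClosedEmbedding.isClosed_range
  have key : MemLp (fun x => boundary ψ (symbol x)) ⊤ volume ∧
      ∀ g, freqMul N (boundary ψ) (ι g) ∈ Set.range ι := by
    refine hψ.boundary_induction (P := fun φ => MemLp (fun x => φ (symbol x)) ⊤ volume ∧
      ∀ g, freqMul N φ (ι g) ∈ Set.range ι) (fun n c => ?_) ?_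
    · induction n with
      | zero =>
        simp only [Finset.range_zero, Finset.sum_empty]
        refine ⟨memLp_top_const _, fun g => ⟨(0 : ℂ) • g, ?_⟩⟩
        have := mulOp_const_mul (N := N) (memLp_top_const (μ := (volume : Measure ℝ)) (1 : ℂ)) 0
        simp only [zero_mul, zero_smul] at this
        rw [freqMul, this]
        simp
      | succ n ih =>
        simp only [Finset.sum_range_succ]
        have hcp : MemLp (fun x => cayley (symbol x) ^ n) ⊤ volume :=
          memLp_top_comp_symbol (memLp_top_cayley_pow n)
        refine ⟨ih.1.add (hcp.const_mul _), fun g => ?_⟩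
        have hpow : ∀ m : ℕ, ∀ g, freqMul N (fun t => cayley t ^ m) (ι g) ∈ Set.range ι := by
          intro m
          induction m with
          | zero =>
            intro g
            simp only [pow_zero]
            exact ⟨g, by rw [freqMul, mulOp_one]; rfl⟩
          | succ m ihm =>
            intro g
            have e : freqMul N (fun t => cayley t ^ (m + 1)) (ι g) =
                freqMul N (fun t => cayley t ^ m) (ι (g - (2 * Complex.I) • R g)) := by
              have e1 : ι (g - (2 * Complex.I) • R g) = freqMul N (fun t => cayley t ^ 1) (ι g) := by
                have hmr := memLp_top_comp_symbol memLp_top_resolvent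
                have := mulOp_add (N := N) (memLp_top_const (μ := (volume : Measure ℝ)) (1 : ℂ))
                  (hmr.const_mul (-(2 * Complex.I)))
                rw [mulOp_const_mul hmr, mulOp_one] at this
                have e2 : (fun x => (1 : ℂ) + -(2 * Complex.I) * (1 / ((symbol x : ℂ) + Complex.I)))
                    = fun x => cayley (symbol x) ^ 1 := by
                  funext x
                  rw [pow_one, cayley_eq]
                  ring
                rw [e2] at this
                rw [freqMul, this, map_sub, map_smul, h.map_resolvent]
                simp [freqMul, sub_eq_add_neg]
              rw [e1, freqMul_mul (memLp_top_cayley_pow m) (memLp_top_cayley_pow 1)]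
              simp only [← pow_add]
            rw [e]
            exact ihm _
        obtain ⟨a, ha⟩ := ih.2 g
        obtain ⟨b, hb⟩ := hpow n g
        refine ⟨a + c n • b, ?_⟩
        rw [freqMul, mulOp_add ih.1 (hcp.const_mul _), mulOp_const_mul hcp, map_add, map_smul, ha,
          hb]
        rfl
    · intro φ χ C hφ hC hlim
      have hlim' := quasiMeasurePreserving_symbol.ae hlim
      have hbχ : ∀ᵐ x, ‖χ (symbol x)‖ ≤ C := by
        filter_upwards [hlim'] with x hx
        exact le_of_tendsto hx.norm (Eventually.of_forall fun n => hC n _)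
      have hχ : MemLp (fun x => χ (symbol x)) ⊤ volume :=
        memLp_top_of_bound (aestronglyMeasurable_of_tendsto_ae atTop (fun n => (hφ n).1.1) hlim')
          C hbχ
      refine ⟨hχ, fun g => ?_⟩
      exact hclosed.mem_of_tendsto (tendsto_mulOp (fun n => (hφ n).1) hχ
        (fun n => Eventually.of_forall fun _ => hC n _) hbχ hlim' (ι g))
        (Eventually.of_forall fun n => (hφ n).2 g)
  exact key.2 g

/-- The definition chooses some spectral function; by uniqueness it is the compressed one, and the
weak integral determines the operator. -/
theorem funCalc_eq (h : IsModel B R ι) {ψ : ℂ → ℂ} (hψ : IsHInfty ψ) :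
    funCalc B ψ = compress ι (boundary ψ) := by
  have hex : ∃ T : H →L[ℂ] H, ∃ E : SpectralFamily H,
      IsSpectralFunction B E ∧ E.IsIntegral (boundary ψ) T :=
    ⟨_, _, h.isSpectralFunction, compressFamily_isIntegral ι hψ.memLp_boundary⟩
  rw [funCalc, dif_pos hex]
  obtain ⟨E, hE, hI⟩ := hex.choose_spec
  rw [hE.unique h.resolvent h.isSpectralFunction] at hI
  ext1 f
  refine ext_inner_left ℂ fun g => ?_
  rw [hI.2, (compressFamily_isIntegral ι hψ.memLp_boundary).2]

/-- The central consequence of invariance: `ι` intertwines `ψ(B)` with an actual multiplication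
operator, so products of functions of `B` can be computed pointwise. -/
theorem map_funCalc (h : IsModel B R ι) {ψ : ℂ → ℂ} (hψ : IsHInfty ψ) (g : H) :
    ι (funCalc B ψ g) = freqMul N (boundary ψ) (ι g) := by
  obtain ⟨g', hg'⟩ := h.exists_map_eq_freqMul hψ g
  rw [h.funCalc_eq hψ, compress_eq_of_mem ι hg', hg']

theorem existsUnique_spectralFunction (h : IsModel B R ι) :
    IsSpectralFunction B (compressFamily ι) ∧
      (∀ E' : SpectralFamily H, IsSpectralFunction B E' → E' = compressFamily ι) ∧
      ∀ ψ : ℂ → ℂ, IsHInfty ψ →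
        (compressFamily ι).IsIntegral (boundary ψ) (funCalc B ψ) :=
  ⟨h.isSpectralFunction, fun _ hE' => hE'.unique h.resolvent h.isSpectralFunction,
    fun ψ hψ => by
      rw [h.funCalc_eq hψ]
      exact compressFamily_isIntegral ι hψ.memLp_boundary⟩

theorem funCalc_comm (h : IsModel B R ι) {ψ₁ ψ₂ : ℂ → ℂ} (h₁ : IsHInfty ψ₁) (h₂ : IsHInfty ψ₂) :
    funCalc B ψ₁ ∘L funCalc B ψ₂ = funCalc B ψ₂ ∘L funCalc B ψ₁ := by
  ext1 f
  apply ι.injective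
  simp only [ContinuousLinearMap.comp_apply]
  rw [h.map_funCalc h₁, h.map_funCalc h₂, h.map_funCalc h₂, h.map_funCalc h₁,
    freqMul_comm h₁.memLp_boundary h₂.memLp_boundary]

theorem isometry_funCalc (h : IsModel B R ι) {ψ : ℂ → ℂ} (hψ : IsInner ψ) :
    Isometry (funCalc B ψ) := by
  refine AddMonoidHomClass.isometry_of_norm _ fun f => ?_
  rw [← ι.norm_map, h.map_funCalc hψ.1, freqMul,
    norm_mulOp_of_norm_eq_one (memLp_top_comp_symbol hψ.1.memLp_boundary)
      (quasiMeasurePreserving_symbol.ae hψ.2), ι.norm_map]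

end IsModel

theorem isHInfty_resolvent : IsHInfty fun δ => 1 / (δ + Complex.I) := by
  have hne : ∀ z : ℂ, 0 < z.im → z + Complex.I ≠ 0 := fun z hz h => by
    have := congrArg Complex.im h
    simp at this
    linarith
  refine ⟨DifferentiableOn.div (by fun_prop) (by fun_prop) fun z hz => hne z hz, 1, fun z hz => ?_⟩
  rw [norm_div, norm_one, div_le_one (norm_pos_iff.2 (hne z hz))]
  have := (le_abs_self _).trans (Complex.abs_im_le_norm (z + Complex.I))
  simp at this
  linarith

theorem boundary_resolvent (t : ℝ) :
    boundary (fun δ => 1 / (δ + Complex.I)) t = 1 / ((t : ℂ) + Complex.I) :=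
  boundary_eq_of_continuousAt (ContinuousAt.div (by fun_prop) (by fun_prop)
    (ofReal_add_I_ne_zero t))

namespace IsModel

variable [CompleteSpace H]

theorem funCalc_resolvent (h : IsModel B R ι) :
    funCalc B (fun δ => 1 / (δ + Complex.I)) = R := by
  ext1 f
  apply ι.injective
  rw [h.map_funCalc isHInfty_resolvent, h.map_resolvent]
  simp only [freqMul, boundary_resolvent]

theorem funCalc_resolvent_apply_eq_iff (h : IsModel B R ι) (f g : H) :
    funCalc B (fun δ => 1 / (δ + Complex.I)) f = g ↔
      ∃ hg : g ∈ B.domain, B ⟨g, hg⟩ + Complex.I • g = f := by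
  rw [h.funCalc_resolvent]
  constructor
  · rintro rfl
    obtain ⟨hm, he⟩ := h.resolvent.mem_domain f
    exact ⟨hm, by rw [he, sub_add_cancel]⟩
  · rintro ⟨hg, rfl⟩
    obtain ⟨k, hk1, hk2⟩ := h.resolvent.exists_eq ⟨g, hg⟩
    simp only at hk1
    rw [hk2, hk1, sub_add_cancel]

theorem funCalc_apply_comm (h : IsModel B R ι) {ψ : ℂ → ℂ} (hψ : IsHInfty ψ) (f : B.domain) :
    ∃ hf : funCalc B ψ (f : H) ∈ B.domain,
      B ⟨funCalc B ψ (f : H), hf⟩ = funCalc B ψ (B f) := by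
  obtain ⟨g, hg1, hg2⟩ := h.resolvent.exists_eq f
  -- `R` is itself the function `1 / (δ + i)` of `B`, so commuting with `B` reduces to commutativity
  -- of the calculus.
  have hc : funCalc B ψ (R g) = R (funCalc B ψ g) := by
    have := h.funCalc_comm hψ isHInfty_resolvent
    rw [h.funCalc_resolvent] at this
    exact DFunLike.congr_fun this g
  rw [hg2, map_sub, map_smul]
  simp only [hg1, hc]
  exact h.resolvent.mem_domain _

end IsModel

/-- A symmetric operator `C` for which `C + i` and `C - i` are onto is self-adjoint. -/
theorem isSelfAdjoint_of_surjective [CompleteSpace H] {C : H →ₗ.[ℂ] H} (hs : C.IsFormalAdjoint C)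
    (hp : ∀ g : H, ∃ f : C.domain, C f + Complex.I • (f : H) = g)
    (hm : ∀ g : H, ∃ f : C.domain, C f - Complex.I • (f : H) = g) : IsSelfAdjoint C := by
  have hd : Dense (C.domain : Set H) := by
    rw [Submodule.dense_iff_topologicalClosure_eq_top,
      Submodule.topologicalClosure_eq_top_iff, Submodule.eq_bot_iff]
    intro x hx
    obtain ⟨y, rfl⟩ := hp x
    have h1 : inner ℂ (y : H) (C y + Complex.I • (y : H)) = 0 :=
      (Submodule.mem_orthogonal _ _).1 hx _ y.2
    have h2 := hs y y
    rw [inner_add_right, inner_smul_right, inner_self_eq_norm_sq_to_K] at h1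
    have h3 : (inner ℂ (y : H) (C y)).im = 0 := by
      have := congrArg Complex.im h2
      rw [← inner_conj_symm, Complex.conj_im] at this
      linarith
    have h4 := congrArg Complex.im h1
    have h5 : ‖(y : H)‖ ^ 2 = 0 := by
      simpa [h3, ← Complex.ofReal_pow] using h4
    have h6 : (y : H) = 0 := by simpa using h5
    rw [h6, show y = 0 from Subtype.ext h6, LinearPMap.map_zero, smul_zero, add_zero]
  have hle : C ≤ C.adjoint := hs.le_adjoint hd
  rw [LinearPMap.isSelfAdjoint_def]
  refine (LinearPMap.eq_of_le_of_domain_eq hle (le_antisymm hle.1 fun x hx => ?_)).symm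
  -- Solve `(C - i) y = (C* - i) x` in the domain of `C`. Then `x - y` is orthogonal to the range of
  -- `C + i`, which is everything, so `x = y`.
  obtain ⟨y, hy⟩ := hm (C.adjoint ⟨x, hx⟩ - Complex.I • x)
  have hz : x - y = 0 := by
    obtain ⟨z, hz⟩ := hp (x - y)
    have e1 := (LinearPMap.adjoint_isFormalAdjoint hd) ⟨x, hx⟩ z
    have e2 := hs y z
    simp only at e1
    have e3 : inner ℂ (x - y) (C z + Complex.I • (z : H)) = 0 := by
      rw [inner_add_right, inner_smul_right, inner_sub_left, inner_sub_left, ← e1, ← e2]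
      have e4 : C.adjoint ⟨x, hx⟩ - Complex.I • x - (C y - Complex.I • (y : H)) = 0 := by
        rw [hy, sub_self]
      have e5 : inner ℂ (C.adjoint ⟨x, hx⟩ - Complex.I • x - (C y - Complex.I • (y : H)))
          (z : H) = 0 := by rw [e4, inner_zero_left]
      simp only [inner_sub_left, inner_smul_left, Complex.conj_I] at e5
      linear_combination e5
    rwa [hz, inner_self_eq_zero] at e3
  rw [sub_eq_zero] at hz
  rw [hz]
  exact y.2

/-- An operator is symmetric if its Cayley transform is isometric. -/
theorem IsResolvent.isFormalAdjoint {B : H →ₗ.[ℂ] H} {R : H →L[ℂ] H} (hR : IsResolvent B R)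
    (hV : ∀ g h : H, inner ℂ (g - (2 * Complex.I) • R g) (h - (2 * Complex.I) • R h)
      = inner ℂ g h) : B.IsFormalAdjoint B := by
  intro x y
  obtain ⟨g, hg1, hg2⟩ := hR.exists_eq x
  obtain ⟨h, hh1, hh2⟩ := hR.exists_eq y
  rw [hg1, hg2, hh1, hh2]
  have := hV g h
  simp only [inner_sub_left, inner_sub_right, inner_smul_left, inner_smul_right, map_mul,
    Complex.conj_I, map_ofNat] at this ⊢
  linear_combination (Complex.I / 2) * this +
    (-(inner ℂ (R g) h) + inner ℂ g (R h) + 2 * Complex.I * inner ℂ (R g) (R h)) * Complex.I_sq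
end Model

/-! ### The operator `i d/dx` on the line -/

section Line

variable {N : Type*} [NormedAddCommGroup N] [InnerProductSpace ℂ N]

/-- Cauchy–Schwarz against the indicator of `s` with constant value the integral `m` itself,
followed by division by `‖m‖`. -/
theorem norm_setIntegral_le_sqrt_mul [CompleteSpace N] {s : Set ℝ} (hs : MeasurableSet s)
    (hμ : volume s ≠ ⊤)
    (g : Lp N 2 (volume : Measure ℝ)) :
    ‖∫ x in s, g x‖ ≤ √(volume.real s) * ‖g‖ := by
  set m := ∫ x in s, g x with hm
  have h1 : inner ℂ (indicatorConstLp 2 hs hμ m) g = inner ℂ m m :=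
    L2.inner_indicatorConstLp_eq_inner_setIntegral ℂ hs hμ m g
  have h2 : ‖m‖ * ‖m‖ ≤ ‖indicatorConstLp 2 hs hμ m‖ * ‖g‖ := by
    have h3 : ‖m‖ * ‖m‖ = ‖(inner ℂ m m : ℂ)‖ := by
      rw [inner_self_eq_norm_sq_to_K, norm_pow, ← sq]
      simp
    rw [h3, ← h1]
    exact norm_inner_le_norm _ _
  rw [norm_indicatorConstLp (by norm_num) (by norm_num)] at h2
  have h3 : volume.real s ^ (1 / (2 : ENNReal).toReal) = √(volume.real s) := by
    rw [Real.sqrt_eq_rpow]; norm_num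
  rw [h3] at h2
  rcases (norm_nonneg m).eq_or_lt with h0 | h0
  · rw [← h0]; positivity
  · exact le_of_mul_le_mul_left (by linarith) h0

theorem norm_intervalIntegral_le_sqrt_mul [CompleteSpace N] (a b : ℝ)
    (g : Lp N 2 (volume : Measure ℝ)) :
    ‖∫ x in a..b, g x‖ ≤ √|b - a| * ‖g‖ := by
  rw [intervalIntegral.norm_intervalIntegral_eq]
  have := norm_setIntegral_le_sqrt_mul (measurableSet_uIoc (a := a) (b := b))
    (by rw [Real.volume_uIoc]; exact ENNReal.ofReal_ne_top) g
  rwa [Measure.real, Real.volume_uIoc, ENNReal.toReal_ofReal (abs_nonneg _)] at this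

theorem tendsto_intervalIntegral_lp [CompleteSpace N] {ι : Type*} {l : Filter ι}
    {g : ι → Lp N 2 (volume : Measure ℝ)}
    {g' : Lp N 2 (volume : Measure ℝ)} (h : Tendsto g l (𝓝 g')) (a b : ℝ) :
    Tendsto (fun n => ∫ x in a..b, g n x) l (𝓝 (∫ x in a..b, g' x)) := by
  rw [tendsto_iff_norm_sub_tendsto_zero] at h ⊢
  refine squeeze_zero (fun _ => norm_nonneg _) (fun n => ?_)
    (by simpa using h.const_mul √|b - a|)
  rw [← intervalIntegral.integral_sub (intervalIntegrable_lp _ _ _) (intervalIntegrable_lp _ _ _)]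
  refine le_trans (le_of_eq ?_) (norm_intervalIntegral_le_sqrt_mul a b (g n - g'))
  congr 1
  refine intervalIntegral.integral_congr_ae ((Lp.coeFn_sub (g n) g').mono fun x hx _ => ?_)
  rw [hx, Pi.sub_apply]

theorem isClosed_lineGraph [CompleteSpace N] :
    IsClosed (lineGraph N : Set (Lp N 2 (volume : Measure ℝ) × Lp N 2 (volume : Measure ℝ))) := by
  refine isClosed_of_closure_subset fun p hp => ?_
  obtain ⟨q, hq, hlim⟩ := mem_closure_iff_seq_limit.1 hp
  choose c v hv hw using hq
  rw [Prod.tendsto_iff] at hlim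
  have hv' : ∀ n, v n = -Complex.I • (q n).2 := fun n => by
    rw [hw n, smul_smul, neg_mul, Complex.I_mul_I, neg_neg, one_smul]
  have hvlim : Tendsto v atTop (𝓝 (-Complex.I • p.2)) := by
    rw [show v = fun n => -Complex.I • (q n).2 from funext hv']
    exact hlim.2.const_smul _
  obtain ⟨ns, hns, hae⟩ := (tendstoInMeasure_of_tendsto_Lp hlim.1).exists_seq_tendsto_ae
  have hall : ∀ᵐ x : ℝ, ∀ n, (q n).1 x = c n + ∫ t in (0 : ℝ)..x, v n t := ae_all_iff.2 hv
  have hI : ∀ x : ℝ, Tendsto (fun n => ∫ t in (0 : ℝ)..x, v (ns n) t) atTop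
      (𝓝 (∫ t in (0 : ℝ)..x, (-Complex.I • p.2) t)) := fun x =>
    tendsto_intervalIntegral_lp (hvlim.comp hns.tendsto_atTop) 0 x
  -- Along an almost everywhere convergent subsequence the primitives converge at every point, so
  -- one good point `x₀` already forces the constants `c n` to converge.
  obtain ⟨x₀, h1, h2⟩ := (hae.and hall).exists
  have hc : Tendsto (fun n => c (ns n)) atTop
      (𝓝 (p.1 x₀ - ∫ t in (0 : ℝ)..x₀, (-Complex.I • p.2) t)) := by
    refine (h1.sub (hI x₀)).congr fun n => ?_
    rw [h2, add_sub_cancel_right]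
  refine ⟨p.1 x₀ - ∫ t in (0 : ℝ)..x₀, (-Complex.I • p.2) t, -Complex.I • p.2, ?_, ?_⟩
  · filter_upwards [hae, hall] with x h3 h4
    refine tendsto_nhds_unique h3 ((hc.add (hI x)).congr fun n => ?_)
    rw [h4]
  · rw [smul_smul, mul_neg, Complex.I_mul_I, neg_neg, one_smul]

/-- A solution of `f' = -f` on the interval between `0` and `x`. -/
theorem primitive_eq_exp_smul [CompleteSpace N] {c : N} {u v : Lp N 2 (volume : Measure ℝ)}
    (h : IsPrimitive c u v) {x : ℝ} (hx : ∀ᵐ t : ℝ, t ∈ Set.uIcc 0 x → v t = -u t) :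
    c + ∫ t in (0 : ℝ)..x, v t = (Real.exp (-x) : ℂ) • c := by
  set f : ℝ → N := fun x => c + ∫ t in (0 : ℝ)..x, v t with hf
  have hfc : Continuous f :=
    continuous_const.add (intervalIntegral.continuous_primitive (intervalIntegrable_lp v) 0)
  -- Since `v` is only in `L₂`, `f` need not be differentiable everywhere. It agrees on the interval
  -- with the `C¹` function `k`, and `eˢ k(s)` has zero derivative there.
  set k : ℝ → N := fun s => c - ∫ t in (0 : ℝ)..s, f t with hk
  have hkf : ∀ s ∈ Set.uIcc 0 x, k s = f s := by
    intro s hs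
    have : ∫ t in (0 : ℝ)..s, v t = ∫ t in (0 : ℝ)..s, -f t := by
      refine intervalIntegral.integral_congr_ae ?_
      filter_upwards [hx, h] with t h1 h2 h3
      rw [h1 (Set.uIcc_subset_uIcc_left hs (Set.uIoc_subset_uIcc h3)), h2]
    simp only [hk, hf]
    rw [this, intervalIntegral.integral_neg, sub_eq_add_neg]
  have hkd : ∀ s, HasDerivAt k (-f s) s := fun s =>
    (intervalIntegral.integral_hasDerivAt_right (hfc.intervalIntegrable _ _)
      (hfc.stronglyMeasurableAtFilter _ _) hfc.continuousAt).const_sub c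
  have hd : ∀ s ∈ Set.uIcc 0 x,
      HasDerivWithinAt (fun s => Real.exp s • k s) 0 (Set.uIcc 0 x) s := by
    intro s hs
    have := ((Real.hasDerivAt_exp s).smul (hkd s)).hasDerivWithinAt (s := Set.uIcc 0 x)
    rwa [hkf s hs, smul_neg, neg_add_cancel] at this
  have := (convex_uIcc 0 x).norm_image_sub_le_of_norm_hasDerivWithin_le (C := 0) hd
    (by simp) Set.left_mem_uIcc Set.right_mem_uIcc
  rw [zero_mul, norm_le_zero_iff, sub_eq_zero, hkf x Set.right_mem_uIcc,
    hkf 0 Set.left_mem_uIcc] at this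
  have h0 : f 0 = c := by simp [hf]
  rw [Real.exp_zero, one_smul, h0] at this
  change f x = _
  rw [Complex.coe_smul, ← this, smul_smul, ← Real.exp_add, neg_add_cancel, Real.exp_zero, one_smul]

/-- On the negative half-line `e^{-x} ≥ 1`, so `‖c‖²` would be integrable over a set of infinite
measure. -/
theorem eq_zero_of_ae_eq_exp_neg_smul {c : N} {u : Lp N 2 (volume : Measure ℝ)}
    (h : ∀ᵐ x : ℝ, x ∈ Set.Iio 0 → u x = (Real.exp (-x) : ℂ) • c) : c = 0 := by
  by_contra hc
  have h1 : IntegrableOn (fun x => ‖u x‖ ^ 2) (Set.Iio 0) := (integrable_norm_sq_lp u).integrableOn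
  have h2 : IntegrableOn (fun _ : ℝ => ‖c‖ ^ 2) (Set.Iio 0) := by
    refine Integrable.mono' h1 aestronglyMeasurable_const ?_
    rw [ae_restrict_iff' measurableSet_Iio]
    filter_upwards [h] with x hx hx0
    rw [hx hx0, norm_smul, Complex.norm_real, Real.norm_of_nonneg (Real.exp_nonneg _),
      Real.norm_of_nonneg (by positivity)]
    have : 1 ≤ Real.exp (-x) := Real.one_le_exp (by simpa using (le_of_lt hx0))
    gcongr
    exact le_mul_of_one_le_left (norm_nonneg _) this
  rw [integrableOn_const_iff] at h2
  simp [hc] at h2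

/-- `A + i` is injective in `L₂` of the left half-line, with no boundary condition at `0`. -/
theorem IsPrimitive.constant_eq_zero [CompleteSpace N] {c : N} {u v : Lp N 2 (volume : Measure ℝ)}
    (h : IsPrimitive c u v) (hx : ∀ᵐ t : ℝ, t ∈ Set.Iio 0 → v t = -u t) : c = 0 := by
  refine eq_zero_of_ae_eq_exp_neg_smul (u := u) ?_
  filter_upwards [h] with x h1 hx0
  rw [h1]
  refine primitive_eq_exp_smul h ?_
  have hne : ∀ᵐ x : ℝ, x ≠ 0 := by simp [ae_iff]
  filter_upwards [hx, hne] with t h2 h3 h4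
  rw [Set.uIcc_of_ge (le_of_lt hx0)] at h4
  exact h2 (lt_of_le_of_ne h4.2 h3)

/-- The constant vanishes because `e^{-x} c` is not square integrable at `-∞`; the equation then
makes `u` vanish up to `0`. This is the source of causality. -/
theorem IsPrimitive.eq_zero_of_Iio [CompleteSpace N] {c : N} {u v : Lp N 2 (volume : Measure ℝ)}
    (h : IsPrimitive c u v) (hx : ∀ᵐ t : ℝ, t ∈ Set.Iio 0 → v t = -u t) :
    u ∈ L2On N (Set.Ioi 0) := by
  have hc := h.constant_eq_zero hx
  subst hc
  have hne : ∀ᵐ x : ℝ, x ≠ 0 := by simp [ae_iff]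
  change ∀ᵐ x : ℝ, x ∉ Set.Ioi (0 : ℝ) → u x = 0
  filter_upwards [h] with x h1 hx0
  rw [h1, primitive_eq_exp_smul h, smul_zero]
  filter_upwards [hx, hne] with t h2 h3 h4
  rw [Set.uIcc_of_ge (by simpa using hx0)] at h4
  exact h2 (lt_of_le_of_ne h4.2 h3)

theorem IsPrimitive.eq_zero_of_eq_neg [CompleteSpace N] {c : N} {u : Lp N 2 (volume : Measure ℝ)}
    (h : IsPrimitive c u (-u)) : u = 0 := by
  have hn : ∀ᵐ t : ℝ, (-u) t = -u t := Lp.coeFn_neg u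
  have hc := h.constant_eq_zero (hn.mono fun _ ht _ => ht)
  subst hc
  rw [Lp.eq_zero_iff_ae_eq_zero]
  filter_upwards [h] with x h1
  rw [h1, primitive_eq_exp_smul h (hn.mono fun _ ht _ => ht), smul_zero]
  rfl

end Line

/-! ### The resolvent of `i d/dx` through the Fourier transform -/

section Fourier

open SchwartzMap FourierTransform

variable {N : Type*} [NormedAddCommGroup N] [InnerProductSpace ℂ N]

theorem schwartz_mem_lineGraph [CompleteSpace N] (f : 𝓢(ℝ, N)) :
    (f.toLp 2 volume, Complex.I • (derivCLM ℂ N f).toLp 2 volume) ∈ lineGraph N := by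
  refine ⟨f 0, (derivCLM ℂ N f).toLp 2 volume, ?_, rfl⟩
  filter_upwards [f.coeFn_toLp 2 volume] with x hx
  rw [hx, intervalIntegral.integral_congr_ae (g := fun t => deriv f t),
    intervalIntegral.integral_eq_sub_of_hasDerivAt (f := f), add_sub_cancel]
  · intro t _
    exact f.differentiableAt.hasDerivAt
  · have : deriv f = derivCLM ℂ N f := by
      funext t; rw [derivCLM_apply]
    rw [this]
    exact (derivCLM ℂ N f).continuous.intervalIntegrable _ _
  · filter_upwards [(derivCLM ℂ N f).coeFn_toLp 2 volume] with t ht _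
    rw [ht, derivCLM_apply]

/-- `1 / (t + i) = (t - i)(1 + t²)⁻¹` is a product of functions known to have temperate growth.
Multiplication by it therefore preserves Schwartz functions. -/
theorem hasTemperateGrowth_resolvent :
    Function.HasTemperateGrowth (fun x : ℝ => 1 / ((symbol x : ℂ) + Complex.I)) := by
  have h1 : Function.HasTemperateGrowth symbol := by
    have := (Function.HasTemperateGrowth.const (E := ℝ) (-(2 * Real.pi))).mul
      (Function.HasTemperateGrowth.id' (E := ℝ))
    exact this
  have h2 : Function.HasTemperateGrowth (fun x : ℝ => (symbol x : ℂ)) :=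
    Function.HasTemperateGrowth.comp Function.Complex.hasTemperateGrowth_ofReal h1
  have h3 := (Function.hasTemperateGrowth_one_add_norm_sq_rpow ℝ (-1)).comp h1
  have h4 := (h2.sub (Function.HasTemperateGrowth.const Complex.I)).mul
    (Function.HasTemperateGrowth.comp Function.Complex.hasTemperateGrowth_ofReal h3)
  refine (funext fun x => ?_ : (fun x : ℝ => 1 / ((symbol x : ℂ) + Complex.I)) = _) ▸ h4
  simp only [Function.comp, Pi.mul_apply, Pi.sub_apply, Real.norm_eq_abs, sq_abs]
  rw [Real.rpow_neg_one]
  have h5 := ofReal_add_I_ne_zero (symbol x)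
  have h6 : (1 + (symbol x : ℂ) ^ 2) ≠ 0 := by
    norm_cast
    positivity
  push_cast
  field_simp
  linear_combination Complex.I_sq

/-- The resolvent `(A + i)⁻¹` of `A = i d/dx` in `L₂(ℝ, N)`. -/
def lineResolvent (N : Type*) [NormedAddCommGroup N] [InnerProductSpace ℂ N] [CompleteSpace N] :
    Lp N 2 (volume : Measure ℝ) →L[ℂ] Lp N 2 (volume : Measure ℝ) :=
  (Lp.fourierTransformₗᵢ ℝ N).symm.toContinuousLinearEquiv.toContinuousLinearMap ∘L
    freqMul N (fun t => 1 / ((t : ℂ) + Complex.I)) ∘L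
    (Lp.fourierTransformₗᵢ ℝ N).toContinuousLinearEquiv.toContinuousLinearMap

theorem fourier_lineResolvent [CompleteSpace N] (g : Lp N 2 (volume : Measure ℝ)) :
    Lp.fourierTransformₗᵢ ℝ N (lineResolvent N g) =
      freqMul N (fun t => 1 / ((t : ℂ) + Complex.I)) (Lp.fourierTransformₗᵢ ℝ N g) :=
  (Lp.fourierTransformₗᵢ ℝ N).apply_symm_apply _

/-- The graph is closed, so Schwartz functions suffice. For these the resolvent is again Schwartz
and the differential equation can be checked on the Fourier side. -/
theorem lineResolvent_mem_lineGraph [CompleteSpace N] (g : Lp N 2 (volume : Measure ℝ)) :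
    (lineResolvent N g, g - Complex.I • lineResolvent N g) ∈ lineGraph N := by
  refine (SchwartzMap.denseRange_toLpCLM (E := ℝ) (F := N) (p := 2) (μ := volume)
    ENNReal.ofNat_ne_top).induction_on (p := fun g : Lp N 2 (volume : Measure ℝ) =>
      (lineResolvent N g, g - Complex.I • lineResolvent N g) ∈ lineGraph N) g ?_ ?_
  · exact isClosed_lineGraph.preimage (by fun_prop)
  · intro f
    set h : 𝓢(ℝ, N) := smulLeftCLM N (fun x : ℝ => 1 / ((symbol x : ℂ) + Complex.I)) (𝓕 f)
      with hh
    set k : 𝓢(ℝ, N) := 𝓕⁻ h with hk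
    have hfk : 𝓕 k = h := fourier_fourierInv_eq h
    have hhx : ∀ x, h x = (1 / ((symbol x : ℂ) + Complex.I)) • (𝓕 f) x := fun x =>
      smulLeftCLM_apply_apply hasTemperateGrowth_resolvent _ _
    have e1 : lineResolvent N (f.toLp 2 volume) = k.toLp 2 := by
      apply (Lp.fourierTransformₗᵢ ℝ N).injective
      rw [fourier_lineResolvent]
      change _ = 𝓕 (k.toLp 2 volume)
      change freqMul N _ (𝓕 (f.toLp 2 volume)) = _
      rw [SchwartzMap.toLp_fourier_eq, SchwartzMap.toLp_fourier_eq, hfk]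
      refine Lp.ext ?_
      filter_upwards [coeFn_mulOp (N := N) (memLp_top_comp_symbol memLp_top_resolvent)
        ((𝓕 f).toLp 2 volume), h.coeFn_toLp 2 volume, (𝓕 f).coeFn_toLp 2 volume] with x h1 h2 h3
      rw [freqMul, h1, h2, h3, hhx]
    -- Under the Fourier transform `i d/dx` becomes `i · 2πiξ = symbol ξ`, and the equation reads `t
    -- / (t + i) = 1 - i / (t + i)`.
    have e2 : Complex.I • derivCLM ℂ N k = f - Complex.I • k := by
      apply (fourierEquiv ℂ 𝓢(ℝ, N)).injective
      ext x
      have e3 : 𝓕 (derivCLM ℂ N k) x = (2 * Real.pi * Complex.I * x) • 𝓕 k x := by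
        have := congrFun (Real.fourier_deriv (k.integrable (μ := volume)) k.differentiable
          (by
            have : deriv k = derivCLM ℂ N k := by
              funext t; rw [derivCLM_apply]
            rw [this]; exact (derivCLM ℂ N k).integrable (μ := volume))) x
        rw [SchwartzMap.fourier_coe, SchwartzMap.fourier_coe, ← this]
        congr 1
      change 𝓕 (Complex.I • derivCLM ℂ N k) x = 𝓕 (f - Complex.I • k) x
      rw [FourierTransform.fourier_smul, show 𝓕 (f - Complex.I • k) = 𝓕 f - 𝓕 (Complex.I • k) from
        map_sub (fourierEquiv ℂ 𝓢(ℝ, N)) _ _, FourierTransform.fourier_smul, hfk]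
      rw [sub_apply, smul_apply, smul_apply, e3, hfk, hhx]
      nth_rw 2 [← one_smul ℂ (𝓕 f x)]
      rw [smul_smul, smul_smul, smul_smul, ← sub_smul]
      congr 1
      have h5 := ofReal_add_I_ne_zero (symbol x)
      have h6 : (symbol x : ℂ) = -(2 * Real.pi) * x := by
        rw [symbol]; push_cast; ring
      field_simp
      rw [h6]
      linear_combination 2 * (Real.pi : ℂ) * x * Complex.I_sq
    change (lineResolvent N (f.toLp 2 volume), f.toLp 2 volume - Complex.I • lineResolvent N (f.toLp 2 volume)) ∈ lineGraph N
    rw [e1]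
    have e3 : Complex.I • (derivCLM ℂ N k).toLp 2 volume =
        f.toLp 2 volume - Complex.I • k.toLp 2 volume := by
      have := congrArg (toLpCLM ℂ N 2 (volume : Measure ℝ)) e2
      rwa [map_sub, map_smul, map_smul] at this
    rw [← e3]
    exact schwartz_mem_lineGraph k

/-- A pair in the graph is compared with the resolvent pair of `g = p.2 + i p.1`. The difference `d`
of the first components satisfies `d' = -d`, which has no nonzero solution in `L₂(ℝ, N)`. -/
theorem mem_lineGraph_iff [CompleteSpace N]
    (p : Lp N 2 (volume : Measure ℝ) × Lp N 2 (volume : Measure ℝ)) :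
    p ∈ lineGraph N ↔ ∃ g, p = (lineResolvent N g, g - Complex.I • lineResolvent N g) := by
  constructor
  · intro hp
    refine ⟨p.2 + Complex.I • p.1, ?_⟩
    set g := p.2 + Complex.I • p.1 with hg
    have hd := (lineGraph N).sub_mem hp (lineResolvent_mem_lineGraph g)
    set d := p.1 - lineResolvent N g with hdd
    have h2 : p.2 - (g - Complex.I • lineResolvent N g) = -(Complex.I • d) := by
      rw [hg, hdd, smul_sub]; abel
    obtain ⟨c, v, hv, hw⟩ := hd
    have hd0 : d = 0 := by
      have hvd : v = -d := by
        have e : p.2 - (g - Complex.I • lineResolvent N g) = Complex.I • v := hw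
        rw [h2, ← smul_neg] at e
        exact ((smul_right_injective _ Complex.I_ne_zero) e).symm
      rw [hvd] at hv
      exact IsPrimitive.eq_zero_of_eq_neg hv
    rw [hd0, smul_zero, neg_zero, sub_eq_zero] at h2
    exact Prod.ext (sub_eq_zero.1 hd0) h2
  · rintro ⟨g, rfl⟩
    exact lineResolvent_mem_lineGraph g

theorem isResolvent_lineMomentum [CompleteSpace N] :
    IsResolvent (lineMomentum N) (lineResolvent N) := fun p => by
  rw [graph_lineMomentum, mem_lineGraph_iff]

/-- The resolvent at `-i` is causal. -/
theorem lineResolvent_mem_L2On [CompleteSpace N] {g : Lp N 2 (volume : Measure ℝ)}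
    (hg : g ∈ L2On N (Set.Ioi 0)) : lineResolvent N g ∈ L2On N (Set.Ioi 0) := by
  obtain ⟨c, v, hv, hw⟩ := lineResolvent_mem_lineGraph g
  refine hv.eq_zero_of_Iio ?_
  have hw' : g - Complex.I • lineResolvent N g = Complex.I • v := hw
  have hg' : ∀ᵐ x : ℝ, x ∉ Set.Ioi (0 : ℝ) → g x = 0 := hg
  have e : Complex.I • (v + lineResolvent N g) = g := by
    rw [smul_add, ← hw', sub_add_cancel]
  filter_upwards [hg', Lp.coeFn_smul Complex.I (v + lineResolvent N g),
    Lp.coeFn_add v (lineResolvent N g)] with x h1 h2 h3 hx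
  rw [e, h1 (by simpa using (le_of_lt hx)), Pi.smul_apply, h3, Pi.add_apply, eq_comm, smul_eq_zero] at h2
  exact eq_neg_of_add_eq_zero_left (h2.resolve_left Complex.I_ne_zero)

theorem mem_halfLineGraph_iff (S : Set ℝ) (p : L2On N S × L2On N S) :
    p ∈ halfLineGraph N S ↔ ∃ v : Lp N 2 (volume : Measure ℝ),
      IsPrimitive 0 (p.1 : Lp N 2 (volume : Measure ℝ)) v ∧
        (p.2 : Lp N 2 (volume : Measure ℝ)) = Complex.I • v := by
  constructor
  · rintro ⟨v, h, hv⟩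
    exact ⟨v, h, by rw [hv]; rfl⟩
  · rintro ⟨v, h, hv⟩
    have hm : v ∈ L2On N S := by
      have : v = -Complex.I • (p.2 : Lp N 2 (volume : Measure ℝ)) := by
        rw [hv, smul_smul, neg_mul, Complex.I_mul_I, neg_neg, one_smul]
      rw [this]
      exact (L2On N S).smul_mem _ p.2.2
    exact ⟨⟨v, hm⟩, h, Subtype.ext hv⟩

theorem coe_mem_lineGraph {S : Set ℝ} {p : L2On N S × L2On N S} (h : p ∈ halfLineGraph N S) :
    ((p.1 : Lp N 2 (volume : Measure ℝ)), (p.2 : Lp N 2 (volume : Measure ℝ))) ∈ lineGraph N := by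
  obtain ⟨v, h, hv⟩ := h
  exact ⟨0, v, h, by rw [hv]; rfl⟩

/-- The condition `u(0) = 0` is automatic: a function vanishing on the left whose primitive
representation holds across `0` must start from `c = 0`. -/
theorem mem_halfLineGraph_Ioi_iff [CompleteSpace N]
    (p : L2On N (Set.Ioi 0) × L2On N (Set.Ioi 0)) :
    p ∈ halfLineGraph N (Set.Ioi 0) ↔
      ((p.1 : Lp N 2 (volume : Measure ℝ)), (p.2 : Lp N 2 (volume : Measure ℝ))) ∈ lineGraph N := by
  refine ⟨coe_mem_lineGraph, ?_⟩
  rintro ⟨c, v, h, hv⟩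
  rw [mem_halfLineGraph_iff]
  have hp1 : ∀ᵐ x : ℝ, x ∉ Set.Ioi (0 : ℝ) → (p.1 : Lp N 2 (volume : Measure ℝ)) x = 0 := p.1.2
  have hp2 : ∀ᵐ x : ℝ, x ∉ Set.Ioi (0 : ℝ) → (p.2 : Lp N 2 (volume : Measure ℝ)) x = 0 := p.2.2
  have hc : c = 0 := by
    refine h.constant_eq_zero ?_
    simp only at hv
    filter_upwards [hp1, hp2, Lp.coeFn_smul Complex.I v] with x h1 h2 h3 hx
    have hx' : x ∉ Set.Ioi (0 : ℝ) := by simpa using (le_of_lt hx)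
    rw [← hv, h2 hx', Pi.smul_apply, eq_comm, smul_eq_zero] at h3
    rw [h1 hx', neg_zero]
    exact h3.resolve_left Complex.I_ne_zero
  subst hc
  exact ⟨v, h, hv⟩

/-- `(i d/dx + i)⁻¹` in `L₂(ℝ₊, N)`. -/
def halfLineResolvent (N : Type*) [NormedAddCommGroup N] [InnerProductSpace ℂ N]
    [CompleteSpace N] : L2On N (Set.Ioi 0) →L[ℂ] L2On N (Set.Ioi 0) :=
  (lineResolvent N ∘L (L2On N (Set.Ioi 0)).subtypeL).codRestrict _
    fun g => lineResolvent_mem_L2On g.2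

theorem isResolvent_halfLineMomentum [CompleteSpace N] :
    IsResolvent (halfLineMomentum N (Set.Ioi 0)) (halfLineResolvent N) := fun p => by
  rw [graph_halfLineMomentum, mem_halfLineGraph_Ioi_iff, mem_lineGraph_iff]
  constructor
  · rintro ⟨g, hg⟩
    have h1 : (p.1 : Lp N 2 (volume : Measure ℝ)) = lineResolvent N g := congrArg Prod.fst hg
    have h2 : (p.2 : Lp N 2 (volume : Measure ℝ)) = g - Complex.I • lineResolvent N g :=
      congrArg Prod.snd hg
    have hgm : (g : Lp N 2 (volume : Measure ℝ)) = (p.2 + Complex.I • p.1 : L2On N (Set.Ioi 0)) := by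
      rw [Submodule.coe_add, Submodule.coe_smul, h1, h2, sub_add_cancel]
    subst hgm
    exact ⟨p.2 + Complex.I • p.1, Prod.ext (Subtype.ext h1) (Subtype.ext h2)⟩
  · rintro ⟨g, hg⟩
    refine ⟨g, ?_⟩
    rw [hg]
    rfl

/-- The subspace is the kernel of multiplication by the indicator of the complement of `S`. -/
theorem isClosed_L2On [CompleteSpace N] {S : Set ℝ} (hS : MeasurableSet S) :
    IsClosed (L2On N S : Set (Lp N 2 (volume : Measure ℝ))) := by
  have hm : MemLp (Sᶜ.indicator fun _ => (1 : ℂ)) ⊤ (volume : Measure ℝ) :=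
    memLp_top_indicator _ hS.compl
  have : (L2On N S : Set (Lp N 2 (volume : Measure ℝ))) =
      {u | mulOp N (Sᶜ.indicator fun _ => (1 : ℂ)) u = 0} := by
    ext u
    change (∀ᵐ x : ℝ, x ∉ S → u x = 0) ↔ _ = 0
    rw [Lp.eq_zero_iff_ae_eq_zero]
    constructor
    · intro h
      filter_upwards [h, coeFn_mulOp hm u] with x h1 h2
      rw [h2]
      by_cases hx : x ∈ S
      · rw [Set.indicator_of_notMem (by simpa using hx), zero_smul]; rfl
      · rw [h1 hx, smul_zero]; rfl
    · intro h
      filter_upwards [h, coeFn_mulOp hm u] with x h1 h2 hx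
      rw [h2, Set.indicator_of_mem (by simpa using hx), one_smul] at h1
      exact h1
  rw [this]
  exact isClosed_eq (mulOp N _).continuous continuous_const

instance completeSpace_L2On_Ioi [CompleteSpace N] : CompleteSpace (L2On N (Set.Ioi (0 : ℝ))) :=
  (isClosed_L2On measurableSet_Ioi).completeSpace_coe

end Fourier

/-! ### The operators `B` and `A` as models -/

section Models

variable {N : Type*} [NormedAddCommGroup N] [InnerProductSpace ℂ N]
  {H : Type*} [NormedAddCommGroup H] [InnerProductSpace ℂ H]

theorem memLp_top_cayley : MemLp cayley ⊤ volume := by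
  simpa using memLp_top_cayley_pow 1

theorem memLp_top_star_cayley : MemLp (fun t => starRingEnd ℂ (cayley t)) ⊤ volume :=
  memLp_top_cayley.star

theorem freqMul_cayley (u : Lp N 2 (volume : Measure ℝ)) :
    freqMul N cayley u =
      u - (2 * Complex.I) • freqMul N (fun t => 1 / ((t : ℂ) + Complex.I)) u := by
  have hmr := memLp_top_comp_symbol memLp_top_resolvent
  have := mulOp_add (N := N) (memLp_top_const (μ := (volume : Measure ℝ)) (1 : ℂ))
    (hmr.const_mul (-(2 * Complex.I)))
  rw [mulOp_const_mul hmr, mulOp_one] at this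
  have e2 : (fun x => (1 : ℂ) + -(2 * Complex.I) * (1 / ((symbol x : ℂ) + Complex.I)))
      = fun x => cayley (symbol x) := by
    funext x
    rw [cayley_eq]
    ring
  rw [e2] at this
  rw [freqMul, this]
  simp [freqMul, sub_eq_add_neg]

theorem freqMul_star_cayley (u : Lp N 2 (volume : Measure ℝ)) :
    freqMul N (fun t => starRingEnd ℂ (cayley t)) (freqMul N cayley u) = u := by
  rw [freqMul_mul memLp_top_star_cayley memLp_top_cayley]
  have : (fun t => starRingEnd ℂ (cayley t) * cayley t) = fun _ => 1 :=
    funext star_cayley_mul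
  rw [this, freqMul, mulOp_one]
  rfl

theorem freqMul_cayley_star (u : Lp N 2 (volume : Measure ℝ)) :
    freqMul N cayley (freqMul N (fun t => starRingEnd ℂ (cayley t)) u) = u := by
  rw [freqMul_comm memLp_top_cayley memLp_top_star_cayley, freqMul_star_cayley]

theorem inner_freqMul_cayley_left (u v : Lp N 2 (volume : Measure ℝ)) :
    inner ℂ (freqMul N cayley u) v =
      inner ℂ u (freqMul N (fun t => starRingEnd ℂ (cayley t)) v) :=
  inner_mulOp_left (memLp_top_comp_symbol memLp_top_cayley) u v

theorem mem_graph_conj {K : Type*} [NormedAddCommGroup K] [InnerProductSpace ℂ K]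
    (Ξ : H ≃ₗᵢ[ℂ] K) (T : K →ₗ.[ℂ] K) (p : H × H) :
    p ∈ (conj Ξ T).graph ↔ (Ξ p.1, Ξ p.2) ∈ T.graph := by
  obtain ⟨x, y⟩ := p
  constructor
  · intro h
    rw [LinearPMap.mem_graph_iff] at h ⊢
    obtain ⟨z, rfl, rfl⟩ := h
    refine ⟨⟨Ξ z, z.2⟩, rfl, ?_⟩
    change T.toFun _ = Ξ (Ξ.symm (T.toFun _))
    rw [Ξ.apply_symm_apply]
    rfl
  · intro h
    rw [LinearPMap.mem_graph_iff] at h ⊢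
    obtain ⟨z, hz1, hz2⟩ := h
    have hx : x ∈ (conj Ξ T).domain := by
      change Ξ x ∈ T.domain
      rw [← show (z : K) = Ξ x from hz1]
      exact z.2
    refine ⟨⟨x, hx⟩, rfl, ?_⟩
    change Ξ.symm (T.toFun ⟨Ξ x, hx⟩) = y
    rw [show (⟨Ξ x, hx⟩ : T.domain) = z from Subtype.ext hz1.symm]
    exact (congrArg Ξ.symm hz2).trans (Ξ.symm_apply_apply y)

/-- `Ξ⁻¹ R Ξ`. -/
def conjCLM {K : Type*} [NormedAddCommGroup K] [InnerProductSpace ℂ K]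
    (Ξ : H ≃ₗᵢ[ℂ] K) (R : K →L[ℂ] K) : H →L[ℂ] H :=
  Ξ.symm.toContinuousLinearEquiv.toContinuousLinearMap ∘L R ∘L
    Ξ.toContinuousLinearEquiv.toContinuousLinearMap

theorem map_conjCLM {K : Type*} [NormedAddCommGroup K] [InnerProductSpace ℂ K]
    (Ξ : H ≃ₗᵢ[ℂ] K) (R : K →L[ℂ] K) (g : H) : Ξ (conjCLM Ξ R g) = R (Ξ g) :=
  Ξ.apply_symm_apply _

theorem IsResolvent.conj {K : Type*} [NormedAddCommGroup K] [InnerProductSpace ℂ K]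
    (Ξ : H ≃ₗᵢ[ℂ] K) {T : K →ₗ.[ℂ] K} {R : K →L[ℂ] K} (h : IsResolvent T R) :
    IsResolvent (conj Ξ T) (conjCLM Ξ R) := fun p => by
  rw [mem_graph_conj, h]
  constructor
  · rintro ⟨g, hg⟩
    refine ⟨Ξ.symm g, Prod.ext (Ξ.injective ?_) (Ξ.injective ?_)⟩
    · change Ξ p.1 = Ξ (conjCLM Ξ R (Ξ.symm g))
      rw [map_conjCLM, Ξ.apply_symm_apply]
      exact congrArg Prod.fst hg
    · change Ξ p.2 = Ξ (Ξ.symm g - Complex.I • conjCLM Ξ R (Ξ.symm g))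
      rw [map_sub, map_smul, map_conjCLM, Ξ.apply_symm_apply]
      exact congrArg Prod.snd hg
  · rintro ⟨g, rfl⟩
    refine ⟨Ξ g, ?_⟩
    simp only [map_sub, map_smul, map_conjCLM]

theorem isModel_line [CompleteSpace N] (Ξ : H ≃ₗᵢ[ℂ] Lp N 2 (volume : Measure ℝ)) :
    IsModel (conj Ξ (lineMomentum N)) (conjCLM Ξ (lineResolvent N))
      ((Lp.fourierTransformₗᵢ ℝ N).toLinearIsometry.comp Ξ.toLinearIsometry) where
  resolvent := isResolvent_lineMomentum.conj Ξ
  map_resolvent g := by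
    change Lp.fourierTransformₗᵢ ℝ N (Ξ (conjCLM Ξ (lineResolvent N) g)) =
      freqMul N _ (Lp.fourierTransformₗᵢ ℝ N (Ξ g))
    rw [map_conjCLM, fourier_lineResolvent]

/-- By causality the half-line resolvent is a restriction of the one on the line, so the same
Fourier transform turns it into the same multiplication; only surjectivity of the isometry is not
claimed. -/
theorem isModel_halfLine [CompleteSpace N] (Ξ : H ≃ₗᵢ[ℂ] L2On N (Set.Ioi 0)) :
    IsModel (conj Ξ (halfLineMomentum N (Set.Ioi 0))) (conjCLM Ξ (halfLineResolvent N))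
      ((Lp.fourierTransformₗᵢ ℝ N).toLinearIsometry.comp
        ((L2On N (Set.Ioi 0)).subtypeₗᵢ.comp Ξ.toLinearIsometry)) where
  resolvent := isResolvent_halfLineMomentum.conj Ξ
  map_resolvent g := by
    change Lp.fourierTransformₗᵢ ℝ N (Ξ (conjCLM Ξ (halfLineResolvent N) g)) =
      freqMul N _ (Lp.fourierTransformₗᵢ ℝ N (Ξ g))
    rw [map_conjCLM, ← fourier_lineResolvent]
    rfl

variable {B : H →ₗ.[ℂ] H} {R : H →L[ℂ] H} {ι : H →ₗᵢ[ℂ] Lp N 2 (volume : Measure ℝ)}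
  [CompleteSpace N]

namespace IsModel

theorem map_cayley (h : IsModel B R ι) (g : H) :
    ι (g - (2 * Complex.I) • R g) = freqMul N cayley (ι g) := by
  rw [freqMul_cayley, map_sub, map_smul, h.map_resolvent]

theorem isFormalAdjoint (h : IsModel B R ι) : B.IsFormalAdjoint B := by
  refine h.resolvent.isFormalAdjoint fun g k => ?_
  rw [← ι.inner_map_map, h.map_cayley, h.map_cayley, inner_freqMul_cayley_left,
    freqMul_star_cayley, ι.inner_map_map]

/-- Surjectivity of `ι` lets the conjugate Cayley function act on the space and invert the Cayley
transform; hence `B - i` is onto as well as `B + i`. -/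
theorem isSelfAdjoint [CompleteSpace H] (h : IsModel B R ι) (hs : Function.Surjective ι) :
    IsSelfAdjoint B := by
  refine isSelfAdjoint_of_surjective h.isFormalAdjoint (fun g => ?_) fun g => ?_
  · obtain ⟨hm, he⟩ := h.resolvent.mem_domain g
    exact ⟨⟨R g, hm⟩, by rw [he, sub_add_cancel]⟩
  · obtain ⟨k, hk⟩ := hs (freqMul N (fun t => starRingEnd ℂ (cayley t)) (ι g))
    obtain ⟨hm, he⟩ := h.resolvent.mem_domain k
    refine ⟨⟨R k, hm⟩, ι.injective ?_⟩
    rw [he, sub_sub, ← add_smul, ← two_mul, h.map_cayley, hk, freqMul_cayley_star]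

end IsModel

/-- With `ι` onto, nothing is lost in compressing, and multiplication by an indicator is idempotent.
-/
theorem compressFamily_isOrthogonal [CompleteSpace H] (hs : Function.Surjective ι) :
    (compressFamily ι).IsOrthogonal := by
  intro t
  have hm := memLp_top_indicator (Set.Iic t) measurableSet_Iic
  have key : ∀ f, ι (compress ι ((Set.Iic t).indicator fun _ => 1) f) =
      freqMul N ((Set.Iic t).indicator fun _ => 1) (ι f) := by
    intro f
    obtain ⟨g, hg⟩ := hs (freqMul N ((Set.Iic t).indicator fun _ => 1) (ι f))
    rw [compress_eq_of_mem ι hg, hg]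
  ext1 f
  apply ι.injective
  change ι (compress ι ((Set.Iic t).indicator fun _ => 1)
    (compress ι ((Set.Iic t).indicator fun _ => 1) f)) =
      ι (compress ι ((Set.Iic t).indicator fun _ => 1) f)
  rw [key, key, freqMul_mul hm hm]
  congr 2
  funext x
  by_cases hx : x ∈ Set.Iic t <;> simp [hx]

end Models

/-! ### The extension from the half-line to the whole line -/

section Extension

variable {N : Type*} [NormedAddCommGroup N] [InnerProductSpace ℂ N] [CompleteSpace N]
  {H' H : Type*} [NormedAddCommGroup H'] [InnerProductSpace ℂ H']
  [NormedAddCommGroup H] [InnerProductSpace ℂ H]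

theorem glue_apply (Ξm : H' ≃ₗᵢ[ℂ] L2On N (Set.Iio 0)) (Ξp : H ≃ₗᵢ[ℂ] L2On N (Set.Ioi 0))
    (f' : H') (f : H) : glue Ξm Ξp (WithLp.toLp 2 (f', f)) =
      (Ξm f' : Lp N 2 (volume : Measure ℝ)) + (Ξp f : Lp N 2 (volume : Measure ℝ)) := rfl

/-- `A` extends the orthogonal sum of the operators on the two half-lines. -/
theorem extensionA_apply (Ξm : H' ≃ₗᵢ[ℂ] L2On N (Set.Iio 0))
    (Ξp : H ≃ₗᵢ[ℂ] L2On N (Set.Ioi 0))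
    (x' : (conj Ξm (halfLineMomentum N (Set.Iio 0))).domain)
    (x : (conj Ξp (halfLineMomentum N (Set.Ioi 0))).domain) :
    ∃ h : WithLp.toLp 2 ((x' : H'), (x : H)) ∈ (extensionA Ξm Ξp).domain,
      extensionA Ξm Ξp ⟨_, h⟩ = WithLp.toLp 2 (conj Ξm (halfLineMomentum N (Set.Iio 0)) x',
        conj Ξp (halfLineMomentum N (Set.Ioi 0)) x) := by
  have h1 := (mem_graph_conj _ _ _).1 (LinearPMap.mem_graph _ x')
  have h2 := (mem_graph_conj _ _ _).1 (LinearPMap.mem_graph _ x)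
  rw [graph_halfLineMomentum] at h1 h2
  have h3 := (lineGraph N).add_mem (coe_mem_lineGraph h1) (coe_mem_lineGraph h2)
  rw [← graph_lineMomentum] at h3
  have h4 : (WithLp.toLp 2 ((x' : H'), (x : H)),
      WithLp.toLp 2 (conj Ξm (halfLineMomentum N (Set.Iio 0)) x',
        conj Ξp (halfLineMomentum N (Set.Ioi 0)) x)) ∈ (extensionA Ξm Ξp).graph := by
    rw [extensionA, mem_graph_conj]
    exact h3
  rw [LinearPMap.mem_graph_iff] at h4
  obtain ⟨y, hy1, hy2⟩ := h4
  have hm : WithLp.toLp 2 ((x' : H'), (x : H)) ∈ (extensionA Ξm Ξp).domain := by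
    have := y.2
    rwa [hy1] at this
  have hy : y = ⟨_, hm⟩ := Subtype.ext hy1
  exact ⟨hm, by rw [← hy]; exact hy2⟩

variable [CompleteSpace H'] [CompleteSpace H]

theorem surjective_fourier_comp_glue (Ξm : H' ≃ₗᵢ[ℂ] L2On N (Set.Iio 0))
    (Ξp : H ≃ₗᵢ[ℂ] L2On N (Set.Ioi 0)) : Function.Surjective
      ((Lp.fourierTransformₗᵢ ℝ N).toLinearIsometry.comp (glue Ξm Ξp).toLinearIsometry) :=
  (Lp.fourierTransformₗᵢ ℝ N).surjective.comp (glue Ξm Ξp).surjective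

/-- On `H` the functions of `A` are the functions of `B`. -/
theorem funCalc_extensionA (Ξm : H' ≃ₗᵢ[ℂ] L2On N (Set.Iio 0))
    (Ξp : H ≃ₗᵢ[ℂ] L2On N (Set.Ioi 0)) {ψ : ℂ → ℂ} (hψ : IsHInfty ψ) (f : H) :
    funCalc (extensionA Ξm Ξp) ψ (WithLp.toLp 2 ((0 : H'), f)) =
      WithLp.toLp 2 ((0 : H'), funCalc (conj Ξp (halfLineMomentum N (Set.Ioi 0))) ψ f) := by
  have hg : ∀ k : H, glue Ξm Ξp (WithLp.toLp 2 ((0 : H'), k)) =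
      (Ξp k : Lp N 2 (volume : Measure ℝ)) := fun k => by
    rw [glue_apply, map_zero, Submodule.coe_zero, zero_add]
  have h1 := (isModel_line (glue Ξm Ξp)).map_funCalc hψ (WithLp.toLp 2 ((0 : H'), f))
  have h2 := (isModel_halfLine Ξp).map_funCalc hψ f
  -- After `Ξ` and the Fourier transform both sides are the same multiple of the transform of `Ξ₊
  -- f`; the left-hand component is zero throughout.
  apply ((Lp.fourierTransformₗᵢ ℝ N).toLinearIsometry.comp (glue Ξm Ξp).toLinearIsometry).injective
  refine h1.trans (Eq.trans ?_ (h2.symm.trans ?_))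
  · change freqMul N _ (Lp.fourierTransformₗᵢ ℝ N (glue Ξm Ξp _)) = freqMul N _
      (Lp.fourierTransformₗᵢ ℝ N (Ξp f))
    rw [hg]
  · change Lp.fourierTransformₗᵢ ℝ N (Ξp _) = Lp.fourierTransformₗᵢ ℝ N (glue Ξm Ξp _)
    rw [hg]

end Extension

/-! ### Isometries without unitary part -/

section Wold

variable {K : Type*} [NormedAddCommGroup K] [InnerProductSpace ℂ K] [CompleteSpace K]
  {H : Type*} [NormedAddCommGroup H] [InnerProductSpace ℂ H] [CompleteSpace H]
  {H₀ : Type*} [NormedAddCommGroup H₀] [InnerProductSpace ℂ H₀] [CompleteSpace H₀]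

/-- `V` is the unilateral shift whose wandering subspace is the range of `j`. -/
structure IsShift (V : H →ₗᵢ[ℂ] H) (j : K →ₗᵢ[ℂ] H) : Prop where
  orthogonal : ∀ (c : K) (g : H), inner ℂ (j c) (V g) = 0
  total : ∀ u : H, (∀ (n : ℕ) (c : K), inner ℂ ((V ^ n) (j c)) u = 0) → u = 0

namespace IsShift

variable {V : H →ₗᵢ[ℂ] H} {j : K →ₗᵢ[ℂ] H} {V₀ : H₀ →ₗᵢ[ℂ] H₀} {j₀ : K →ₗᵢ[ℂ] H₀}

/-- The isometry cancels the common powers of `V`, leaving a wandering vector against a vector in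
the range of `V`. Totality supplies density of the sum. -/
theorem isHilbertSum (h : IsShift V j) :
    IsHilbertSum ℂ (fun _ : ℕ => K) (fun n => (V ^ n).comp j) := by
  have key : ∀ n m : ℕ, n < m → ∀ c d : K, inner ℂ ((V ^ n) (j c)) ((V ^ m) (j d)) = 0 := by
    intro n m hnm c d
    obtain ⟨k, rfl⟩ := Nat.exists_eq_add_of_lt hnm
    rw [add_assoc, pow_add, LinearIsometry.coe_mul, Function.comp_apply,
      LinearIsometry.inner_map_map, pow_succ', LinearIsometry.coe_mul, Function.comp_apply]
    exact h.orthogonal _ _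
  refine IsHilbertSum.mk (fun n m hnm c d => ?_) ?_
  · rcases lt_or_gt_of_ne hnm with hlt | hlt
    · exact key n m hlt c d
    · rw [← inner_conj_symm]
      exact (congrArg _ (key m n hlt d c)).trans (map_zero _)
  · rw [top_le_iff, Submodule.topologicalClosure_eq_top_iff, Submodule.eq_bot_iff]
    intro u hu
    refine h.total u fun n c => ?_
    refine (Submodule.mem_orthogonal _ _).1 hu _ ?_
    exact Submodule.mem_iSup_of_mem n ⟨c, rfl⟩

/-- Both spaces are identified with `ℓ²(ℕ, K)` so that `Vⁿ j c` and `V₀ⁿ j₀ c` correspond.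
Intertwining is clear on these vectors and extends by density. -/
theorem exists_intertwining (h : IsShift V j) (h₀ : IsShift V₀ j₀) :
    ∃ Ξ : H ≃ₗᵢ[ℂ] H₀, ∀ g, Ξ (V g) = V₀ (Ξ g) := by
  classical
  let e := h.isHilbertSum.linearIsometryEquiv
  let e₀ := h₀.isHilbertSum.linearIsometryEquiv
  refine ⟨e.trans e₀.symm, ?_⟩
  have hn : ∀ (n : ℕ) (c : K), (e.trans e₀.symm) ((V ^ n) (j c)) = (V₀ ^ n) (j₀ c) := by
    intro n c
    have h1 : e.symm (lp.single 2 n c) = (V ^ n) (j c) :=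
      h.isHilbertSum.linearIsometryEquiv_symm_apply_single c
    have h2 : e₀.symm (lp.single 2 n c) = (V₀ ^ n) (j₀ c) :=
      h₀.isHilbertSum.linearIsometryEquiv_symm_apply_single c
    rw [← h1, LinearIsometryEquiv.trans_apply, e.apply_symm_apply, h2]
  intro g
  set Ξ := e.trans e₀.symm
  rw [← sub_eq_zero]
  set M : Submodule ℂ H := ⨆ n : ℕ, LinearMap.range ((V ^ n).comp j).toLinearMap
  have hM : Dense (M : Set H) := by
    rw [Submodule.dense_iff_topologicalClosure_eq_top, Submodule.topologicalClosure_eq_top_iff,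
      Submodule.eq_bot_iff]
    intro u hu
    refine h.total u fun n c => ?_
    refine (Submodule.mem_orthogonal _ _).1 hu _ ?_
    exact Submodule.mem_iSup_of_mem n ⟨c, rfl⟩
  have hc : IsClosed {g | Ξ (V g) - V₀ (Ξ g) = 0} :=
    isClosed_eq (by fun_prop) continuous_const
  have hMs : ∀ g ∈ M, Ξ (V g) - V₀ (Ξ g) = 0 := by
    intro g hg
    refine Submodule.iSup_induction _ (motive := fun g => Ξ (V g) - V₀ (Ξ g) = 0) hg ?_
      (by simp) ?_
    · rintro n _ ⟨c, rfl⟩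
      change Ξ (V ((V ^ n) (j c))) - V₀ (Ξ ((V ^ n) (j c))) = 0
      rw [hn, show V ((V ^ n) (j c)) = (V ^ (n + 1)) (j c) by
        rw [pow_succ', LinearIsometry.coe_mul, Function.comp_apply], hn,
        pow_succ', LinearIsometry.coe_mul, Function.comp_apply, sub_self]
    · intro x y hx hy
      rw [map_add, map_add, map_add, map_add, add_sub_add_comm, hx, hy, add_zero]
  exact hc.closure_subset_iff.2 (fun g hg => hMs g hg) (hM g)

end IsShift

end Wold

/-! ### Cayley transforms of symmetric operators -/

section Cayley

variable {H : Type*} [NormedAddCommGroup H] [InnerProductSpace ℂ H]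

/-- The cross term is the real part of `i ⟨B x, x⟩`, and symmetry makes `⟨B x, x⟩` real. -/
theorem norm_sq_add_I_smul {B : H →ₗ.[ℂ] H} (hs : B.IsFormalAdjoint B) (x : B.domain) :
    ‖B x + Complex.I • (x : H)‖ ^ 2 = ‖B x‖ ^ 2 + ‖(x : H)‖ ^ 2 := by
  have h := hs x x
  have h2 : (inner ℂ (B x) (x : H)).im = 0 := by
    have := congrArg Complex.im h
    rw [← inner_conj_symm (x : H) (B x), Complex.conj_im] at this
    linarith
  rw [@norm_add_sq ℂ, inner_smul_right, norm_smul, Complex.norm_I, one_mul]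
  simp [h2]

theorem norm_sq_sub_I_smul {B : H →ₗ.[ℂ] H} (hs : B.IsFormalAdjoint B) (x : B.domain) :
    ‖B x - Complex.I • (x : H)‖ ^ 2 = ‖B x‖ ^ 2 + ‖(x : H)‖ ^ 2 := by
  have h := hs x x
  have h2 : (inner ℂ (B x) (x : H)).im = 0 := by
    have := congrArg Complex.im h
    rw [← inner_conj_symm (x : H) (B x), Complex.conj_im] at this
    linarith
  rw [@norm_sub_sq ℂ, inner_smul_right, norm_smul, Complex.norm_I, one_mul]
  simp [h2]

/-- The Cayley transform of a symmetric operator `B` for which `B + i` is onto. -/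
theorem IsResolvent.exists_isometry {B : H →ₗ.[ℂ] H} {R : H →L[ℂ] H} (hR : IsResolvent B R)
    (hs : B.IsFormalAdjoint B) : ∃ V : H →ₗᵢ[ℂ] H, ∀ g, V g = g - (2 * Complex.I) • R g := by
  refine ⟨⟨((ContinuousLinearMap.id ℂ H - (2 * Complex.I) • R : H →L[ℂ] H) : H →ₗ[ℂ] H),
    fun g => ?_⟩, fun g => rfl⟩
  change ‖g - (2 * Complex.I) • R g‖ = ‖g‖
  obtain ⟨hm, he⟩ := hR.mem_domain g
  have h1 := norm_sq_add_I_smul hs ⟨R g, hm⟩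
  have h2 := norm_sq_sub_I_smul hs ⟨R g, hm⟩
  rw [← h1, he, sub_add_cancel, sub_sub, ← add_smul, ← two_mul] at h2
  exact (pow_left_inj₀ (norm_nonneg _) (norm_nonneg _) two_ne_zero).1 h2

/-- Intertwining the Cayley transforms, `Ξ` carries one operator into the other. -/
theorem IsResolvent.eq_conj {K : Type*} [NormedAddCommGroup K] [InnerProductSpace ℂ K]
    {B : H →ₗ.[ℂ] H} {R : H →L[ℂ] H} {T : K →ₗ.[ℂ] K} {S : K →L[ℂ] K}
    (hR : IsResolvent B R) (hS : IsResolvent T S) (Ξ : H ≃ₗᵢ[ℂ] K)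
    (h : ∀ g, Ξ (g - (2 * Complex.I) • R g) = Ξ g - (2 * Complex.I) • S (Ξ g)) :
    B = Plesner.conj Ξ T := by
  have hRS : conjCLM Ξ S = R := by
    ext1 g
    apply Ξ.injective
    rw [map_conjCLM]
    have := h g
    rw [map_sub, map_smul, sub_right_inj] at this
    exact (smul_right_injective K (mul_ne_zero two_ne_zero Complex.I_ne_zero) this).symm
  refine LinearPMap.eq_of_eq_graph (Submodule.ext fun p => ?_)
  rw [hR p, (hS.conj Ξ) p, hRS]

end Cayley

/-! ### The Cayley transform of a simple maximal symmetric operator -/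

namespace IsSimpleMaximalSymmetric

variable {H : Type*} [NormedAddCommGroup H] [InnerProductSpace ℂ H] [CompleteSpace H]
  {B : H →ₗ.[ℂ] H}

/-- The norm identity bounds `B + i` from below, closedness of `B` then makes its range closed, and
the vanishing defect makes the range dense. -/
theorem exists_resolvent (hB : IsSimpleMaximalSymmetric B) : ∃ R, IsResolvent B R := by
  let T : B.domain →ₗ[ℂ] H := B.toFun + Complex.I • B.domain.subtype
  have hT : ∀ x, T x = B x + Complex.I • (x : H) := fun x => rfl
  have hb : ∀ x : B.domain, ‖(x : H)‖ ≤ ‖T x‖ := fun x => by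
    have := norm_sq_add_I_smul hB.symm x
    refine (pow_le_pow_iff_left₀ (norm_nonneg _) (norm_nonneg _) two_ne_zero).1 ?_
    rw [hT, this]
    nlinarith [sq_nonneg ‖B x‖]
  have hb' : ∀ x : B.domain, ‖B x‖ ≤ ‖T x‖ := fun x => by
    have := norm_sq_add_I_smul hB.symm x
    refine (pow_le_pow_iff_left₀ (norm_nonneg _) (norm_nonneg _) two_ne_zero).1 ?_
    rw [hT, this]
    nlinarith [sq_nonneg ‖(x : H)‖]
  have hinj : Function.Injective T := by
    rw [injective_iff_map_eq_zero]
    intro x hx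
    have := hb x
    rw [hx, norm_zero, norm_le_zero_iff] at this
    exact Subtype.ext this
  have hclosed : IsClosed (LinearMap.range T : Set H) := by
    refine isClosed_of_closure_subset fun y hy => ?_
    obtain ⟨z, hz, hlim⟩ := mem_closure_iff_seq_limit.1 hy
    choose x hx using hz
    have hcz := hlim.cauchySeq
    have hc1 : CauchySeq fun n => (x n : H) := by
      rw [Metric.cauchySeq_iff'] at hcz ⊢
      intro ε hε
      obtain ⟨n₀, hn₀⟩ := hcz ε hε
      refine ⟨n₀, fun n hn => lt_of_le_of_lt ?_ (hn₀ n hn)⟩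
      rw [dist_eq_norm, dist_eq_norm, ← hx, ← hx, ← map_sub]
      exact hb (x n - x n₀)
    obtain ⟨a, ha⟩ := cauchySeq_tendsto_of_complete hc1
    have hBl : Tendsto (fun n => B (x n)) atTop (𝓝 (y - Complex.I • a)) := by
      refine (hlim.sub (ha.const_smul Complex.I)).congr fun n => ?_
      rw [← hx, hT, add_sub_cancel_right]
    have hg : (a, y - Complex.I • a) ∈ B.graph :=
      hB.closed.mem_of_tendsto (ha.prodMk_nhds hBl)
        (Eventually.of_forall fun n => B.mem_graph (x n))
    rw [LinearPMap.mem_graph_iff] at hg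
    obtain ⟨w, hw1, hw2⟩ := hg
    simp only at hw1 hw2
    exact ⟨w, by rw [hT, hw2, hw1, sub_add_cancel]⟩
  have hsurj : Function.Surjective T := by
    rw [← LinearMap.range_eq_top]
    have hd : (LinearMap.range T).topologicalClosure = ⊤ := by
      rw [Submodule.topologicalClosure_eq_top_iff, Submodule.eq_bot_iff]
      intro y hy
      -- Orthogonality to the range of `B + i` says exactly that `B* y = i y`.
      have h1 : ∀ x : B.domain, inner ℂ (Complex.I • y) (x : H) = inner ℂ y (B x) := by
        intro x
        have := (Submodule.mem_orthogonal' _ _).1 hy (T x) ⟨x, rfl⟩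
        rw [hT, inner_add_right, inner_smul_right] at this
        rw [inner_smul_left, Complex.conj_I]
        linear_combination -this
      have hm := LinearPMap.mem_adjoint_domain_of_exists y ⟨Complex.I • y, h1⟩
      exact hB.defect_upper ⟨y, hm⟩ (LinearPMap.adjoint_apply_eq hB.dense ⟨y, hm⟩ h1)
    rw [← hclosed.submodule_topologicalClosure_eq, hd]
  let e : B.domain ≃ₗ[ℂ] H := LinearEquiv.ofBijective T ⟨hinj, hsurj⟩
  refine ⟨(B.domain.subtype ∘ₗ (e.symm : H →ₗ[ℂ] B.domain)).mkContinuous 1 fun g => ?_,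
    fun p => ⟨fun hp => ?_, ?_⟩⟩
  · rw [one_mul]
    have := hb (e.symm g)
    rwa [show T (e.symm g) = g from e.apply_symm_apply g] at this
  · rw [LinearPMap.mem_graph_iff] at hp
    obtain ⟨x, hx1, hx2⟩ := hp
    refine ⟨T x, Prod.ext ?_ ?_⟩
    · change p.1 = ((e.symm (e x) : B.domain) : H)
      rw [e.symm_apply_apply, hx1]
    · change p.2 = T x - Complex.I • ((e.symm (e x) : B.domain) : H)
      rw [e.symm_apply_apply, hT, add_sub_cancel_right, hx2]
  · rintro ⟨g, rfl⟩
    change (((e.symm g : B.domain) : H), g - Complex.I • ((e.symm g : B.domain) : H)) ∈ B.graph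
    have h1 : B (e.symm g) + Complex.I • ((e.symm g : B.domain) : H) = g := e.apply_symm_apply g
    have h2 : g - Complex.I • ((e.symm g : B.domain) : H) = B (e.symm g) := by
      rw [eq_comm, eq_sub_iff_add_eq, h1]
    rw [h2]
    exact B.mem_graph _

/-- Let `M` be the space of vectors orthogonal to all `Vⁿ (ran V)ᗮ`. Then `V` maps `M` onto itself
and `R` preserves `M`. The part of `B` in `M` is therefore symmetric with `B + i` and `B - i` both
onto, hence self-adjoint, and simplicity leaves only `M = 0`. -/
theorem isShift (hB : IsSimpleMaximalSymmetric B) {R : H →L[ℂ] H} (hR : IsResolvent B R)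
    {V : H →ₗᵢ[ℂ] H} (hV : ∀ g, V g = g - (2 * Complex.I) • R g) :
    IsShift V (LinearMap.range V.toLinearMap)ᗮ.subtypeₗᵢ := by
  have hort : ∀ (c : (LinearMap.range V.toLinearMap)ᗮ) (g : H), inner ℂ (c : H) (V g) = 0 :=
    fun c g => (Submodule.mem_orthogonal' _ _).1 c.2 _ ⟨g, rfl⟩
  refine ⟨hort, fun u hu => ?_⟩
  set N := (LinearMap.range V.toLinearMap)ᗮ with hN
  let M : Submodule ℂ H :=
    ⨅ (n : ℕ) (c : N), LinearMap.ker (innerSL ℂ ((V ^ n) (c : H))).toLinearMap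
  have hM : ∀ u, u ∈ M ↔ ∀ (n : ℕ) (c : N), inner ℂ ((V ^ n) (c : H)) u = 0 := by
    intro u
    simp [M, Submodule.mem_iInf]
  have hMc : IsClosed (M : Set H) := by
    have : (M : Set H) = ⋂ (n : ℕ) (c : N), {u | inner ℂ ((V ^ n) (c : H)) u = 0} := by
      ext u
      simp only [SetLike.mem_coe, hM, Set.mem_iInter, Set.mem_ofPred_eq]
    rw [this]
    exact isClosed_iInter fun n => isClosed_iInter fun c =>
      isClosed_eq (by fun_prop) continuous_const
  have : CompleteSpace M := hMc.completeSpace_coe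
  have hVs : ∀ (n : ℕ) (x : H), (V ^ (n + 1)) x = V ((V ^ n) x) := fun n x => by
    rw [pow_succ', LinearIsometry.coe_mul, Function.comp_apply]
  have hVM : ∀ u ∈ M, V u ∈ M := by
    intro u hu
    rw [hM] at hu ⊢
    intro n c
    cases n with
    | zero => simpa using hort c u
    | succ n => rw [hVs, V.inner_map_map, hu]
  -- The condition at `n = 0` places `u` in the closed range of `V`; the conditions at `n + 1`
  -- return the preimage to `M`.
  have hVM' : ∀ u ∈ M, ∃ k ∈ M, V k = u := by
    intro u hu
    have hcl : IsClosed (LinearMap.range V.toLinearMap : Set H) := by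
      have := V.isometry.isClosedEmbedding.isClosed_range
      exact this
    have hr : u ∈ LinearMap.range V.toLinearMap := by
      rw [← hcl.submodule_topologicalClosure_eq, ← Submodule.orthogonal_orthogonal_eq_closure,
        Submodule.mem_orthogonal]
      intro c hc
      simpa using (hM u).1 hu 0 ⟨c, hc⟩
    obtain ⟨k, rfl⟩ := hr
    refine ⟨k, (hM k).2 fun n c => ?_, rfl⟩
    have := (hM _).1 hu (n + 1) c
    rw [hVs] at this
    rwa [← V.inner_map_map]
  have hRM : ∀ u ∈ M, R u ∈ M := by
    intro u hu
    have h1 : (2 * Complex.I) • R u ∈ M := by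
      have h2 := M.sub_mem hu (hVM u hu)
      rwa [hV, sub_sub_cancel] at h2
    exact (M.smul_mem_iff (mul_ne_zero two_ne_zero Complex.I_ne_zero)).1 h1
  have hres : ∀ k (hk : k ∈ M), ∃ f : (partIn B M).domain, ((f : M) : H) = R k ∧
      ((partIn B M f : M) : H) = k - Complex.I • R k := by
    intro k hk
    have : ((⟨R k, hRM k hk⟩ : M), (⟨k - Complex.I • R k,
        M.sub_mem hk (M.smul_mem _ (hRM k hk))⟩ : M)) ∈ (partIn B M).graph :=
      (mem_graph_partIn B M _).2 ((hR _).2 ⟨k, rfl⟩)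
    rw [LinearPMap.mem_graph_iff] at this
    obtain ⟨f, hf1, hf2⟩ := this
    exact ⟨f, congrArg Subtype.val hf1, congrArg Subtype.val hf2⟩
  have hself : IsSelfAdjoint (partIn B M) := by
    refine isSelfAdjoint_of_surjective (fun x y => ?_) (fun g => ?_) fun g => ?_
    · have hx := (mem_graph_partIn B M _).1 ((partIn B M).mem_graph x)
      have hy := (mem_graph_partIn B M _).1 ((partIn B M).mem_graph y)
      rw [LinearPMap.mem_graph_iff] at hx hy
      obtain ⟨x', hx1, hx2⟩ := hx
      obtain ⟨y', hy1, hy2⟩ := hy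
      have := hB.symm x' y'
      rw [hx2, hy2, hx1, hy1] at this
      exact this
    · obtain ⟨f, hf1, hf2⟩ := hres g g.2
      refine ⟨f, Subtype.ext ?_⟩
      rw [Submodule.coe_add, Submodule.coe_smul, hf1, hf2, sub_add_cancel]
    · obtain ⟨k, hk, hkg⟩ := hVM' g g.2
      obtain ⟨f, hf1, hf2⟩ := hres k hk
      refine ⟨f, Subtype.ext ?_⟩
      rw [Submodule.coe_sub, Submodule.coe_smul, hf1, hf2, sub_sub, ← add_smul, ← two_mul,
        ← hV, hkg]
  have hbot : M = ⊥ := by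
    by_contra hne
    exact hB.simple M hne hself
  have : u ∈ M := (hM u).2 hu
  rwa [hbot, Submodule.mem_bot] at this

end IsSimpleMaximalSymmetric

/-! ### The shift on the half-line -/

section HalfLineShift

open SchwartzMap FourierTransform

variable {N : Type*} [NormedAddCommGroup N] [InnerProductSpace ℂ N] [CompleteSpace N]

theorem integral_smul_fourier_eq {f : ℝ → N} (h₁ : Integrable f) (φ : 𝓢(ℝ, ℂ)) :
    ∫ ξ, φ ξ • 𝓕 f ξ = ∫ x, 𝓕 φ x • f x := by
  have := VectorFourier.integral_fourierIntegral_smul_eq_flip (μ := (volume : Measure ℝ))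
    (ν := (volume : Measure ℝ)) (L := innerₗ ℝ) (f := φ) (g := f) Real.continuous_fourierChar
    (by fun_prop) φ.integrable h₁
  rw [flip_innerₗ] at this
  exact this.symm

/-- The Fourier transform in `L₂` of an integrable function is given by the Fourier integral. -/
theorem fourier_toLp_ae_eq {f : ℝ → N} (h₁ : Integrable f) (h₂ : MemLp f 2 volume) :
    Lp.fourierTransformₗᵢ ℝ N (h₂.toLp f) =ᵐ[volume] 𝓕 f := by
  have hc : Continuous (𝓕 f) := VectorFourier.fourierIntegral_continuous
    Real.continuous_fourierChar (by fun_prop) h₁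
  -- Both functions are tested against smooth compactly supported `φ`: the Fourier integral by
  -- Fubini, the `L₂` transform by its agreement with the transform of tempered distributions.
  refine ae_eq_of_integral_contDiff_smul_eq (locallyIntegrable_lp _) hc.locallyIntegrable
    fun g hg hgs => ?_
  let φ : 𝓢(ℝ, ℂ) := (hgs.comp_left (g := Complex.ofReal) Complex.ofReal_zero).toSchwartzMap
    (Complex.ofRealCLM.contDiff.comp hg)
  have hφ : ∀ x, φ x = (g x : ℂ) := fun x => rfl
  have e1 : ∫ x, φ x • 𝓕 f x = ∫ x, 𝓕 φ x • f x := integral_smul_fourier_eq h₁ φ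
  have e2 : ∫ x, φ x • (Lp.fourierTransformₗᵢ ℝ N (h₂.toLp f)) x = ∫ x, 𝓕 φ x • f x := by
    have h3 := Lp.fourier_toTemperedDistribution_eq (h₂.toLp f)
    have h4 := congrArg (fun T : 𝓢'(ℝ, N) => T φ) h3
    simp only [TemperedDistribution.fourier_apply, Lp.toTemperedDistribution_apply] at h4
    refine h4.symm.trans (integral_congr_ae ?_)
    filter_upwards [h₂.coeFn_toLp] with x hx
    rw [hx]
  simp only [hφ, Complex.coe_smul] at e1 e2
  rw [e1, e2]

theorem memLp_two_indicator_exp {S : Set ℝ} (hS : MeasurableSet S) {a : ℝ}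
    (h : IntegrableOn (fun x => Real.exp (2 * a * x)) S) (c : N) :
    MemLp (S.indicator fun x => (Real.exp (a * x) : ℂ) • c) 2 volume := by
  refine (memLp_indicator_iff_restrict hS).2 ((memLp_two_iff_integrable_sq_norm ?_).2 ?_)
  · exact (Continuous.smul (by fun_prop) continuous_const).aestronglyMeasurable
  · refine (h.mul_const (‖c‖ ^ 2)).congr (Eventually.of_forall fun x => ?_)
    simp only [norm_smul, Complex.norm_real, Real.norm_eq_abs, Real.abs_exp, mul_pow]
    rw [← Real.exp_nat_mul]
    push_cast
    ring_nf

theorem integrable_indicator_exp {S : Set ℝ} (hS : MeasurableSet S) {a : ℝ}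
    (h : IntegrableOn (fun x => Real.exp (a * x)) S) (c : N) :
    Integrable (S.indicator fun x => (Real.exp (a * x) : ℂ) • c) volume := by
  rw [integrable_indicator_iff hS]
  exact h.ofReal.smul_const c

theorem fourier_indicator_exp {S : Set ℝ} (hS : MeasurableSet S) (a : ℝ) (c : N) (ξ : ℝ) :
    𝓕 (S.indicator fun x => (Real.exp (a * x) : ℂ) • c) ξ =
      (∫ x in S, Complex.exp ((a + symbol ξ * Complex.I) * x)) • c := by
  rw [Real.fourier_eq', ← integral_smul_const, ← integral_indicator hS]
  refine integral_congr_ae (Eventually.of_forall fun x => ?_)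
  by_cases hx : x ∈ S
  · simp only [Set.indicator_of_mem hx]
    rw [smul_smul, Complex.ofReal_exp, ← Complex.exp_add]
    congr 2
    simp [symbol]
    ring
  · simp [Set.indicator_of_notMem hx]

/-- The function `e^{-x} c` on the right half-line. -/
def expRight (c : N) : Lp N 2 (volume : Measure ℝ) :=
  (memLp_two_indicator_exp (a := -1) measurableSet_Ioi
    (integrableOn_exp_mul_Ioi (by norm_num) 0) c).toLp _

/-- The function `e^x c` on the left half-line. -/
def expLeft (c : N) : Lp N 2 (volume : Measure ℝ) :=
  (memLp_two_indicator_exp (a := 1) measurableSet_Iic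
    (integrableOn_exp_mul_Iic (by norm_num) 0) c).toLp _

theorem coeFn_expRight (c : N) : expRight c =ᵐ[volume]
    (Set.Ioi (0 : ℝ)).indicator fun x => (Real.exp (-1 * x) : ℂ) • c :=
  MemLp.coeFn_toLp _

theorem coeFn_expLeft (c : N) : expLeft c =ᵐ[volume]
    (Set.Iic (0 : ℝ)).indicator fun x => (Real.exp (1 * x) : ℂ) • c :=
  MemLp.coeFn_toLp _

theorem fourier_expRight (c : N) : Lp.fourierTransformₗᵢ ℝ N (expRight c) =ᵐ[volume]
    fun ξ => (Complex.I / ((symbol ξ : ℂ) + Complex.I)) • c := by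
  refine (fourier_toLp_ae_eq (integrable_indicator_exp (a := -1) measurableSet_Ioi
    (integrableOn_exp_mul_Ioi (by norm_num) 0) c) _).trans (Eventually.of_forall fun ξ => ?_)
  simp only
  rw [fourier_indicator_exp measurableSet_Ioi, integral_exp_mul_complex_Ioi (by simp)]
  congr 1
  have h1 := ofReal_add_I_ne_zero (symbol ξ)
  have h2 : ((-1 : ℝ) : ℂ) + symbol ξ * Complex.I = Complex.I * (symbol ξ + Complex.I) := by
    push_cast
    linear_combination -Complex.I_sq
  rw [h2]
  have h3 := Complex.I_ne_zero
  simp only [Complex.ofReal_zero, mul_zero, Complex.exp_zero]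
  field_simp
  linear_combination -Complex.I_sq

theorem fourier_expLeft (c : N) : Lp.fourierTransformₗᵢ ℝ N (expLeft c) =ᵐ[volume]
    fun ξ => (-(Complex.I / ((symbol ξ : ℂ) - Complex.I))) • c := by
  refine (fourier_toLp_ae_eq (integrable_indicator_exp (a := 1) measurableSet_Iic
    (integrableOn_exp_mul_Iic (by norm_num) 0) c) _).trans (Eventually.of_forall fun ξ => ?_)
  simp only
  rw [fourier_indicator_exp measurableSet_Iic, integral_exp_mul_complex_Iic (by simp)]
  congr 1
  have h1 := ofReal_sub_I_ne_zero (symbol ξ)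
  have h2 : ((1 : ℝ) : ℂ) + symbol ξ * Complex.I = Complex.I * (symbol ξ - Complex.I) := by
    push_cast
    linear_combination Complex.I_sq
  rw [h2]
  have h3 := Complex.I_ne_zero
  simp only [Complex.ofReal_zero, mul_zero, Complex.exp_zero]
  field_simp
  linear_combination Complex.I_sq

/-- The factor `t + i` cancels: `(t + i) / (t - i) · i / (t + i) = i / (t - i)`. The inverse Cayley
transform on the line thus throws `e^{-x} c` onto the left half-line, so `e^{-x} c` is orthogonal to
the range of the half-line Cayley transform. -/
theorem freqMul_star_cayley_fourier_expRight (c : N) :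
    freqMul N (fun t => starRingEnd ℂ (cayley t)) (Lp.fourierTransformₗᵢ ℝ N (expRight c)) =
      -Lp.fourierTransformₗᵢ ℝ N (expLeft c) := by
  refine Lp.ext ?_
  filter_upwards [coeFn_mulOp (memLp_top_comp_symbol memLp_top_star_cayley)
    (Lp.fourierTransformₗᵢ ℝ N (expRight c)), fourier_expRight c, fourier_expLeft c,
    Lp.coeFn_neg (Lp.fourierTransformₗᵢ ℝ N (expLeft c))] with ξ h1 h2 h3 h4
  rw [freqMul, h1, h2, h4, Pi.neg_apply, h3, smul_smul, ← neg_smul]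
  congr 1
  have h5 := ofReal_add_I_ne_zero (symbol ξ)
  have h6 := ofReal_sub_I_ne_zero (symbol ξ)
  rw [cayley, map_div₀, map_sub, map_add, Complex.conj_I, Complex.conj_ofReal, ← sub_eq_add_neg,
    sub_neg_eq_add]
  field_simp

theorem inner_expLeft_eq_zero (c : N) {u : Lp N 2 (volume : Measure ℝ)}
    (hu : u ∈ L2On N (Set.Ioi 0)) : inner ℂ (expLeft c) u = 0 := by
  rw [L2.inner_def]
  refine integral_eq_zero_of_ae ?_
  have hu' : ∀ᵐ x : ℝ, x ∉ Set.Ioi (0 : ℝ) → u x = 0 := hu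
  filter_upwards [hu', coeFn_expLeft c] with x h1 h2
  rw [h2]
  by_cases hx : x ∈ Set.Ioi (0 : ℝ)
  · rw [Set.indicator_of_notMem (by simpa using hx), inner_zero_left]; rfl
  · rw [h1 hx, inner_zero_right]; rfl

theorem expRight_mem (c : N) : expRight c ∈ L2On N (Set.Ioi 0) := by
  change ∀ᵐ x : ℝ, x ∉ Set.Ioi (0 : ℝ) → expRight c x = 0
  filter_upwards [coeFn_expRight c] with x h1 hx
  rw [h1, Set.indicator_of_notMem hx]

theorem norm_sq_expRight (c : N) : ‖expRight c‖ ^ 2 = ‖c‖ ^ 2 / 2 := by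
  rw [norm_sq_lp]
  have : ∫ x in Set.Ioi (0 : ℝ), Real.exp ((-2) * x) * ‖c‖ ^ 2 = ‖c‖ ^ 2 / 2 := by
    rw [integral_mul_const, integral_exp_mul_Ioi (by norm_num)]
    simp
    ring
  rw [← this, ← integral_indicator measurableSet_Ioi]
  refine integral_congr_ae ?_
  filter_upwards [coeFn_expRight c] with x h1
  rw [h1]
  by_cases hx : x ∈ Set.Ioi (0 : ℝ)
  · simp only [Set.indicator_of_mem hx]
    simp only [norm_smul, Complex.norm_real, Real.norm_eq_abs, Real.abs_exp, mul_pow]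
    rw [← Real.exp_nat_mul]
    push_cast
    ring_nf
  · simp [Set.indicator_of_notMem hx]

/-- The isometry `c ↦ √2 e^{-x} c` onto the wandering subspace. -/
def expIsometry (N : Type*) [NormedAddCommGroup N] [InnerProductSpace ℂ N] [CompleteSpace N] :
    N →ₗᵢ[ℂ] L2On N (Set.Ioi 0) where
  toFun c := ⟨(√2 : ℂ) • expRight c, (L2On N _).smul_mem _ (expRight_mem c)⟩
  map_add' c d := by
    refine Subtype.ext ?_
    rw [Submodule.coe_add]
    simp only
    rw [← smul_add]
    congr 1
    refine Lp.ext ?_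
    filter_upwards [coeFn_expRight c, coeFn_expRight d, coeFn_expRight (c + d),
      Lp.coeFn_add (expRight c) (expRight d)] with x h1 h2 h3 h4
    rw [h3, h4, Pi.add_apply, h1, h2]
    by_cases hx : x ∈ Set.Ioi (0 : ℝ)
    · simp only [Set.indicator_of_mem hx, smul_add]
    · simp [Set.indicator_of_notMem hx]
  map_smul' a c := by
    refine Subtype.ext ?_
    rw [RingHom.id_apply, Submodule.coe_smul]
    simp only
    rw [smul_comm]
    congr 1
    refine Lp.ext ?_
    filter_upwards [coeFn_expRight c, coeFn_expRight (a • c),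
      Lp.coeFn_smul a (expRight c)] with x h1 h2 h3
    rw [h2, h3, Pi.smul_apply, h1]
    by_cases hx : x ∈ Set.Ioi (0 : ℝ)
    · simp only [Set.indicator_of_mem hx]
      rw [smul_comm]
    · simp [Set.indicator_of_notMem hx]
  norm_map' c := by
    change ‖(√2 : ℂ) • expRight c‖ = ‖c‖
    refine (pow_left_inj₀ (norm_nonneg _) (norm_nonneg _) two_ne_zero).1 ?_
    rw [norm_smul, mul_pow, norm_sq_expRight, Complex.norm_real, Real.norm_eq_abs, sq_abs,
      Real.sq_sqrt (by norm_num)]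
    ring

/-- If `a` and `b` are orthogonal under all powers of the Cayley transform, they are pointwise
orthogonal. -/
theorem ae_inner_eq_zero {a b : Lp N 2 (volume : Measure ℝ)}
    (h₁ : ∀ n : ℕ, inner ℂ a (freqMul N (fun t => cayley t ^ n) b) = 0)
    (h₂ : ∀ n : ℕ, inner ℂ b (freqMul N (fun t => cayley t ^ n) a) = 0) :
    ∀ᵐ x, inner ℂ (a x) (b x) = 0 := by
  -- The hypotheses kill the cross terms, so `a + z b` and `a - z b` have equal Cayley moments.
  -- Their measures, and therefore their densities `‖·‖²`, coincide. Taking `z = 1` and `z = i`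
  -- gives both parts of the pointwise inner product.
  have key : ∀ z : ℂ, ∀ᵐ x, ‖(a + z • b) x‖ ^ 2 = ‖(a - z • b) x‖ ^ 2 := by
    intro z
    have hint : ∀ (n : ℕ) (u : Lp N 2 (volume : Measure ℝ)),
        ∫ t, cayley t ^ n ∂(compressFamily LinearIsometry.id).measure u =
          inner ℂ u (freqMul N (fun t => cayley t ^ n) u) := fun n u => by
      rw [integral_compressFamily_measure, freqMul,
        inner_self_mulOp (memLp_top_comp_symbol (memLp_top_cayley_pow n))]
      rfl
    have hμ : (compressFamily LinearIsometry.id).measure (a + z • b) =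
        (compressFamily LinearIsometry.id).measure (a - z • b) := by
      refine measure_ext_of_cayley fun n => ?_
      rw [hint, hint]
      simp only [map_add, map_sub, map_smul, inner_add_left, inner_add_right, inner_sub_left,
        inner_sub_right, inner_smul_left, inner_smul_right, h₁, h₂]
      ring
    rw [compressFamily_measure, compressFamily_measure] at hμ
    have hμ' := congrArg (Measure.comap symbol) hμ
    rw [measurableEmbedding_symbol.comap_map, measurableEmbedding_symbol.comap_map,
      withDensity_eq_iff_of_sigmaFinite (measurable_density _ _).aemeasurable
        (measurable_density _ _).aemeasurable] at hμ'
    filter_upwards [hμ'] with x hx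
    exact (ENNReal.ofReal_eq_ofReal_iff (by positivity) (by positivity)).1 hx
  have hre : ∀ z : ℂ, ∀ᵐ x, (z * inner ℂ (a x) (b x)).re = 0 := by
    intro z
    filter_upwards [key z, Lp.coeFn_add a (z • b), Lp.coeFn_sub a (z • b), Lp.coeFn_smul z b]
      with x h1 h2 h3 h4
    rw [h2, h3, Pi.add_apply, Pi.sub_apply, h4, Pi.smul_apply, @norm_add_sq ℂ, @norm_sub_sq ℂ,
      inner_smul_right, RCLike.re_eq_complex_re] at h1
    linarith
  filter_upwards [hre 1, hre Complex.I] with x h1 h2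
  refine Complex.ext (by simpa using h1) ?_
  simpa using h2

/-- The exceptional set depends on `c` and `N` need not be separable; the essentially separable
range of `u` reduces the matter to countably many `c`. -/
theorem ae_eq_zero_of_forall_inner_const {u : Lp N 2 (volume : Measure ℝ)}
    (h : ∀ c : N, ∀ᵐ x, inner ℂ c (u x) = 0) : u = 0 := by
  rw [Lp.eq_zero_iff_ae_eq_zero]
  obtain ⟨t, ht, hut⟩ := (Lp.stronglyMeasurable u).aestronglyMeasurable.isSeparable_ae_range
    (μ := (volume : Measure ℝ))
  refine ae_eq_zero_of_forall_dual_of_isSeparable ℂ ht (fun c => ?_) hut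
  filter_upwards [h ((InnerProductSpace.toDual ℂ N).symm c)] with x hx
  rw [InnerProductSpace.toDual_symm_apply] at hx
  exact hx

theorem fourier_cayley_halfLine (g : L2On N (Set.Ioi 0)) :
    Lp.fourierTransformₗᵢ ℝ N (g - (2 * Complex.I) • halfLineResolvent N g : L2On N (Set.Ioi 0)) =
      freqMul N cayley (Lp.fourierTransformₗᵢ ℝ N g) := by
  rw [Submodule.coe_sub, Submodule.coe_smul, map_sub, map_smul, freqMul_cayley]
  congr 2
  exact fourier_lineResolvent _

theorem isFormalAdjoint_halfLineMomentum :
    (halfLineMomentum N (Set.Ioi 0)).IsFormalAdjoint (halfLineMomentum N (Set.Ioi 0)) := by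
  refine isResolvent_halfLineMomentum.isFormalAdjoint fun g h => ?_
  rw [Submodule.coe_inner, ← (Lp.fourierTransformₗᵢ ℝ N).inner_map_map, fourier_cayley_halfLine,
    fourier_cayley_halfLine, inner_freqMul_cayley_left, freqMul_star_cayley,
    LinearIsometryEquiv.inner_map_map, Submodule.coe_inner]

/-- If `u` is orthogonal to all `Vⁿ (e^{-x} c)`, then, since each `e^{-x} c` is orthogonal to the
range of `V`, all integer Cayley moments between the transforms of `u` and `e^{-x} c` vanish. So the
two are pointwise orthogonal, and the second is a nowhere zero scalar times `c`. -/
theorem isShift_halfLine {V : L2On N (Set.Ioi 0) →ₗᵢ[ℂ] L2On N (Set.Ioi 0)}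
    (hV : ∀ g, V g = g - (2 * Complex.I) • halfLineResolvent N g) :
    IsShift V (expIsometry N) := by
  let F := Lp.fourierTransformₗᵢ ℝ N
  have hF : ∀ g : L2On N (Set.Ioi 0), F (V g) = freqMul N cayley (F g) := by
    intro g
    rw [hV]
    exact fourier_cayley_halfLine g
  have hFn : ∀ (n : ℕ) (g : L2On N (Set.Ioi 0)),
      F ((V ^ n) g : L2On N (Set.Ioi 0)) = freqMul N (fun t => cayley t ^ n) (F g) := by
    intro n g
    induction n with
    | zero =>
      simp only [pow_zero]
      rw [freqMul, mulOp_one]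
      rfl
    | succ n ih =>
      rw [pow_succ', LinearIsometry.coe_mul, Function.comp_apply, hF, ih,
        freqMul_mul memLp_top_cayley (memLp_top_cayley_pow n)]
      simp only [pow_succ']
  have hleft : ∀ (c : N) (g : L2On N (Set.Ioi 0)),
      inner ℂ (F (expRight c)) (freqMul N cayley (F g)) = 0 := by
    intro c g
    rw [← inner_conj_symm, inner_freqMul_cayley_left, freqMul_star_cayley_fourier_expRight,
      inner_neg_right, ← inner_neg_left, inner_neg_left, F.inner_map_map, ← inner_conj_symm,
      inner_expLeft_eq_zero c g.2]
    simp
  refine ⟨fun c g => ?_, fun u hu => ?_⟩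
  · rw [Submodule.coe_inner, ← F.inner_map_map, hF]
    change inner ℂ (F ((√2 : ℂ) • expRight c)) _ = 0
    rw [map_smul, inner_smul_left, hleft, mul_zero]
  · have hFu : F u = 0 := by
      refine ae_eq_zero_of_forall_inner_const fun c => ?_
      have h2 : ∀ n : ℕ, inner ℂ (F u) (freqMul N (fun t => cayley t ^ n) (F (expRight c))) = 0 := by
        intro n
        have h := hu n c
        rw [Submodule.coe_inner, ← F.inner_map_map, hFn] at h
        change inner ℂ (freqMul N _ (F ((√2 : ℂ) • expRight c))) (F u) = 0 at h
        rw [map_smul, map_smul, inner_smul_left, mul_eq_zero] at h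
        rw [← inner_conj_symm, h.resolve_left (by simp), map_zero]
      -- Positive powers on `u` come from orthogonality of `e^{-x} c` to the range of `V`; the power
      -- zero is the conjugate of the hypothesis on `u`.
      have h1 : ∀ n : ℕ, inner ℂ (F (expRight c)) (freqMul N (fun t => cayley t ^ n) (F u)) = 0 := by
        intro n
        cases n with
        | zero =>
          have := h2 0
          simp only [pow_zero] at this ⊢
          rw [freqMul, mulOp_one] at this ⊢
          rw [← inner_conj_symm]
          exact (congrArg _ this).trans (map_zero _)
        | succ n =>
          have := hleft c ((V ^ n) u)
          rw [hFn, freqMul_mul memLp_top_cayley (memLp_top_cayley_pow n)] at this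
          simpa only [pow_succ'] using this
      filter_upwards [ae_inner_eq_zero h1 h2, fourier_expRight c] with x h3 h4
      rw [h4, inner_smul_left, mul_eq_zero] at h3
      refine h3.resolve_left ?_
      rw [map_eq_zero]
      exact div_ne_zero Complex.I_ne_zero (ofReal_add_I_ne_zero _)
    exact Subtype.ext ((map_eq_zero_iff F F.injective).1 hFu)

end HalfLineShift

theorem IsShift.exists_eq_conj {N : Type*} [NormedAddCommGroup N] [InnerProductSpace ℂ N]
    [CompleteSpace N] {H : Type*} [NormedAddCommGroup H] [InnerProductSpace ℂ H] [CompleteSpace H]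
    {B : H →ₗ.[ℂ] H} {R : H →L[ℂ] H} (hR : IsResolvent B R) {V : H →ₗᵢ[ℂ] H}
    (hV : ∀ g, V g = g - (2 * Complex.I) • R g) {j : N →ₗᵢ[ℂ] H} (h : IsShift V j) :
    ∃ Ξ : H ≃ₗᵢ[ℂ] L2On N (Set.Ioi 0), B = conj Ξ (halfLineMomentum N (Set.Ioi 0)) := by
  have hS := isResolvent_halfLineMomentum (N := N)
  obtain ⟨V₀, hV₀⟩ := hS.exists_isometry isFormalAdjoint_halfLineMomentum
  obtain ⟨Ξ, hΞ⟩ := h.exists_intertwining (isShift_halfLine hV₀)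
  refine ⟨Ξ, hR.eq_conj hS Ξ fun g => ?_⟩
  rw [← hV, hΞ, hV₀]

/-- A simple maximal symmetric operator is `i d/dx` on a half-line, up to unitary equivalence. -/
theorem IsSimpleMaximalSymmetric.exists_eq_conj {H : Type u} [NormedAddCommGroup H]
    [InnerProductSpace ℂ H] [CompleteSpace H] {B : H →ₗ.[ℂ] H}
    (hB : IsSimpleMaximalSymmetric B) :
    ∃ (N : Type u) (_ : NormedAddCommGroup N) (_ : InnerProductSpace ℂ N) (_ : CompleteSpace N)
      (Ξp : H ≃ₗᵢ[ℂ] L2On N (Set.Ioi 0)), B = conj Ξp (halfLineMomentum N (Set.Ioi 0)) := by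
  obtain ⟨R, hR⟩ := hB.exists_resolvent
  obtain ⟨V, hV⟩ := hR.exists_isometry hB.symm
  exact ⟨_, _, _, inferInstance, (hB.isShift hR hV).exists_eq_conj hR hV⟩

end Plesner

end

theorem lemma5p1
    {H : Type u} [NormedAddCommGroup H] [InnerProductSpace ℂ H] [CompleteSpace H]
    (B : H →ₗ.[ℂ] H) (hB : Plesner.IsSimpleMaximalSymmetric B) :
    -- `B` has exactly one spectral function `E`, and `ψ(B) = ∫ ψ dE` for all `ψ ∈ H^∞(ℂ₊)`
    (∃ E : Plesner.SpectralFamily H, Plesner.IsSpectralFunction B E ∧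
      (∀ E' : Plesner.SpectralFamily H, Plesner.IsSpectralFunction B E' → E' = E) ∧
      ∀ ψ : ℂ → ℂ, Plesner.IsHInfty ψ →
        E.IsIntegral (Plesner.boundary ψ) (Plesner.funCalc B ψ)) ∧
    -- `B` is unitarily equivalent to `i d/dx` on the half-line, so that there are operators `A`
    (∃ (N : Type u) (_ : NormedAddCommGroup N) (_ : InnerProductSpace ℂ N) (_ : CompleteSpace N)
      (Ξp : H ≃ₗᵢ[ℂ] Plesner.L2On N (Set.Ioi 0)),
      B = Plesner.conj Ξp (Plesner.halfLineMomentum N (Set.Ioi 0))) ∧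
    -- for every such equivalence `Ξ₊`, and every `B'`, `Ξ₋` on the other half-line, the operator
    -- `A = Ξ⁻¹ (i d/dx) Ξ` is a self-adjoint extension of `B' ⊕ B` and `ψ(A) f = ψ(B) f` on `H`
    (∀ (N : Type v) [NormedAddCommGroup N] [InnerProductSpace ℂ N] [CompleteSpace N]
      (H' : Type w) [NormedAddCommGroup H'] [InnerProductSpace ℂ H'] [CompleteSpace H']
      (B' : H' →ₗ.[ℂ] H')
      (Ξm : H' ≃ₗᵢ[ℂ] Plesner.L2On N (Set.Iio 0)) (Ξp : H ≃ₗᵢ[ℂ] Plesner.L2On N (Set.Ioi 0)),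
      B' = Plesner.conj Ξm (Plesner.halfLineMomentum N (Set.Iio 0)) →
      B = Plesner.conj Ξp (Plesner.halfLineMomentum N (Set.Ioi 0)) →
      IsSelfAdjoint (Plesner.extensionA Ξm Ξp) ∧
      (∀ (x' : B'.domain) (x : B.domain),
        ∃ h : WithLp.toLp 2 ((x' : H'), (x : H)) ∈ (Plesner.extensionA Ξm Ξp).domain,
          Plesner.extensionA Ξm Ξp ⟨_, h⟩ = WithLp.toLp 2 (B' x', B x)) ∧
      (∃ E : Plesner.SpectralFamily (WithLp 2 (H' × H)),
        Plesner.IsSpectralFunction (Plesner.extensionA Ξm Ξp) E ∧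
        (∀ E' : Plesner.SpectralFamily (WithLp 2 (H' × H)),
          Plesner.IsSpectralFunction (Plesner.extensionA Ξm Ξp) E' → E' = E) ∧
        E.IsOrthogonal ∧
        ∀ ψ : ℂ → ℂ, Plesner.IsHInfty ψ →
          E.IsIntegral (Plesner.boundary ψ) (Plesner.funCalc (Plesner.extensionA Ξm Ξp) ψ)) ∧
      ∀ ψ : ℂ → ℂ, Plesner.IsHInfty ψ → ∀ f : H,
        Plesner.funCalc (Plesner.extensionA Ξm Ξp) ψ (WithLp.toLp 2 ((0 : H'), f)) =
          WithLp.toLp 2 ((0 : H'), Plesner.funCalc B ψ f)) ∧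
    -- (a) the operators `ψ(B)` commute
    (∀ ψ₁ ψ₂ : ℂ → ℂ, Plesner.IsHInfty ψ₁ → Plesner.IsHInfty ψ₂ →
      Plesner.funCalc B ψ₁ ∘L Plesner.funCalc B ψ₂ =
        Plesner.funCalc B ψ₂ ∘L Plesner.funCalc B ψ₁) ∧
    -- (b) `ψ(B)` is isometric for inner `ψ`
    (∀ ψ : ℂ → ℂ, Plesner.IsInner ψ → Isometry (Plesner.funCalc B ψ)) ∧
    -- (c) `ψ(B) = (B + i)⁻¹`, defined on all of `H`, for `ψ(δ) = 1 / (δ + i)`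
    (∀ f g : H, Plesner.funCalc B (fun δ => 1 / (δ + Complex.I)) f = g ↔
      ∃ hg : g ∈ B.domain, B ⟨g, hg⟩ + Complex.I • g = f) ∧
    -- (d) `ψ(B)` commutes with `B`
    (∀ ψ : ℂ → ℂ, Plesner.IsHInfty ψ → ∀ f : B.domain,
      ∃ h : Plesner.funCalc B ψ (f : H) ∈ B.domain,
        B ⟨Plesner.funCalc B ψ (f : H), h⟩ = Plesner.funCalc B ψ (B f)) := by
  -- One realization suffices for the statements about `B` alone. The assertion for arbitrary `Ξ₋`
  -- and `Ξ₊` is proved from those unitaries themselves.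
  obtain ⟨N, _, _, _, Ξ, hΞ⟩ := hB.exists_eq_conj
  have hm := Plesner.isModel_halfLine Ξ
  rw [← hΞ] at hm
  refine ⟨⟨_, hm.existsUnique_spectralFunction⟩, ⟨N, _, _, inferInstance, Ξ, hΞ⟩, ?_,
    fun ψ₁ ψ₂ h₁ h₂ => hm.funCalc_comm h₁ h₂, fun ψ hψ => hm.isometry_funCalc hψ,
    fun f g => hm.funCalc_resolvent_apply_eq_iff f g, fun ψ hψ f => hm.funCalc_apply_comm hψ f⟩
  intro N _ _ _ H' _ _ _ B' Ξm Ξp hB' hBp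
  subst hB' hBp
  have hA := Plesner.isModel_line (Plesner.glue Ξm Ξp)
  have hs := Plesner.surjective_fourier_comp_glue Ξm Ξp
  obtain ⟨h1, h2, h3⟩ := hA.existsUnique_spectralFunction
  exact ⟨hA.isSelfAdjoint hs, Plesner.extensionA_apply Ξm Ξp,
    ⟨_, h1, h2, Plesner.compressFamily_isOrthogonal hs, h3⟩,
    fun ψ hψ f => Plesner.funCalc_extensionA Ξm Ξp hψ f⟩
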